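/- Work over $\mathbb{C}$, and let $\mathbb{P}^3$ and $(\mathbb{P}^3)^*$ be projective $3$-space and its dual, whose points are the planes in $\mathbb{P}^3$. All closures are Zariski closures, and $T_x(X)$ denotes the embedded tangent space of a variety $X$ at a point $x \in X$. For a line $L \subset \mathbb{P}^3$, let $L^\vee \subset (\mathbb{P}^3)^*$ be the dual line, consisting of all planes that contain $L$. For a set $\Sigma$ of lines in $\mathbb{P}^3$, put $\Sigma^\perp := \{L^\vee : L \in \Sigma\}$; this is the image of $\Sigma$ under the natural isomorphism $\mathrm{Gr}(1,\mathbb{P}^3) \cong \mathrm{Gr}(1,(\mathbb{P}^3)^*)$. Let $C \subset \mathbb{P}^3$ be a nondegenerate (not contained in a plane) irreducible smooth projective curve. Let $\operatorname{Sec}(C) \subset \mathrm{Gr}(1,\mathbb{P}^3)$ be the closure of the set of lines that meet $C$ in two distinct points, and let the dual surface $C^\vee \subset (\mathbb{P}^3)^*$ be the closure of the set of planes that contain $T_x(C)$ for some $x \in C$. For an irreducible surface $S$ in a projective $3$-space, let $\operatorname{Bit}(S)$ be the closure of the set of lines $L$ for which there are distinct smooth points $x, y \in S$ with $x, y \in L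 \subset T_x(S) \cap T_y(S)$, and let $\operatorname{Infl}(S)$ be the closure of the set of lines that intersect $S$ with multiplicity at least $3$ at some smooth point of $S$ (a line contained in $S$ intersects $S$ with infinite multiplicity at each of its points). Then $$\operatorname{Sec}(C)^\perp = \operatorname{Bit}(C^\vee), \qquad \{T_x(C) : x \in C\}^\perp = \operatorname{Infl}(C^\vee), \qquad \operatorname{Infl}(C^\vee) \subset \operatorname{Bit}(C^\vee).$$ -/

import Mathlib

open MvPolynomial

noncomputable section

namespace SpaceCurve

/-- Complex projective space of dimension `n`, as the set of its closed points. -/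
abbrev ProjSpace (n : ℕ) : Type := Projectivization ℂ (Fin (n + 1) → ℂ)

/-- The dual projective space. In the coordinates given by the dual basis, the point
`(a₀ : … : aₙ)` is the hyperplane `a₀ x₀ + … + aₙ xₙ = 0`. -/
abbrev DualProjSpace (n : ℕ) : Type := ProjSpace n

/-- A polynomial (used for homogeneous ones only) vanishes at a point of projective space. -/
def VanishesAt {n : ℕ} (f : MvPolynomial (Fin (n + 1)) ℂ) (x : ProjSpace n) : Prop :=
  eval x.rep f = 0

/-- The homogeneous elements of the homogeneous ideal of a set `X` in projective space. -/
def homogeneousVanishing {n : ℕ} (X : Set (ProjSpace n)) :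
    Set (MvPolynomial (Fin (n + 1)) ℂ) :=
  {f | (∃ d : ℕ, f.IsHomogeneous d) ∧ ∀ x ∈ X, VanishesAt f x}

/-- The Zariski topology on projective space: the sets `f ≠ 0`, for `f` homogeneous, form a
basis. -/
instance zariskiTopology (n : ℕ) : TopologicalSpace (ProjSpace n) :=
  TopologicalSpace.generateFrom
    {U | ∃ (d : ℕ) (f : MvPolynomial (Fin (n + 1)) ℂ), f.IsHomogeneous d ∧
      U = {x | ¬ VanishesAt f x}}

/-- The affine cone over the embedded tangent space of `X` at `x`: all `y` with
`∑ ∂f/∂xᵢ(x) yᵢ = 0` for every `f` in the homogeneous ideal of `X`. -/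
def embeddedTangent {n : ℕ} (X : Set (ProjSpace n)) (x : ProjSpace n) :
    Submodule ℂ (Fin (n + 1) → ℂ) where
  carrier := {y | ∀ f ∈ homogeneousVanishing X, ∑ i, eval x.rep (pderiv i f) * y i = 0}
  add_mem' := by
    intro a b ha hb f hf
    have h1 := ha f hf
    have h2 := hb f hf
    simp only [Pi.add_apply, mul_add, Finset.sum_add_distrib, h1, h2, add_zero]
  zero_mem' := by
    intro f _
    simp
  smul_mem' := by
    intro c a ha f hf
    have h1 := ha f hf
    have h2 : ∑ i, eval x.rep (pderiv i f) * (c • a) i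
        = c * ∑ i, eval x.rep (pderiv i f) * a i := by
      rw [Finset.mul_sum]
      refine Finset.sum_congr rfl fun i _ => ?_
      simp only [Pi.smul_apply, smul_eq_mul]
      ring
    rw [h2, h1, mul_zero]

/-- `x` is a smooth point of the irreducible variety `X`: it lies on `X`, and the embedded
tangent space of `X` at `x` has the dimension of `X` (its affine cone has one more). -/
def IsSmoothPoint {n : ℕ} (X : Set (ProjSpace n)) (x : ProjSpace n) : Prop :=
  x ∈ X ∧ ((Module.finrank ℂ (embeddedTangent X x) : ℕ) : WithBot ℕ∞) = topologicalKrullDim X + 1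

/-- A projective curve: an irreducible Zariski closed subset of dimension one. -/
structure IsIrreducibleCurve {n : ℕ} (C : Set (ProjSpace n)) : Prop where
  isClosed : IsClosed C
  isIrreducible : IsIrreducible C
  dim_eq_one : topologicalKrullDim C = 1

/-- `X` is contained in no hyperplane. -/
def IsNondegenerate {n : ℕ} (X : Set (ProjSpace n)) : Prop :=
  ∀ a : Fin (n + 1) → ℂ, a ≠ 0 → ∃ x ∈ X, a ⬝ᵥ x.rep ≠ 0

/-- The dual variety: the Zariski closure of the set of all hyperplanes that contain the
embedded tangent space of `X` at some smooth point of `X`. -/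
def dualVariety {n : ℕ} (X : Set (ProjSpace n)) : Set (DualProjSpace n) :=
  closure {h | ∃ x, IsSmoothPoint X x ∧ ∀ y ∈ embeddedTangent X x, h.rep ⬝ᵥ y = 0}

/-- The Grassmannian of lines in projective `n`-space. -/
def LineGr (n : ℕ) : Type :=
  {W : Submodule ℂ (Fin (n + 1) → ℂ) // Module.finrank ℂ W = 2}

/-- Indices of Plücker coordinates. -/
abbrev PluckerIndex (n : ℕ) : Type := {p : Fin (n + 1) × Fin (n + 1) // p.1 < p.2}

/-- The `2 × 2` minors of the matrix with rows `u`, `v`. -/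
def minors {n : ℕ} (u v : Fin (n + 1) → ℂ) : PluckerIndex n → ℂ :=
  fun p => u p.1.1 * v p.1.2 - u p.1.2 * v p.1.1

/-- A polynomial (used for homogeneous ones only) in the Plücker coordinates vanishes at a line.
The minors of two bases of the same line differ by a nonzero factor. -/
def VanishesAtLine {n : ℕ} (F : MvPolynomial (PluckerIndex n) ℂ) (L : LineGr n) : Prop :=
  ∀ u v : Fin (n + 1) → ℂ, Submodule.span ℂ {u, v} = L.1 → eval (minors u v) F = 0

/-- The Zariski topology on the Grassmannian, induced by the Plücker embedding. -/
instance zariskiTopologyLine (n : ℕ) : TopologicalSpace (LineGr n) :=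
  TopologicalSpace.generateFrom
    {U | ∃ (d : ℕ) (F : MvPolynomial (PluckerIndex n) ℂ), F.IsHomogeneous d ∧
      U = {L | ¬ VanishesAtLine F L}}

/-- The point `x` lies on the line `L`. -/
def OnLine {n : ℕ} (x : ProjSpace n) (L : LineGr n) : Prop := x.submodule ≤ L.1

/-- The secant locus of `X`: the Zariski closure of the set of lines that meet `X` in two
distinct smooth points. -/
def Sec {n : ℕ} (X : Set (ProjSpace n)) : Set (LineGr n) :=
  closure {L | ∃ x y, x ≠ y ∧ IsSmoothPoint X x ∧ IsSmoothPoint X y ∧ OnLine x L ∧ OnLine y L}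

/-- The set of tangent lines of a smooth curve `C`. -/
def tangentLines {n : ℕ} (C : Set (ProjSpace n)) : Set (LineGr n) :=
  {L | ∃ x ∈ C, L.1 = embeddedTangent C x}

/-- The bitangent locus of a surface `S`: the Zariski closure of the set of lines that are
tangent to `S` at two distinct smooth points. -/
def Bit {n : ℕ} (S : Set (ProjSpace n)) : Set (LineGr n) :=
  closure {L | ∃ x y, x ≠ y ∧ IsSmoothPoint S x ∧ IsSmoothPoint S y ∧ OnLine x L ∧ OnLine y L ∧
    L.1 ≤ embeddedTangent S x ∧ L.1 ≤ embeddedTangent S y}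

/-- The restriction of `f` to the line through `x` and `v`, in the affine parameter `t` of the
point `x + t v`. -/
def restrictToLine {n : ℕ} (f : MvPolynomial (Fin (n + 1)) ℂ) (x v : Fin (n + 1) → ℂ) :
    Polynomial ℂ :=
  aeval (fun i => Polynomial.C (x i) + Polynomial.X * Polynomial.C (v i)) f

/-- The multiplicity with which the line `L` meets `S` at its point `x`: the least order of
vanishing at `x` of the restrictions to `L` of the elements of the homogeneous ideal of `S`. It is
`⊤` if `L` is contained in `S`. (For `v` proportional to `x` the order is zero or `⊤`, the latter
if `x ∈ S`.) -/
def lineMultiplicity {n : ℕ} (L : LineGr n) (S : Set (ProjSpace n)) (x : ProjSpace n) : ℕ∞ :=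
  ⨅ f ∈ homogeneousVanishing S, ⨅ v ∈ L.1,
    emultiplicity (Polynomial.X : Polynomial ℂ) (restrictToLine f x.rep v)

/-- The inflectional locus of a surface `S`: the Zariski closure of the set of lines that meet `S`
at a smooth point with multiplicity at least three. -/
def Infl {n : ℕ} (S : Set (ProjSpace n)) : Set (LineGr n) :=
  closure {L | ∃ x, IsSmoothPoint S x ∧ OnLine x L ∧ 3 ≤ lineMultiplicity L S x}

/-- The standard bilinear form, which pairs the coordinates of projective space with those of its
dual. -/
def stdForm : LinearMap.BilinForm ℂ (Fin 4 → ℂ) := dotProductBilin ℂ ℂ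

lemma stdForm_isRefl : stdForm.IsRefl := by
  intro x y h
  simpa [stdForm, dotProductBilin, dotProduct_comm] using h

lemma stdForm_nondegenerate : stdForm.Nondegenerate := by
  refine (LinearMap.IsRefl.nondegenerate_iff_separatingLeft stdForm_isRefl).2 ?_
  intro x hx
  exact dotProduct_eq_zero x
    (fun y => by simpa [stdForm, dotProductBilin, dotProduct_comm] using hx y)

/-- The dual line of `L`: all hyperplanes that contain `L`. -/
def dualLine (L : LineGr 3) : LineGr 3 :=
  ⟨stdForm.orthogonal L.1, by
    rw [LinearMap.BilinForm.finrank_orthogonal stdForm_nondegenerate, L.2]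
    simp⟩

lemma mem_dualLine (L : LineGr 3) (a : Fin 4 → ℂ) :
    a ∈ (dualLine L).1 ↔ ∀ x ∈ L.1, a ⬝ᵥ x = 0 := by
  simp only [dualLine, LinearMap.BilinForm.mem_orthogonal_iff]
  refine forall₂_congr fun x _ => ?_
  rw [dotProduct_comm]
  rfl

/-- The natural bijection between the lines of projective `3`-space and those of its dual. -/
def perp : LineGr 3 ≃ LineGr 3 where
  toFun := dualLine
  invFun := dualLine
  left_inv L := Subtype.ext
    (LinearMap.BilinForm.orthogonal_orthogonal stdForm_nondegenerate stdForm_isRefl L.1)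
  right_inv L := Subtype.ext
    (LinearMap.BilinForm.orthogonal_orthogonal stdForm_nondegenerate stdForm_isRefl L.1)

end SpaceCurve

end

/-! Everything takes place on the affine cone over `C`, with prime ideal `I`. At a nonzero point `v`
of the cone the tangent space `tang I v` is a plane in `ℂ⁴`; its annihilator `nrm I v` consists of
the gradients at `v` of elements of `I`, and it is the cone over the line dual to the tangent line
at `v`. The dual surface is therefore ruled by the lines `nrm I v`; elimination theory shows that
their union is already closed.

The core is biduality (`grad_dualIdeal_mul`): if `F` vanishes on the dual surface and `h ∈ nrm I v`,
then `grad F h` is a multiple of `v`. Indeed `grad F h` lies in `tang I v`, because `F` vanishes on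
the linear space `nrm I v`; differentiating the relation `F (grad f) = 0` along the curve shows that
it also kills `hess f v t`, which for general `f` and `v` singles out the multiples of `v` in the
tangent plane. This needs a nonzero second fundamental form (`exists_hess_ne_zero`): otherwise the
normal planes would be constant and `C` would lie in a plane. Hence at a smooth point of the dual
surface on the ruling of `v` the tangent plane is the plane dual to `v`.

Bitangents: a line tangent at smooth points on the rulings of `v` and `w` is dual to the secant
through `v` and `w`, or, if the two rulings agree, is itself that ruling, dual to a tangent line,
which is a limit of secants (`eval_minors_tang`). Conversely, for a general secant through `x` and
`y`, the plane tangent at `x` through `y` and the plane tangent at `y` through `x` are distinct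
smooth points of the dual surface, and the dual line is tangent at both. General means outside a
proper closed subset of `C × C`, which is irreducible.

Inflectional lines: a line with contact of order three at a smooth point follows a direction on
which the first and second differentials of an equation vanish. Differentiating biduality shows that
the only such direction is the ruling (`mem_nrm_of_hess_eq_zero`). Conversely rulings lie in the
surface, and a general one contains a smooth point. Tangent lines form a closed set, so no further
closure is needed. The last inclusion dualizes the fact that tangent lines are limits of secants.

Two facts about the local ring of the smooth curve support this: a ratio of forms with zero
differential is constant (`sub_C_mul_mem`), and chords through a point tend to the tangent there. -/

noncomputable section

namespace SpaceCurve

/-! ### Forms, affine cones and the Zariski topology -/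

section

variable {n : ℕ}

/-- The gradient of `f` at `v`. -/
def grad {σ : Type*} (f : MvPolynomial σ ℂ) (v : σ → ℂ) : σ → ℂ := fun i => eval v (pderiv i f)

lemma eval_smul_of_isHomogeneous {σ : Type*} {f : MvPolynomial σ ℂ} {d : ℕ}
    (hf : f.IsHomogeneous d) (c : ℂ) (v : σ → ℂ) : eval (c • v) f = c ^ d * eval v f := by
  classical
  rw [eval_eq, eval_eq, Finset.mul_sum]
  refine Finset.sum_congr rfl fun s hs => ?_
  have hd : ∑ i ∈ s.support, s i = d := (hf.degree_eq_sum_deg_support hs).symm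
  simp only [Pi.smul_apply, smul_eq_mul, mul_pow, Finset.prod_mul_distrib,
    Finset.prod_pow_eq_pow_sum, hd]
  ring

lemma isHomogeneous_pderiv {σ : Type*} {f : MvPolynomial σ ℂ} {d : ℕ}
    (hf : f.IsHomogeneous d) (i : σ) : (pderiv i f).IsHomogeneous (d - 1) := hf.pderiv

/-- The vanishing of all `f (c • v)` forces that of the homogeneous components at `v`. -/
lemma eval_homogeneousComponent_eq_zero {σ : Type*} {f : MvPolynomial σ ℂ} {v : σ → ℂ}
    (h : ∀ c : ℂ, c ≠ 0 → eval (c • v) f = 0) (d : ℕ) :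
    eval v (homogeneousComponent d f) = 0 := by
  -- As a function of `c`, the value at `c • v` is a polynomial whose coefficients are the values of
  -- the components at `v`; it has infinitely many roots.
  set p : Polynomial ℂ := ∑ i ∈ Finset.range (f.totalDegree + 1),
    Polynomial.monomial i (eval v (homogeneousComponent i f)) with hp
  have hev : ∀ c : ℂ, p.eval c = eval (c • v) f := by
    intro c
    conv_rhs => rw [← sum_homogeneousComponent f]
    rw [hp, Polynomial.eval_finsetSum, map_sum]
    refine Finset.sum_congr rfl fun i _ => ?_
    rw [Polynomial.eval_monomial,
      eval_smul_of_isHomogeneous (homogeneousComponent_isHomogeneous i f), mul_comm]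
  have hp0 : p = 0 := by
    refine Polynomial.eq_zero_of_infinite_isRoot p ?_
    refine (Set.infinite_univ.sdiff (Set.finite_singleton (0 : ℂ))).mono fun c hc => ?_
    have : c ≠ 0 := by simpa using hc
    exact (hev c).trans (h c this)
  by_cases hd : d < f.totalDegree + 1
  · have := congrArg (fun q => Polynomial.coeff q d) hp0
    simpa [hp, Polynomial.finsetSum_coeff, Polynomial.coeff_monomial, hd] using this
  · rw [homogeneousComponent_eq_zero _ _ (by omega), map_zero]

/-- The affine cone over a subset of projective space. -/
def cone (X : Set (ProjSpace n)) : Set (Fin (n + 1) → ℂ) := {v | ∃ x ∈ X, ∃ c : ℂ, v = c • x.rep}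

/-- The ideal of the affine cone over `X`. -/
def coneIdeal (X : Set (ProjSpace n)) : Ideal (MvPolynomial (Fin (n + 1)) ℂ) :=
  vanishingIdeal ℂ (cone X)

lemma mem_coneIdeal {X : Set (ProjSpace n)} {f : MvPolynomial (Fin (n + 1)) ℂ} :
    f ∈ coneIdeal X ↔ ∀ v ∈ cone X, eval v f = 0 := by
  simp [coneIdeal, mem_vanishingIdeal_iff]

lemma smul_mem_cone {X : Set (ProjSpace n)} {v : Fin (n + 1) → ℂ} (hv : v ∈ cone X) (c : ℂ) :
    c • v ∈ cone X := by
  obtain ⟨x, hx, a, rfl⟩ := hv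
  exact ⟨x, hx, c * a, by rw [mul_smul]⟩

lemma rep_mem_cone {X : Set (ProjSpace n)} {x : ProjSpace n} (hx : x ∈ X) : x.rep ∈ cone X :=
  ⟨x, hx, 1, by simp⟩

lemma mem_cone_iff {X : Set (ProjSpace n)} {v : Fin (n + 1) → ℂ} (hv : v ≠ 0) :
    v ∈ cone X ↔ Projectivization.mk ℂ v hv ∈ X := by
  constructor
  · rintro ⟨x, hx, c, rfl⟩
    have hc : c ≠ 0 := by rintro rfl; simp at hv
    have : Projectivization.mk ℂ (c • x.rep) hv = x := by
      conv_rhs => rw [← x.mk_rep]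
      rw [Projectivization.mk_eq_mk_iff']
      exact ⟨c, rfl⟩
    rwa [this]
  · intro h
    obtain ⟨a, ha⟩ := Projectivization.exists_smul_eq_mk_rep ℂ v hv
    refine ⟨_, h, (a⁻¹ : ℂˣ), ?_⟩
    rw [← ha]
    exact (inv_smul_smul a v).symm

lemma vanishesAt_mk {f : MvPolynomial (Fin (n + 1)) ℂ} {d : ℕ} (hf : f.IsHomogeneous d)
    {v : Fin (n + 1) → ℂ} (hv : v ≠ 0) :
    VanishesAt f (Projectivization.mk ℂ v hv) ↔ eval v f = 0 := by
  obtain ⟨a, ha⟩ := Projectivization.exists_smul_eq_mk_rep ℂ v hv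
  have : eval (a • v) f = (a : ℂ) ^ d * eval v f := eval_smul_of_isHomogeneous hf a v
  rw [VanishesAt, ← ha, this]
  simp

lemma homogeneousVanishing_subset_coneIdeal {X : Set (ProjSpace n)}
    {f : MvPolynomial (Fin (n + 1)) ℂ} (hf : f ∈ homogeneousVanishing X) : f ∈ coneIdeal X := by
  obtain ⟨⟨d, hd⟩, h⟩ := hf
  rw [mem_coneIdeal]
  rintro _ ⟨x, hx, c, rfl⟩
  have h1 : eval x.rep f = 0 := h x hx
  rw [eval_smul_of_isHomogeneous hd, h1, mul_zero]

lemma mem_homogeneousVanishing_of_coneIdeal {X : Set (ProjSpace n)}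
    {f : MvPolynomial (Fin (n + 1)) ℂ} (hf : f ∈ coneIdeal X) {d : ℕ} (hd : f.IsHomogeneous d) :
    f ∈ homogeneousVanishing X :=
  ⟨⟨d, hd⟩, fun _ hx => mem_coneIdeal.1 hf _ (rep_mem_cone hx)⟩

lemma homogeneousComponent_mem_coneIdeal {X : Set (ProjSpace n)}
    {f : MvPolynomial (Fin (n + 1)) ℂ} (hf : f ∈ coneIdeal X) (d : ℕ) :
    homogeneousComponent d f ∈ coneIdeal X := by
  rw [mem_coneIdeal] at hf ⊢
  exact fun v hv => eval_homogeneousComponent_eq_zero (fun c _ => hf _ (smul_mem_cone hv c)) d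

lemma coneIdeal_anti {X Y : Set (ProjSpace n)} (h : X ⊆ Y) : coneIdeal Y ≤ coneIdeal X := by
  intro f hf
  rw [mem_coneIdeal] at hf ⊢
  rintro v ⟨x, hx, hv⟩
  exact hf v ⟨x, h hx, hv⟩

/-- A product of forms is a form, so the generating sets are stable under intersection. This allows
closures to be tested on single forms. -/
lemma isTopologicalBasis_proj (n : ℕ) : TopologicalSpace.IsTopologicalBasis
    {U : Set (ProjSpace n) | ∃ (d : ℕ) (f : MvPolynomial (Fin (n + 1)) ℂ), f.IsHomogeneous d ∧
      U = {x | ¬ VanishesAt f x}} := by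
  have hinter : ∀ ⦃s : Set (ProjSpace n)⦄, s ∈ {U : Set (ProjSpace n) | ∃ (d : ℕ)
      (f : MvPolynomial (Fin (n + 1)) ℂ), f.IsHomogeneous d ∧ U = {x | ¬ VanishesAt f x}} →
      ∀ ⦃t⦄, t ∈ {U : Set (ProjSpace n) | ∃ (d : ℕ)
      (f : MvPolynomial (Fin (n + 1)) ℂ), f.IsHomogeneous d ∧ U = {x | ¬ VanishesAt f x}} →
      s ∩ t ∈ {U : Set (ProjSpace n) | ∃ (d : ℕ)
      (f : MvPolynomial (Fin (n + 1)) ℂ), f.IsHomogeneous d ∧ U = {x | ¬ VanishesAt f x}} := by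
    rintro _ ⟨d, f, hf, rfl⟩ _ ⟨e, g, hg, rfl⟩
    refine ⟨d + e, f * g, hf.mul hg, ?_⟩
    ext x
    simp [VanishesAt]
  have := TopologicalSpace.isTopologicalBasis_of_subbasis_of_inter
    (t := zariskiTopology n) rfl hinter
  convert! this using 1
  symm
  refine Set.insert_eq_of_mem ⟨0, 1, isHomogeneous_one _ _, ?_⟩
  ext x
  simp [VanishesAt]

lemma mem_closure_iff_vanishesAt {X : Set (ProjSpace n)} {x : ProjSpace n} :
    x ∈ closure X ↔ ∀ f ∈ homogeneousVanishing X, VanishesAt f x := by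
  rw [(isTopologicalBasis_proj n).mem_closure_iff]
  constructor
  · rintro h f ⟨⟨d, hd⟩, hf⟩
    by_contra hx
    obtain ⟨y, hy, hyX⟩ := h _ ⟨d, f, hd, rfl⟩ hx
    exact hy (hf y hyX)
  · rintro h _ ⟨d, f, hd, rfl⟩ hx
    by_contra hne
    rw [Set.not_nonempty_iff_eq_empty] at hne
    refine hx (h f ⟨⟨d, hd⟩, fun y hy => ?_⟩)
    by_contra hy'
    exact Set.notMem_empty y (hne ▸ ⟨hy', hy⟩)

lemma isClosed_setOf_vanishesAt {f : MvPolynomial (Fin (n + 1)) ℂ} {d : ℕ}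
    (hf : f.IsHomogeneous d) : IsClosed {x : ProjSpace n | VanishesAt f x} := by
  rw [← isOpen_compl_iff]
  exact (isTopologicalBasis_proj n).isOpen ⟨d, f, hf, rfl⟩

lemma mem_of_isClosed {X : Set (ProjSpace n)} (hX : IsClosed X) {x : ProjSpace n}
    (h : ∀ f ∈ homogeneousVanishing X, VanishesAt f x) : x ∈ X := by
  rw [← hX.closure_eq]
  exact mem_closure_iff_vanishesAt.2 h

lemma coneIdeal_isHomogeneous (X : Set (ProjSpace n)) :
    letI := MvPolynomial.gradedAlgebra (σ := Fin (n + 1)) (R := ℂ)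
    (coneIdeal X).IsHomogeneous (homogeneousSubmodule (Fin (n + 1)) ℂ) := by
  intro d f hf
  have := homogeneousComponent_mem_coneIdeal hf d
  rwa [← decomposition.decompose'_apply] at this

lemma coneIdeal_ne_top {X : Set (ProjSpace n)} (hX : X.Nonempty) : coneIdeal X ≠ ⊤ := by
  rw [Ideal.ne_top_iff_one]
  intro h
  obtain ⟨x, hx⟩ := hX
  simpa using mem_coneIdeal.1 h _ (rep_mem_cone hx)

/-- For a homogeneous ideal primality need only be tested on forms, and two forms outside the ideal
give two nonempty open subsets of `X`, which must meet. -/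
lemma coneIdeal_isPrime {X : Set (ProjSpace n)} (hX : IsIrreducible X) :
    (coneIdeal X).IsPrime := by
  let _ := MvPolynomial.gradedAlgebra (σ := Fin (n + 1)) (R := ℂ)
  refine (coneIdeal_isHomogeneous X).isPrime_of_homogeneous_mem_or_mem
    (coneIdeal_ne_top hX.nonempty) ?_
  rintro f g ⟨d, hd⟩ ⟨e, he⟩ hfg
  by_contra! hcon
  have key : ∀ {f : MvPolynomial (Fin (n + 1)) ℂ} {d : ℕ}, f.IsHomogeneous d → f ∉ coneIdeal X →
      (X ∩ {x | ¬ VanishesAt f x}).Nonempty := by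
    intro f d hd hf
    by_contra hne
    rw [Set.not_nonempty_iff_eq_empty] at hne
    refine hf (homogeneousVanishing_subset_coneIdeal ⟨⟨d, hd⟩, fun x hx => ?_⟩)
    by_contra hx'
    exact Set.notMem_empty x (hne ▸ ⟨hx, hx'⟩)
  obtain ⟨x, hx, hfx, hgx⟩ := hX.isPreirreducible _ _
    ((isTopologicalBasis_proj n).isOpen ⟨d, f, hd, rfl⟩)
    ((isTopologicalBasis_proj n).isOpen ⟨e, g, he, rfl⟩) (key hd hcon.1) (key he hcon.2)
  have h0 := mem_coneIdeal.1 hfg _ (rep_mem_cone hx)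
  rw [map_mul, mul_eq_zero] at h0
  exact h0.elim hfx hgx

lemma isIrreducible_of_coneIdeal {X : Set (ProjSpace n)} (hX : X.Nonempty)
    (h : ∀ f g : MvPolynomial (Fin (n + 1)) ℂ, f * g ∈ coneIdeal X →
      f ∈ coneIdeal X ∨ g ∈ coneIdeal X) : IsIrreducible X := by
  refine ⟨hX, fun u v hu hv hXu hXv => ?_⟩
  obtain ⟨x, hxX, hxu⟩ := hXu
  obtain ⟨y, hyX, hyv⟩ := hXv
  obtain ⟨_, ⟨d, f, hd, rfl⟩, hxf, hfu⟩ := (isTopologicalBasis_proj n).exists_subset_of_mem_open hxu hu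
  obtain ⟨_, ⟨e, g, he, rfl⟩, hyg, hgv⟩ := (isTopologicalBasis_proj n).exists_subset_of_mem_open hyv hv
  by_contra hne
  have hfg : f * g ∈ coneIdeal X := by
    refine homogeneousVanishing_subset_coneIdeal ⟨⟨d + e, hd.mul he⟩, fun z hz => ?_⟩
    by_contra hz'
    refine hne ⟨z, hz, hfu ?_, hgv ?_⟩
    · intro h0
      have : eval z.rep f = 0 := h0
      exact hz' (by simp [VanishesAt, this])
    · intro h0
      have : eval z.rep g = 0 := h0
      exact hz' (by simp [VanishesAt, this])
  rcases h f g hfg with h | h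
  · exact hxf (mem_coneIdeal.1 h _ (rep_mem_cone hxX))
  · exact hyg (mem_coneIdeal.1 h _ (rep_mem_cone hyX))

/-! ### Tangent spaces from the full ideal of the cone -/

/-- The vectors annihilated by the differentials at `v` of all elements of `I`. -/
def tang {σ : Type*} [Fintype σ] (I : Ideal (MvPolynomial σ ℂ)) (v : σ → ℂ) :
    Submodule ℂ (σ → ℂ) where
  carrier := {y | ∀ f ∈ I, grad f v ⬝ᵥ y = 0}
  add_mem' ha hb f hf := by rw [dotProduct_add, ha f hf, hb f hf, add_zero]
  zero_mem' f _ := dotProduct_zero _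
  smul_mem' c a ha f hf := by rw [dotProduct_smul, ha f hf, smul_zero]

lemma mem_tang {σ : Type*} [Fintype σ] {I : Ideal (MvPolynomial σ ℂ)} {v y : σ → ℂ} :
    y ∈ tang I v ↔ ∀ f ∈ I, grad f v ⬝ᵥ y = 0 := Iff.rfl

lemma grad_add {σ : Type*} (f g : MvPolynomial σ ℂ) (v : σ → ℂ) :
    grad (f + g) v = grad f v + grad g v := by
  ext i; simp [grad]

lemma grad_sum {σ ι : Type*} (s : Finset ι) (f : ι → MvPolynomial σ ℂ) (v : σ → ℂ) :
    grad (∑ i ∈ s, f i) v = ∑ i ∈ s, grad (f i) v := by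
  ext i; simp [grad]

lemma grad_mul {σ : Type*} (f g : MvPolynomial σ ℂ) (v : σ → ℂ) :
    grad (f * g) v = eval v f • grad g v + eval v g • grad f v := by
  ext i; simp [grad]

lemma grad_C {σ : Type*} (c : ℂ) (v : σ → ℂ) : grad (C c) v = 0 := by
  ext i; simp [grad]

lemma grad_smul_of_isHomogeneous {σ : Type*} {f : MvPolynomial σ ℂ} {d : ℕ}
    (hf : f.IsHomogeneous d) (c : ℂ) (v : σ → ℂ) : grad f (c • v) = c ^ (d - 1) • grad f v := by
  ext i
  simp [grad, eval_smul_of_isHomogeneous (isHomogeneous_pderiv hf i)]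

/-- Frees the tangent space from the chosen representative and from the restriction to forms:
rescaling the point rescales the gradient of a form by a nonzero factor, and the ideal contains the
components of its elements. -/
lemma embeddedTangent_eq_tang {X : Set (ProjSpace n)} {v : Fin (n + 1) → ℂ} (hv : v ≠ 0) :
    embeddedTangent X (Projectivization.mk ℂ v hv) = tang (coneIdeal X) v := by
  obtain ⟨a, ha⟩ := Projectivization.exists_smul_eq_mk_rep ℂ v hv
  have ha' : (Projectivization.mk ℂ v hv).rep = (a : ℂ) • v := ha.symm
  ext y
  have h1 : y ∈ embeddedTangent X (Projectivization.mk ℂ v hv) ↔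
      ∀ f ∈ homogeneousVanishing X, grad f v ⬝ᵥ y = 0 := by
    refine forall₂_congr fun f hf => ?_
    obtain ⟨⟨d, hd⟩, -⟩ := hf
    have : ∑ i, eval (Projectivization.mk ℂ v hv).rep (pderiv i f) * y i
        = (a : ℂ) ^ (d - 1) * (grad f v ⬝ᵥ y) := by
      rw [ha']
      change grad f ((a : ℂ) • v) ⬝ᵥ y = _
      rw [grad_smul_of_isHomogeneous hd, smul_dotProduct, smul_eq_mul]
    rw [this]
    simp
  rw [h1, mem_tang]
  constructor
  · intro h f hf
    rw [← sum_homogeneousComponent f, grad_sum, sum_dotProduct]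
    refine Finset.sum_eq_zero fun i _ => h _ ?_
    exact mem_homogeneousVanishing_of_coneIdeal (homogeneousComponent_mem_coneIdeal hf i)
      (homogeneousComponent_isHomogeneous i f)
  · exact fun h f hf => h f (homogeneousVanishing_subset_coneIdeal hf)

/-! ### Lines and their Plücker coordinates -/

lemma minors_comb (u v : Fin (n + 1) → ℂ) (a b c d : ℂ) :
    minors (a • u + b • v) (c • u + d • v) = (a * d - b * c) • minors u v := by
  ext p
  simp only [minors, Pi.add_apply, Pi.smul_apply, smul_eq_mul]
  ring

lemma minors_ne_zero {u v : Fin (n + 1) → ℂ} (h : LinearIndependent ℂ ![u, v]) :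
    minors u v ≠ 0 := by
  intro h0
  have hall : ∀ i j, u i * v j = u j * v i := by
    intro i j
    rcases lt_trichotomy i j with hij | rfl | hij
    · have := congrFun h0 ⟨(i, j), hij⟩
      simp only [minors, Pi.zero_apply] at this
      linear_combination this
    · ring
    · have := congrFun h0 ⟨(j, i), hij⟩
      simp only [minors, Pi.zero_apply] at this
      linear_combination -this
  rw [LinearIndependent.pair_iff] at h
  have hu : ∀ j, u j = 0 := by
    intro j
    have := h (v j) (-u j) (by
      ext i
      simp only [Pi.add_apply, Pi.smul_apply, smul_eq_mul, Pi.zero_apply]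
      linear_combination hall i j)
    simpa using this.2
  have hu0 : u = 0 := funext hu
  have := h 1 0 (by simp [hu0])
  simp at this

lemma linearIndependent_of_minors_ne_zero {u v : Fin (n + 1) → ℂ} (h : minors u v ≠ 0) :
    LinearIndependent ℂ ![u, v] := by
  rw [LinearIndependent.pair_iff]
  intro s t hst
  have hi : ∀ i, s * u i + t * v i = 0 := fun i => by simpa using congrFun hst i
  obtain ⟨p, hp⟩ := Function.ne_iff.1 h
  simp only [minors, Pi.zero_apply] at hp
  constructor
  · refine (mul_eq_zero.1 ?_).resolve_right hp
    linear_combination v p.1.2 * hi p.1.1 - v p.1.1 * hi p.1.2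
  · refine (mul_eq_zero.1 ?_).resolve_right hp
    linear_combination u p.1.1 * hi p.1.2 - u p.1.2 * hi p.1.1

lemma finrank_span_pair {V : Type*} [AddCommGroup V] [Module ℂ V] {u v : V}
    (h : LinearIndependent ℂ ![u, v]) :
    Module.finrank ℂ (Submodule.span ℂ {u, v}) = 2 := by
  have := finrank_span_eq_card h
  rwa [Matrix.range_cons_cons_empty, Fintype.card_fin] at this

lemma linearIndependent_of_finrank_span_pair {V : Type*} [AddCommGroup V] [Module ℂ V]
    {u v : V} (h : Module.finrank ℂ (Submodule.span ℂ {u, v}) = 2) :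
    LinearIndependent ℂ ![u, v] := by
  rw [linearIndependent_iff_card_eq_finrank_span]
  rw [Set.finrank, Matrix.range_cons_cons_empty, h, Fintype.card_fin]

lemma span_pair_eq_of_mem {V : Type*} [AddCommGroup V] [Module ℂ V] {u v : V}
    (h : LinearIndependent ℂ ![u, v]) {W : Submodule ℂ V}
    (hW : Module.finrank ℂ W = 2) (hu : u ∈ W) (hv : v ∈ W) :
    Submodule.span ℂ {u, v} = W := by
  have : FiniteDimensional ℂ W := Module.finite_of_finrank_pos (by omega)
  refine Submodule.eq_of_le_of_finrank_eq ?_ (by rw [finrank_span_pair h, hW])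
  rw [Submodule.span_le]
  rintro x (rfl | rfl) <;> assumption

lemma exists_basis_pair {V : Type*} [AddCommGroup V] [Module ℂ V] {W : Submodule ℂ V}
    (hW : Module.finrank ℂ W = 2) : ∃ u v : V, LinearIndependent ℂ ![u, v] ∧
      u ∈ W ∧ v ∈ W ∧ Submodule.span ℂ {u, v} = W := by
  have : FiniteDimensional ℂ W := Module.finite_of_finrank_pos (by omega)
  let b := Module.finBasisOfFinrankEq ℂ W hW
  have hli : LinearIndependent ℂ ![(b 0 : V), (b 1 : V)] := by
    have h1 := b.linearIndependent.map' W.subtype (Submodule.ker_subtype W)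
    have h2 : ![(b 0 : V), (b 1 : V)] = W.subtype ∘ b := by
      funext i
      fin_cases i <;> rfl
    rwa [h2]
  exact ⟨b 0, b 1, hli, (b 0).2, (b 1).2, span_pair_eq_of_mem hli hW (b 0).2 (b 1).2⟩

lemma exists_minors_eq_smul {u v a b : Fin (n + 1) → ℂ}
    (ha : a ∈ Submodule.span ℂ {u, v}) (hb : b ∈ Submodule.span ℂ {u, v}) :
    ∃ c : ℂ, minors a b = c • minors u v := by
  obtain ⟨r, s, rfl⟩ := Submodule.mem_span_pair.1 ha
  obtain ⟨t, w, rfl⟩ := Submodule.mem_span_pair.1 hb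
  exact ⟨_, minors_comb u v r s t w⟩

/-- Minors of two bases are proportional, so a single basis suffices to test a form. -/
lemma vanishesAtLine_iff {F : MvPolynomial (PluckerIndex n) ℂ} {d : ℕ} (hF : F.IsHomogeneous d)
    {L : LineGr n} {u v : Fin (n + 1) → ℂ} (huv : Submodule.span ℂ {u, v} = L.1) :
    VanishesAtLine F L ↔ eval (minors u v) F = 0 := by
  refine ⟨fun h => h u v huv, fun h a b hab => ?_⟩
  obtain ⟨c, hc⟩ := exists_minors_eq_smul (u := u) (v := v) (a := a) (b := b)
    (by rw [huv, ← hab]; exact Submodule.subset_span (by simp))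
    (by rw [huv, ← hab]; exact Submodule.subset_span (by simp))
  rw [hc, eval_smul_of_isHomogeneous hF, h, mul_zero]

lemma isTopologicalBasis_line (n : ℕ) : TopologicalSpace.IsTopologicalBasis
    {U : Set (LineGr n) | ∃ (d : ℕ) (F : MvPolynomial (PluckerIndex n) ℂ), F.IsHomogeneous d ∧
      U = {L | ¬ VanishesAtLine F L}} := by
  have hinter : ∀ ⦃s : Set (LineGr n)⦄, s ∈ {U : Set (LineGr n) | ∃ (d : ℕ)
      (F : MvPolynomial (PluckerIndex n) ℂ), F.IsHomogeneous d ∧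
      U = {L | ¬ VanishesAtLine F L}} →
      ∀ ⦃t⦄, t ∈ {U : Set (LineGr n) | ∃ (d : ℕ)
      (F : MvPolynomial (PluckerIndex n) ℂ), F.IsHomogeneous d ∧
      U = {L | ¬ VanishesAtLine F L}} →
      s ∩ t ∈ {U : Set (LineGr n) | ∃ (d : ℕ)
      (F : MvPolynomial (PluckerIndex n) ℂ), F.IsHomogeneous d ∧
      U = {L | ¬ VanishesAtLine F L}} := by
    rintro _ ⟨d, f, hf, rfl⟩ _ ⟨e, g, hg, rfl⟩
    refine ⟨d + e, f * g, hf.mul hg, ?_⟩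
    ext L
    obtain ⟨u, v, -, -, -, huv⟩ := exists_basis_pair L.2
    simp [vanishesAtLine_iff hf huv, vanishesAtLine_iff hg huv,
      vanishesAtLine_iff (hf.mul hg) huv]
  have := TopologicalSpace.isTopologicalBasis_of_subbasis_of_inter
    (t := zariskiTopologyLine n) rfl hinter
  convert! this using 1
  symm
  refine Set.insert_eq_of_mem ⟨0, 1, isHomogeneous_one _ _, ?_⟩
  ext L
  obtain ⟨u, v, -, -, -, huv⟩ := exists_basis_pair L.2
  simp [vanishesAtLine_iff (isHomogeneous_one _ _) huv]

lemma mem_closure_iff_vanishesAtLine {X : Set (LineGr n)} {L : LineGr n} :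
    L ∈ closure X ↔ ∀ (F : MvPolynomial (PluckerIndex n) ℂ) (d : ℕ), F.IsHomogeneous d →
      (∀ M ∈ X, VanishesAtLine F M) → VanishesAtLine F L := by
  rw [(isTopologicalBasis_line n).mem_closure_iff]
  constructor
  · rintro h F d hd hF
    by_contra hx
    obtain ⟨y, hy, hyX⟩ := h _ ⟨d, F, hd, rfl⟩ hx
    exact hy (hF y hyX)
  · rintro h _ ⟨d, F, hd, rfl⟩ hx
    by_contra hne
    rw [Set.not_nonempty_iff_eq_empty] at hne
    refine hx (h F d hd fun M hM => ?_)
    by_contra hM'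
    exact Set.notMem_empty M (hne ▸ ⟨hM', hM⟩)

lemma onLine_mk {v : Fin (n + 1) → ℂ} (hv : v ≠ 0) {L : LineGr n} :
    OnLine (Projectivization.mk ℂ v hv) L ↔ v ∈ L.1 := by
  rw [OnLine, Projectivization.submodule_mk, Submodule.span_singleton_le_iff_mem]

end

/-! ### The cone over a space curve, its tangent and normal planes -/

/-- The linear form with coefficient vector `a`. -/
def lin {m : ℕ} (a : Fin m → ℂ) : MvPolynomial (Fin m) ℂ := ∑ i, C (a i) * X i

@[simp] lemma eval_lin {m : ℕ} (a v : Fin m → ℂ) : eval v (lin a) = a ⬝ᵥ v := by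
  simp [lin, dotProduct]

@[simp] lemma pderiv_lin {m : ℕ} (a : Fin m → ℂ) (i : Fin m) : pderiv i (lin a) = C (a i) := by
  simp [lin, pderiv_X, Pi.single_apply]

@[simp] lemma grad_lin {m : ℕ} (a v : Fin m → ℂ) : grad (lin a) v = a := by
  ext i; simp [grad]

lemma isHomogeneous_lin {m : ℕ} (a : Fin m → ℂ) : (lin a).IsHomogeneous 1 :=
  IsHomogeneous.sum _ _ _ fun i _ => isHomogeneous_C_mul_X (a i) i

lemma lin_add {m : ℕ} (a b : Fin m → ℂ) : lin (a + b) = lin a + lin b := by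
  simp [lin, add_mul, Finset.sum_add_distrib]

lemma lin_smul {m : ℕ} (c : ℂ) (a : Fin m → ℂ) : lin (c • a) = C c * lin a := by
  simp [lin, Finset.mul_sum, mul_assoc]

lemma lin_sum {m : ℕ} {ι : Type*} (s : Finset ι) (a : ι → Fin m → ℂ) :
    lin (∑ i ∈ s, a i) = ∑ i ∈ s, lin (a i) := by
  classical
  induction s using Finset.induction_on with
  | empty => simp [lin]
  | insert i s hi ih => rw [Finset.sum_insert hi, Finset.sum_insert hi, lin_add, ih]

lemma dotProduct_grad_self {m d : ℕ} {f : MvPolynomial (Fin m) ℂ} (hf : f.IsHomogeneous d)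
    (v : Fin m → ℂ) : grad f v ⬝ᵥ v = d * eval v f := by
  have := congrArg (eval v) hf.sum_X_mul_pderiv
  simpa [dotProduct, grad, mul_comm] using this

/-- The data of the affine cone `Z` over a smooth nondegenerate space curve, and its ideal `I`. -/
structure IsCurveCone (I : Ideal (MvPolynomial (Fin 4) ℂ)) (Z : Set (Fin 4 → ℂ)) : Prop where
  mem_iff : ∀ f, f ∈ I ↔ ∀ v ∈ Z, eval v f = 0
  smul_mem : ∀ v ∈ Z, ∀ c : ℂ, c • v ∈ Z
  isPrime : I.IsPrime
  mem_of_forall : ∀ v, (∀ f ∈ I, eval v f = 0) → v ∈ Z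
  finrank_tang : ∀ v ∈ Z, v ≠ 0 → Module.finrank ℂ (tang I v) = 2
  nondegenerate : ∀ a : Fin 4 → ℂ, a ≠ 0 → ∃ v ∈ Z, a ⬝ᵥ v ≠ 0
  finite_zeros : ∀ f, (∃ d, f.IsHomogeneous d) → f ∉ I → ∃ T : Set (Fin 4 → ℂ), T.Finite ∧
    ∀ v ∈ Z, v ≠ 0 → eval v f = 0 → ∃ t ∈ T, ∃ c : ℂ, c ≠ 0 ∧ v = c • t

/-- The differentials at `v` of the elements of `I`. -/
def nrm (I : Ideal (MvPolynomial (Fin 4) ℂ)) (v : Fin 4 → ℂ) : Submodule ℂ (Fin 4 → ℂ) where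
  carrier := {h | ∃ f ∈ I, grad f v = h}
  add_mem' := by
    rintro _ _ ⟨f, hf, rfl⟩ ⟨g, hg, rfl⟩
    exact ⟨f + g, I.add_mem hf hg, grad_add f g v⟩
  zero_mem' := ⟨0, I.zero_mem, by ext i; simp [grad]⟩
  smul_mem' := by
    rintro c _ ⟨f, hf, rfl⟩
    exact ⟨C c * f, I.mul_mem_left _ hf, by simp [grad_mul, grad_C]⟩

lemma orthogonal_nrm (I : Ideal (MvPolynomial (Fin 4) ℂ)) (v : Fin 4 → ℂ) :
    stdForm.orthogonal (nrm I v) = tang I v := by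
  ext y
  rw [LinearMap.BilinForm.mem_orthogonal_iff, mem_tang]
  constructor
  · intro h f hf
    exact h _ ⟨f, hf, rfl⟩
  · rintro h _ ⟨f, hf, rfl⟩
    exact h f hf

lemma orthogonal_tang (I : Ideal (MvPolynomial (Fin 4) ℂ)) (v : Fin 4 → ℂ) :
    stdForm.orthogonal (tang I v) = nrm I v := by
  rw [← orthogonal_nrm, LinearMap.BilinForm.orthogonal_orthogonal stdForm_nondegenerate
    stdForm_isRefl]

/-- Double annihilators in finite dimension: every covector that kills the tangent space is the
gradient of a single element of `I`. -/
lemma mem_nrm_iff {I : Ideal (MvPolynomial (Fin 4) ℂ)} {v h : Fin 4 → ℂ} :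
    h ∈ nrm I v ↔ ∀ y ∈ tang I v, h ⬝ᵥ y = 0 := by
  rw [← orthogonal_tang, LinearMap.BilinForm.mem_orthogonal_iff]
  refine forall₂_congr fun y _ => ?_
  rw [dotProduct_comm]
  rfl

lemma grad_mem_nrm {I : Ideal (MvPolynomial (Fin 4) ℂ)} {f : MvPolynomial (Fin 4) ℂ}
    (hf : f ∈ I) (v : Fin 4 → ℂ) : grad f v ∈ nrm I v := ⟨f, hf, rfl⟩

namespace IsCurveCone

variable {I : Ideal (MvPolynomial (Fin 4) ℂ)} {Z : Set (Fin 4 → ℂ)} (hI : IsCurveCone I Z)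
include hI

lemma eval_eq_zero {f : MvPolynomial (Fin 4) ℂ} (hf : f ∈ I) {v : Fin 4 → ℂ} (hv : v ∈ Z) :
    eval v f = 0 := (hI.mem_iff f).1 hf v hv

lemma homogeneousComponent_mem {f : MvPolynomial (Fin 4) ℂ} (hf : f ∈ I) (d : ℕ) :
    homogeneousComponent d f ∈ I := by
  rw [hI.mem_iff] at hf ⊢
  exact fun v hv => eval_homogeneousComponent_eq_zero (fun c _ => hf _ (hI.smul_mem v hv c)) d

lemma exists_mem_ne_zero : ∃ v ∈ Z, v ≠ 0 := by
  obtain ⟨v, hv, h⟩ := hI.nondegenerate (Pi.single 0 1) (by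
    intro h
    simpa using congrFun h 0)
  exact ⟨v, hv, by rintro rfl; simp at h⟩

lemma lin_mem_iff {a : Fin 4 → ℂ} : lin a ∈ I ↔ a = 0 := by
  constructor
  · intro h
    by_contra ha
    obtain ⟨v, hv, hav⟩ := hI.nondegenerate a ha
    exact hav (by simpa using hI.eval_eq_zero h hv)
  · rintro rfl
    simp [lin]

/-- The vertex of the cone imposes nothing new: the constant term of `f` vanishes because `f`
vanishes at all nonzero multiples of a nonzero point. -/
lemma mem_of_forall_ne_zero {f : MvPolynomial (Fin 4) ℂ}
    (h : ∀ v ∈ Z, v ≠ 0 → eval v f = 0) : f ∈ I := by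
  rw [hI.mem_iff]
  intro v hv
  by_cases hv0 : v = 0
  · obtain ⟨w, hw, hw0⟩ := hI.exists_mem_ne_zero
    have := eval_homogeneousComponent_eq_zero
      (fun c hc => h _ (hI.smul_mem w hw c) (smul_ne_zero hc hw0)) 0
    rw [homogeneousComponent_zero, eval_C] at this
    rw [hv0, ← coe_aeval_eq_eval]
    simpa [aeval_zero', constantCoeff_eq] using this
  · exact h v hv hv0

/-- Euler's formula, applied to each homogeneous component. -/
lemma self_mem_tang {v : Fin 4 → ℂ} (hv : v ∈ Z) : v ∈ tang I v := by
  intro f hf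
  rw [← sum_homogeneousComponent f, grad_sum, sum_dotProduct]
  refine Finset.sum_eq_zero fun i _ => ?_
  rw [dotProduct_grad_self (homogeneousComponent_isHomogeneous i f),
    hI.eval_eq_zero (hI.homogeneousComponent_mem hf i) hv, mul_zero]

lemma finrank_nrm {v : Fin 4 → ℂ} (hv : v ∈ Z) (hv0 : v ≠ 0) :
    Module.finrank ℂ (nrm I v) = 2 := by
  rw [← orthogonal_tang, LinearMap.BilinForm.finrank_orthogonal stdForm_nondegenerate,
    hI.finrank_tang v hv hv0]
  simp

lemma dotProduct_self_of_mem_nrm {v h : Fin 4 → ℂ} (hv : v ∈ Z) (hh : h ∈ nrm I v) :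
    h ⬝ᵥ v = 0 := mem_nrm_iff.1 hh v (hI.self_mem_tang hv)

/-- Two homogeneous elements of the ideal cut out the tangent line at a point. -/
lemma exists_pair {v : Fin 4 → ℂ} (hv : v ∈ Z) (hv0 : v ≠ 0) :
    ∃ g₁ ∈ I, ∃ g₂ ∈ I, (∃ d, g₁.IsHomogeneous d) ∧ (∃ d, g₂.IsHomogeneous d) ∧
      LinearIndependent ℂ ![grad g₁ v, grad g₂ v] := by
  have key : ∀ W : Submodule ℂ (Fin 4 → ℂ),
      (∀ g ∈ I, (∃ d, g.IsHomogeneous d) → grad g v ∈ W) → nrm I v ≤ W := by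
    rintro W hW _ ⟨f, hf, rfl⟩
    rw [← sum_homogeneousComponent f, grad_sum]
    exact W.sum_mem fun i _ =>
      hW _ (hI.homogeneousComponent_mem hf i) ⟨i, homogeneousComponent_isHomogeneous i f⟩
  have h2 := hI.finrank_nrm hv hv0
  obtain ⟨g₁, hg₁, hd₁, hne⟩ : ∃ g ∈ I, (∃ d, g.IsHomogeneous d) ∧ grad g v ≠ 0 := by
    by_contra! hcon
    have := key ⊥ (fun g hg hd => by simpa using hcon g hg hd)
    rw [le_bot_iff] at this
    rw [this] at h2
    simp at h2
  obtain ⟨g₂, hg₂, hd₂, hnot⟩ : ∃ g ∈ I, (∃ d, g.IsHomogeneous d) ∧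
      grad g v ∉ Submodule.span ℂ {grad g₁ v} := by
    by_contra! hcon
    have := Submodule.finrank_mono (key (Submodule.span ℂ {grad g₁ v}) hcon)
    rw [h2, finrank_span_singleton hne] at this
    omega
  refine ⟨g₁, hg₁, g₂, hg₂, hd₁, hd₂, ?_⟩
  rw [LinearIndependent.pair_iff' hne]
  exact fun a ha => hnot (Submodule.mem_span_singleton.2 ⟨a, ha⟩)

lemma span_grad_eq {v : Fin 4 → ℂ} (hv : v ∈ Z) (hv0 : v ≠ 0) {g₁ g₂ : MvPolynomial (Fin 4) ℂ}
    (h₁ : g₁ ∈ I) (h₂ : g₂ ∈ I) (hli : LinearIndependent ℂ ![grad g₁ v, grad g₂ v]) :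
    Submodule.span ℂ {grad g₁ v, grad g₂ v} = nrm I v :=
  span_pair_eq_of_mem hli (hI.finrank_nrm hv hv0) ⟨g₁, h₁, rfl⟩ ⟨g₂, h₂, rfl⟩

lemma mem_tang_of_pair {v y : Fin 4 → ℂ} (hv : v ∈ Z) (hv0 : v ≠ 0)
    {g₁ g₂ : MvPolynomial (Fin 4) ℂ} (h₁ : g₁ ∈ I) (h₂ : g₂ ∈ I)
    (hli : LinearIndependent ℂ ![grad g₁ v, grad g₂ v])
    (hy₁ : grad g₁ v ⬝ᵥ y = 0) (hy₂ : grad g₂ v ⬝ᵥ y = 0) : y ∈ tang I v := by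
  intro f hf
  have : grad f v ∈ Submodule.span ℂ {grad g₁ v, grad g₂ v} := by
    rw [hI.span_grad_eq hv hv0 h₁ h₂ hli]
    exact ⟨f, hf, rfl⟩
  obtain ⟨a, b, hab⟩ := Submodule.mem_span_pair.1 this
  rw [← hab, add_dotProduct, smul_dotProduct, smul_dotProduct, hy₁, hy₂]
  simp

end IsCurveCone

/-! ### Determinants and cofactor vectors -/

/-- The determinant of four vectors in dimension four. -/
def det4 {A : Type*} [CommRing A] (a b c d : Fin 4 → A) : A := (Matrix.of ![a, b, c, d]).det

/-- The cofactor vector of three vectors in dimension four. -/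
def cof {A : Type*} [CommRing A] (a b c : Fin 4 → A) : Fin 4 → A :=
  fun i => det4 a b c (Pi.single i 1)

lemma det4_eq {A : Type*} [CommRing A] (a b c d : Fin 4 → A) : det4 a b c d =
    (a 0 * b 1 - a 1 * b 0) * (c 2 * d 3 - c 3 * d 2)
    - (a 0 * b 2 - a 2 * b 0) * (c 1 * d 3 - c 3 * d 1)
    + (a 0 * b 3 - a 3 * b 0) * (c 1 * d 2 - c 2 * d 1)
    + (a 1 * b 2 - a 2 * b 1) * (c 0 * d 3 - c 3 * d 0)
    - (a 1 * b 3 - a 3 * b 1) * (c 0 * d 2 - c 2 * d 0)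
    + (a 2 * b 3 - a 3 * b 2) * (c 0 * d 1 - c 1 * d 0) := by
  simp [det4, Matrix.det_succ_row_zero, Fin.sum_univ_succ, Fin.succAbove]
  ring

lemma cof_dotProduct {A : Type*} [CommRing A] (a b c d : Fin 4 → A) :
    cof a b c ⬝ᵥ d = det4 a b c d := by
  simp [cof, dotProduct, Fin.sum_univ_four, det4_eq]
  ring

lemma map_det4 {A B : Type*} [CommRing A] [CommRing B] (φ : A →+* B) (a b c d : Fin 4 → A) :
    φ (det4 a b c d) = det4 (φ ∘ a) (φ ∘ b) (φ ∘ c) (φ ∘ d) := by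
  simp [det4_eq]

lemma map_cof {A B : Type*} [CommRing A] [CommRing B] (φ : A →+* B) (a b c : Fin 4 → A)
    (i : Fin 4) : φ (cof a b c i) = cof (φ ∘ a) (φ ∘ b) (φ ∘ c) i := by
  rw [cof, cof, map_det4]
  congr 1
  ext k
  simp [Pi.single_apply, apply_ite φ]

lemma cof_dotProduct_left {A : Type*} [CommRing A] (a b c : Fin 4 → A) :
    cof a b c ⬝ᵥ a = 0 := by
  rw [cof_dotProduct, det4_eq]; ring

lemma cof_dotProduct_mid {A : Type*} [CommRing A] (a b c : Fin 4 → A) :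
    cof a b c ⬝ᵥ b = 0 := by
  rw [cof_dotProduct, det4_eq]; ring

lemma cof_dotProduct_right {A : Type*} [CommRing A] (a b c : Fin 4 → A) :
    cof a b c ⬝ᵥ c = 0 := by
  rw [cof_dotProduct, det4_eq]; ring

lemma linearIndependent_of_det4_ne_zero {a b c d : Fin 4 → ℂ} (h : det4 a b c d ≠ 0) :
    LinearIndependent ℂ ![a, b, c, d] := Matrix.linearIndependent_rows_of_det_ne_zero h

lemma det4_ne_zero_of_linearIndependent {a b c d : Fin 4 → ℂ}
    (h : LinearIndependent ℂ ![a, b, c, d]) : det4 a b c d ≠ 0 := by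
  have : IsUnit (Matrix.of ![a, b, c, d]) := Matrix.linearIndependent_rows_iff_isUnit.1 h
  exact ((Matrix.isUnit_iff_isUnit_det _).1 this).ne_zero

lemma cof_eq_zero_of_not_linearIndependent {a b : Fin 4 → ℂ}
    (h : ¬ LinearIndependent ℂ ![a, b]) (c : Fin 4 → ℂ) : cof a b c = 0 := by
  funext i
  by_contra h0
  apply h
  have h1 := linearIndependent_of_det4_ne_zero h0
  have h2 := h1.comp ![0, 1] (by intro i j; fin_cases i <;> fin_cases j <;> simp)
  have h3 : ![a, b] = ![a, b, c, Pi.single i 1] ∘ ![0, 1] := by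
    funext i
    fin_cases i <;> rfl
  rwa [h3]

lemma linearIndependent_triple {a b c : Fin 4 → ℂ} (h : LinearIndependent ℂ ![a, b])
    (hc : c ∉ Submodule.span ℂ {a, b}) : LinearIndependent ℂ ![a, b, c] := by
  have h1 := (linearIndependent_finSnoc (x := c)).2
    ⟨h, by rwa [Matrix.range_cons_cons_empty]⟩
  have h2 : ![a, b, c] = Fin.snoc (α := fun _ => Fin 4 → ℂ) ![a, b] c := by
    funext i
    fin_cases i <;> rfl
  rwa [h2]

lemma exists_det4_ne_zero {a b c : Fin 4 → ℂ} (h : LinearIndependent ℂ ![a, b, c]) :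
    ∃ d, det4 a b c d ≠ 0 := by
  obtain ⟨d, hd⟩ := exists_linearIndependent_snoc_of_lt_finrank h (by simp)
  refine ⟨d, det4_ne_zero_of_linearIndependent ?_⟩
  have h2 : ![a, b, c, d] = Fin.snoc (α := fun _ => Fin 4 → ℂ) ![a, b, c] d := by
    funext i
    fin_cases i <;> rfl
  rwa [h2]

lemma cof_ne_zero {a b c : Fin 4 → ℂ} (h : LinearIndependent ℂ ![a, b, c]) :
    cof a b c ≠ 0 := by
  obtain ⟨d, hd⟩ := exists_det4_ne_zero h
  intro h0
  rw [← cof_dotProduct, h0, zero_dotProduct] at hd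
  exact hd rfl

/-! ### Tangent vector fields on the cone -/

/-- A polynomial vector field, evaluated at a point. -/
def vecEval (τ : Fin 4 → MvPolynomial (Fin 4) ℂ) (v : Fin 4 → ℂ) : Fin 4 → ℂ :=
  fun i => eval v (τ i)

/-- The derivation of the polynomial ring given by a vector field. -/
def vder (τ : Fin 4 → MvPolynomial (Fin 4) ℂ) :
    Derivation ℂ (MvPolynomial (Fin 4) ℂ) (MvPolynomial (Fin 4) ℂ) := mkDerivation ℂ τ

lemma vder_eq (τ : Fin 4 → MvPolynomial (Fin 4) ℂ) (f : MvPolynomial (Fin 4) ℂ) :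
    vder τ f = ∑ i, τ i * pderiv i f := by
  induction f using MvPolynomial.induction_on with
  | C a => simp [vder]
  | add p q hp hq => simp only [map_add, mul_add, Finset.sum_add_distrib, hp, hq]
  | mul_X p i hp =>
    rw [Derivation.leibniz, hp, vder, mkDerivation_X]
    simp only [Derivation.leibniz, smul_eq_mul, mul_add, Finset.sum_add_distrib, pderiv_X,
      Pi.single_apply, Finset.mul_sum]
    congr 1
    · simp [mul_comm]
    · exact Finset.sum_congr rfl fun j _ => by ring

lemma eval_vder (τ : Fin 4 → MvPolynomial (Fin 4) ℂ) (f : MvPolynomial (Fin 4) ℂ)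
    (v : Fin 4 → ℂ) : eval v (vder τ f) = grad f v ⬝ᵥ vecEval τ v := by
  rw [vder_eq]
  simp [dotProduct, grad, vecEval, mul_comm]

namespace IsCurveCone

variable {I : Ideal (MvPolynomial (Fin 4) ℂ)} {Z : Set (Fin 4 → ℂ)} (hI : IsCurveCone I Z)
include hI

/-- A polynomial vector field tangent to the cone which is not radial at a given point. -/
lemma exists_vectorField {v : Fin 4 → ℂ} (hv : v ∈ Z) (hv0 : v ≠ 0) :
    ∃ τ : Fin 4 → MvPolynomial (Fin 4) ℂ, (∀ w ∈ Z, w ≠ 0 → vecEval τ w ∈ tang I w) ∧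
      LinearIndependent ℂ ![v, vecEval τ v] := by
  obtain ⟨g₁, h₁, g₂, h₂, -, -, hli⟩ := hI.exists_pair hv hv0
  obtain ⟨e, he⟩ : ∃ e : Fin 4 → ℂ, e ⬝ᵥ v ≠ 0 := by
    by_contra! hcon
    exact hv0 (dotProduct_eq_zero v fun w => by rw [dotProduct_comm]; exact hcon w)
  -- The generalized cross product of two gradients and the constant covector `e` is killed by both
  -- gradients. Where these become dependent it is zero, so it is tangent at every nonzero point of
  -- the cone.
  set τ : Fin 4 → MvPolynomial (Fin 4) ℂ :=
    cof (fun i => pderiv i g₁) (fun i => pderiv i g₂) (fun i => C (e i)) with hτ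
  have hev : ∀ w, vecEval τ w = cof (grad g₁ w) (grad g₂ w) e := by
    intro w
    funext i
    rw [vecEval, hτ, map_cof]
    congr 1
    ext j
    simp
  refine ⟨τ, fun w hw hw0 => ?_, ?_⟩
  · rw [hev]
    by_cases hl : LinearIndependent ℂ ![grad g₁ w, grad g₂ w]
    · refine hI.mem_tang_of_pair hw hw0 h₁ h₂ hl ?_ ?_
      · rw [dotProduct_comm, cof_dotProduct_left]
      · rw [dotProduct_comm, cof_dotProduct_mid]
    · rw [cof_eq_zero_of_not_linearIndependent hl]
      exact (tang I w).zero_mem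
  · rw [hev]
    have h3 : LinearIndependent ℂ ![grad g₁ v, grad g₂ v, e] := by
      have hns : e ∉ Submodule.span ℂ {grad g₁ v, grad g₂ v} := by
        rw [hI.span_grad_eq hv hv0 h₁ h₂ hli]
        exact fun h => he (hI.dotProduct_self_of_mem_nrm hv h)
      exact linearIndependent_triple hli hns
    have h4 := cof_ne_zero h3
    rw [LinearIndependent.pair_iff' hv0]
    intro a ha
    have ha0 : a ≠ 0 := by rintro rfl; exact h4 (by rw [← ha, zero_smul])
    -- The field pairs to zero with `e`, whereas a nonzero multiple of `v` does not.
    have := cof_dotProduct_right (grad g₁ v) (grad g₂ v) e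
    rw [← ha, smul_dotProduct, dotProduct_comm, smul_eq_mul] at this
    exact (mul_ne_zero ha0 he) this

/-- A tangent field descends to a derivation of the coordinate ring of the cone. -/
lemma vder_mem {τ : Fin 4 → MvPolynomial (Fin 4) ℂ}
    (hτ : ∀ w ∈ Z, w ≠ 0 → vecEval τ w ∈ tang I w) {f : MvPolynomial (Fin 4) ℂ} (hf : f ∈ I) :
    vder τ f ∈ I := by
  refine hI.mem_of_forall_ne_zero fun w hw hw0 => ?_
  rw [eval_vder]
  exact hτ w hw hw0 f hf

end IsCurveCone

/-! ### The local ring at a point of the curve: Taylor expansion and uniformizer -/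

/-- The restriction of polynomials to the line through the origin and `v`. -/
def lineHom (v : Fin 4 → ℂ) : MvPolynomial (Fin 4) ℂ →ₐ[ℂ] Polynomial ℂ :=
  aeval fun i => Polynomial.C (v i) * Polynomial.X

lemma eval_lineHom (v : Fin 4 → ℂ) (f : MvPolynomial (Fin 4) ℂ) (c : ℂ) :
    (lineHom v f).eval c = eval (c • v) f := by
  have : ((Polynomial.evalRingHom c).comp (lineHom v : MvPolynomial (Fin 4) ℂ →+* Polynomial ℂ))
      = eval (c • v) := by
    ext i
    · simp [lineHom]
    · simp [lineHom]; ring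
  exact RingHom.congr_fun this f

/-- The ideal of the line through the origin and `v`. -/
def lineIdeal (v : Fin 4 → ℂ) : Ideal (MvPolynomial (Fin 4) ℂ) := RingHom.ker (lineHom v)

instance lineIdeal_isPrime (v : Fin 4 → ℂ) : (lineIdeal v).IsPrime := RingHom.ker_isPrime _

lemma mem_lineIdeal {v : Fin 4 → ℂ} {f : MvPolynomial (Fin 4) ℂ} :
    f ∈ lineIdeal v ↔ ∀ c : ℂ, eval (c • v) f = 0 := by
  rw [lineIdeal, RingHom.mem_ker]
  constructor
  · intro h c
    rw [← eval_lineHom]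
    have : lineHom v f = 0 := h
    rw [this, Polynomial.eval_zero]
  · intro h
    refine Polynomial.funext fun c => ?_
    rw [Polynomial.eval_zero]
    exact (eval_lineHom v f c).trans (h c)

lemma eval_of_mem_lineIdeal {v : Fin 4 → ℂ} {f : MvPolynomial (Fin 4) ℂ} (h : f ∈ lineIdeal v) :
    eval v f = 0 := by simpa using mem_lineIdeal.1 h 1

lemma mem_lineIdeal_of_isHomogeneous {v : Fin 4 → ℂ} {f : MvPolynomial (Fin 4) ℂ} {d : ℕ}
    (hf : f.IsHomogeneous d) (h : eval v f = 0) : f ∈ lineIdeal v := by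
  rw [mem_lineIdeal]
  intro c
  rw [eval_smul_of_isHomogeneous hf, h, mul_zero]

section taylor

variable {v : Fin 4 → ℂ} {k : Fin 4}

/-- The projection onto the line through `v`, along the directions with vanishing `k`-th
coordinate. -/
def projHom (v : Fin 4 → ℂ) (k : Fin 4) :
    MvPolynomial (Fin 4) ℂ →ₐ[ℂ] MvPolynomial (Fin 4) ℂ :=
  aeval fun i => C (v i * (v k)⁻¹) * X k

lemma eval_projHom (v : Fin 4 → ℂ) (k : Fin 4) (f : MvPolynomial (Fin 4) ℂ) (y : Fin 4 → ℂ) :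
    eval y (projHom v k f) = eval ((y k * (v k)⁻¹) • v) f := by
  have : ((eval y).comp (projHom v k : MvPolynomial (Fin 4) ℂ →+* MvPolynomial (Fin 4) ℂ))
      = eval ((y k * (v k)⁻¹) • v) := by
    ext i
    · simp [projHom]
    · simp [projHom]; ring
  exact RingHom.congr_fun this f

lemma projHom_of_isHomogeneous {f : MvPolynomial (Fin 4) ℂ} {d : ℕ} (hf : f.IsHomogeneous d) :
    projHom v k f = C (eval v f) * (C (v k)⁻¹ * X k) ^ d := by
  refine MvPolynomial.funext fun y => ?_
  rw [eval_projHom, eval_smul_of_isHomogeneous hf]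
  simp
  ring

/-- The linear forms that generate the ideal of the line. -/
def lineForm (v : Fin 4 → ℂ) (k i : Fin 4) : MvPolynomial (Fin 4) ℂ :=
  X i - C (v i * (v k)⁻¹) * X k

lemma lineForm_eq (i : Fin 4) : lineForm v k i = X i - projHom v k (X i) := by
  simp [lineForm, projHom]

lemma lineForm_mem (hk : v k ≠ 0) (i : Fin 4) : lineForm v k i ∈ lineIdeal v := by
  rw [mem_lineIdeal]
  intro c
  simp [lineForm]
  field_simp
  ring

lemma sub_projHom_mem (f : MvPolynomial (Fin 4) ℂ) :
    f - projHom v k f ∈ Ideal.span (Set.range (lineForm v k)) := by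
  induction f using MvPolynomial.induction_on with
  | C a => simp [projHom]
  | add p q hp hq =>
    have : p + q - projHom v k (p + q) = (p - projHom v k p) + (q - projHom v k q) := by
      rw [map_add]; ring
    rw [this]
    exact Ideal.add_mem _ hp hq
  | mul_X p i hp =>
    have : p * X i - projHom v k (p * X i)
        = (p - projHom v k p) * X i + projHom v k p * lineForm v k i := by
      rw [map_mul, lineForm_eq]; ring
    rw [this]
    exact Ideal.add_mem _ (Ideal.mul_mem_right _ _ hp)
      (Ideal.mul_mem_left _ _ (Ideal.subset_span ⟨i, rfl⟩))

lemma lineIdeal_eq_span (hk : v k ≠ 0) :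
    lineIdeal v = Ideal.span (Set.range (lineForm v k)) := by
  refine le_antisymm (fun f hf => ?_) ?_
  · have h0 : projHom v k f = 0 := by
      refine MvPolynomial.funext fun y => ?_
      rw [eval_projHom, mem_lineIdeal.1 hf, map_zero]
    simpa [h0] using sub_projHom_mem (v := v) (k := k) f
  · rw [Ideal.span_le]
    rintro _ ⟨i, rfl⟩
    exact lineForm_mem hk i

/-- The Taylor expansion of first order along the line through `v`. -/
lemma taylor_mem (hk : v k ≠ 0) (f : MvPolynomial (Fin 4) ℂ) :
    f - projHom v k f - ∑ i, projHom v k (pderiv i f) * lineForm v k i ∈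
      lineIdeal v * lineIdeal v := by
  induction f using MvPolynomial.induction_on with
  | C a => simp [projHom]
  | add p q hp hq =>
    have : p + q - projHom v k (p + q) -
        ∑ i, projHom v k (pderiv i (p + q)) * lineForm v k i
        = (p - projHom v k p - ∑ i, projHom v k (pderiv i p) * lineForm v k i)
        + (q - projHom v k q - ∑ i, projHom v k (pderiv i q) * lineForm v k i) := by
      simp only [map_add, add_mul, Finset.sum_add_distrib]; ring
    rw [this]
    exact Ideal.add_mem _ hp hq
  | mul_X p j hp =>
    have hsum : ∑ i, projHom v k (pderiv i (p * X j)) * lineForm v k i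
        = projHom v k p * lineForm v k j
          + projHom v k (X j) * ∑ i, projHom v k (pderiv i p) * lineForm v k i := by
      have : ∀ i, projHom v k (pderiv i (p * X j)) * lineForm v k i
          = (if i = j then projHom v k p * lineForm v k j else 0)
          + projHom v k (X j) * (projHom v k (pderiv i p) * lineForm v k i) := by
        intro i
        rw [Derivation.leibniz, pderiv_X]
        by_cases hij : i = j
        · subst hij
          simp; ring
        · simp [hij]
          ring
      rw [Finset.sum_congr rfl fun i _ => this i, Finset.sum_add_distrib, Finset.mul_sum]
      simp
    have : p * X j - projHom v k (p * X j) -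
        ∑ i, projHom v k (pderiv i (p * X j)) * lineForm v k i
        = projHom v k (X j) *
          (p - projHom v k p - ∑ i, projHom v k (pderiv i p) * lineForm v k i)
        + (p - projHom v k p) * lineForm v k j := by
      rw [hsum, map_mul, lineForm_eq]; ring
    rw [this]
    refine Ideal.add_mem _ (Ideal.mul_mem_left _ _ hp) (Ideal.mul_mem_mul ?_ (lineForm_mem hk j))
    rw [lineIdeal_eq_span hk]
    exact sub_projHom_mem p

lemma lin_eq_sum_lineForm {a : Fin 4 → ℂ} (ha : a ⬝ᵥ v = 0) :
    lin a = ∑ i, C (a i) * lineForm v k i := by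
  refine MvPolynomial.funext fun y => ?_
  have : ∑ i, a i * (v i * (v k)⁻¹ * y k) = (a ⬝ᵥ v) * ((v k)⁻¹ * y k) := by
    rw [dotProduct, Finset.sum_mul]
    exact Finset.sum_congr rfl fun i _ => by ring
  rw [ha, zero_mul] at this
  simp only [eval_lin, map_sum, map_mul, lineForm, map_sub, eval_C, eval_X, mul_sub,
    Finset.sum_sub_distrib, this, sub_zero]
  rfl

/-- The linear part of a homogeneous element vanishing at `v` is congruent to it up to a unit. -/
lemma X_pow_mul_lin_grad_mem (hk : v k ≠ 0) {I : Ideal (MvPolynomial (Fin 4) ℂ)}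
    {f : MvPolynomial (Fin 4) ℂ} (hf : f ∈ I) {d : ℕ} (hd : f.IsHomogeneous d)
    (hfv : eval v f = 0) :
    (C (v k)⁻¹ * X k) ^ (d - 1) * lin (grad f v) ∈ I ⊔ lineIdeal v * lineIdeal v := by
  have h1 := taylor_mem hk f
  have hg : grad f v ⬝ᵥ v = 0 := by rw [dotProduct_grad_self hd, hfv, mul_zero]
  have h2 : ∑ i, projHom v k (pderiv i f) * lineForm v k i
      = (C (v k)⁻¹ * X k) ^ (d - 1) * lin (grad f v) := by
    rw [lin_eq_sum_lineForm (k := k) hg, Finset.mul_sum]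
    refine Finset.sum_congr rfl fun i _ => ?_
    rw [projHom_of_isHomogeneous (isHomogeneous_pderiv hd i)]
    simp only [grad]
    ring
  rw [projHom_of_isHomogeneous hd, hfv, C_0, zero_mul, sub_zero, h2] at h1
  have h3 := Ideal.sub_mem (I ⊔ lineIdeal v * lineIdeal v) (Ideal.mem_sup_left hf)
    (Ideal.mem_sup_right h1)
  simpa using h3

lemma X_pow_notMem (hk : v k ≠ 0) (N : ℕ) : (C (v k)⁻¹ * X k) ^ N ∉ lineIdeal v := by
  intro h
  have := eval_of_mem_lineIdeal h
  simp [hk] at this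

end taylor

namespace IsCurveCone

variable {I : Ideal (MvPolynomial (Fin 4) ℂ)} {Z : Set (Fin 4 → ℂ)} (hI : IsCurveCone I Z)
include hI

lemma le_lineIdeal {v : Fin 4 → ℂ} (hv : v ∈ Z) : I ≤ lineIdeal v := fun _ hf =>
  mem_lineIdeal.2 fun c => hI.eval_eq_zero hf (hI.smul_mem v hv c)

lemma span_pair_eq_tang {v t : Fin 4 → ℂ} (hv : v ∈ Z) (ht : t ∈ tang I v)
    (hli : LinearIndependent ℂ ![v, t]) : Submodule.span ℂ {v, t} = tang I v := by
  have hv0 : v ≠ 0 := hli.ne_zero 0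
  exact span_pair_eq_of_mem hli (hI.finrank_tang v hv hv0) (hI.self_mem_tang hv) ht

lemma mem_nrm_of_dotProduct {v t h : Fin 4 → ℂ} (hv : v ∈ Z) (ht : t ∈ tang I v)
    (hli : LinearIndependent ℂ ![v, t]) (h1 : h ⬝ᵥ v = 0) (h2 : h ⬝ᵥ t = 0) : h ∈ nrm I v := by
  rw [mem_nrm_iff, ← hI.span_pair_eq_tang hv ht hli]
  intro y hy
  obtain ⟨a, b, rfl⟩ := Submodule.mem_span_pair.1 hy
  simp [h1, h2]

/-- Every linear form vanishing at `v` is, up to a unit, a multiple of the linear form `u` modulo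
the ideal of the curve and the square of the ideal of the point. -/
lemma exists_mul_lin_mem {v t u : Fin 4 → ℂ} (hv : v ∈ Z) (ht : t ∈ tang I v)
    (hli : LinearIndependent ℂ ![v, t]) (huv : u ⬝ᵥ v = 0) (hut : u ⬝ᵥ t ≠ 0)
    {k : Fin 4} (hk : v k ≠ 0) {a : Fin 4 → ℂ} (hav : a ⬝ᵥ v = 0) :
    ∃ N : ℕ, (C (v k)⁻¹ * X k) ^ N * lin a ∈
      (Ideal.span {lin u} ⊔ I) ⊔ lineIdeal v * lineIdeal v := by
  -- With this constant `a - c • u` kills both `v` and `t`, hence is the gradient at `v` of an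
  -- element of `I`.
  set c : ℂ := (a ⬝ᵥ t) / (u ⬝ᵥ t) with hc
  have hb : a - c • u ∈ nrm I v := by
    refine hI.mem_nrm_of_dotProduct hv ht hli ?_ ?_
    · simp [sub_dotProduct, hav, huv]
    · simp [sub_dotProduct, hc, hut]
  obtain ⟨f, hf, hfa⟩ := hb
  set J := (Ideal.span {lin u} ⊔ I) ⊔ lineIdeal v * lineIdeal v with hJ
  set w : MvPolynomial (Fin 4) ℂ := C (v k)⁻¹ * X k with hw
  have hcomp : ∀ i, w ^ (i - 1) * lin (grad (homogeneousComponent i f) v) ∈ J := by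
    intro i
    have hm := hI.homogeneousComponent_mem hf i
    have hle : I ⊔ lineIdeal v * lineIdeal v ≤ J := sup_le_sup_right le_sup_right _
    exact hle (X_pow_mul_lin_grad_mem hk hm
      (homogeneousComponent_isHomogeneous i f) (hI.eval_eq_zero hm hv))
  refine ⟨f.totalDegree, ?_⟩
  have ha : a = c • u + ∑ i ∈ Finset.range (f.totalDegree + 1),
      grad (homogeneousComponent i f) v := by
    rw [← grad_sum, sum_homogeneousComponent, hfa]
    abel
  rw [ha, lin_add, lin_smul, lin_sum, mul_add, Finset.mul_sum]
  refine Ideal.add_mem _ ?_ (Ideal.sum_mem _ fun i hi => ?_)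
  · refine Ideal.mul_mem_left _ _ (Ideal.mul_mem_left _ _ ?_)
    exact Ideal.mem_sup_left (Ideal.mem_sup_left (Ideal.subset_span rfl))
  · have : f.totalDegree = (f.totalDegree - (i - 1)) + (i - 1) := by
      have := Finset.mem_range.1 hi
      omega
    rw [this, pow_add, mul_assoc]
    exact Ideal.mul_mem_left _ _ (hcomp i)

/-- A local equation of the point on the curve: after inverting `s`, the form `u` generates the
ideal of the point. -/
lemma exists_uniformizer {v t u : Fin 4 → ℂ} (hv : v ∈ Z) (ht : t ∈ tang I v)
    (hli : LinearIndependent ℂ ![v, t]) (huv : u ⬝ᵥ v = 0) (hut : u ⬝ᵥ t ≠ 0) :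
    ∃ s ∉ lineIdeal v, ∀ f ∈ lineIdeal v, ∃ r, s * f - r * lin u ∈ I := by
  classical
  have hv0 : v ≠ 0 := hli.ne_zero 0
  obtain ⟨k, hk⟩ := Function.ne_iff.1 hv0
  simp only [Pi.zero_apply] at hk
  set w : MvPolynomial (Fin 4) ℂ := C (v k)⁻¹ * X k with hw
  set J := Ideal.span {lin u} ⊔ I with hJ
  have hform : ∀ i, ∃ N : ℕ, w ^ N * lineForm v k i ∈ J ⊔ lineIdeal v * lineIdeal v := by
    intro i
    have h1 : lineForm v k i = lin (Pi.single i 1 - Pi.single k (v i * (v k)⁻¹)) := by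
      refine MvPolynomial.funext fun y => ?_
      simp [lineForm, sub_dotProduct]
    rw [h1]
    refine hI.exists_mul_lin_mem hv ht hli huv hut hk ?_
    simp [sub_dotProduct, hk]
  choose N hN using hform
  have hform' : ∀ i, w ^ (∑ j, N j) * lineForm v k i ∈ J ⊔ lineIdeal v * lineIdeal v := by
    intro i
    have : ∑ j, N j = (∑ j ∈ Finset.univ.erase i, N j) + N i :=
      (Finset.sum_erase_add _ _ (Finset.mem_univ i)).symm
    rw [this, pow_add, mul_assoc]
    exact Ideal.mul_mem_left _ _ (hN i)
  -- A common power serves all four generators. Since `W` does not vanish at `v`, the ideal of the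
  -- point is locally contained in `J` plus its own square, which is the situation of Nakayama's
  -- lemma.
  set W := w ^ (∑ j, N j) with hW
  have hdec : ∀ i, ∃ q : Fin 4 → MvPolynomial (Fin 4) ℂ, (∀ j, q j ∈ lineIdeal v) ∧
      W * lineForm v k i - ∑ j, q j * lineForm v k j ∈ J := by
    intro i
    obtain ⟨b, hb, c, hc, hbc⟩ := Submodule.mem_sup.1 (hform' i)
    have hc' : c ∈ lineIdeal v • Submodule.span (MvPolynomial (Fin 4) ℂ)
        (Set.range (lineForm v k)) := by
      have h2 : Submodule.span (MvPolynomial (Fin 4) ℂ) (Set.range (lineForm v k))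
        = lineIdeal v := (lineIdeal_eq_span hk).symm
      rw [h2]
      exact hc
    obtain ⟨q, hq, hqc⟩ := (Submodule.mem_ideal_smul_span_iff_exists_sum _ _ _).1 hc'
    refine ⟨q, hq, ?_⟩
    rw [Finsupp.sum_fintype _ _ (by simp)] at hqc
    simp only [smul_eq_mul] at hqc
    rw [hqc, ← hbc, add_sub_cancel_right]
    exact hb
  choose q hq hqJ using hdec
  -- The determinant trick: `M` sends the vector of generators into `J`, and multiplying by the
  -- adjugate shows that `M.det` multiplies each generator into `J`.
  set M : Matrix (Fin 4) (Fin 4) (MvPolynomial (Fin 4) ℂ) :=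
    W • (1 : Matrix (Fin 4) (Fin 4) (MvPolynomial (Fin 4) ℂ)) - Matrix.of q with hM
  have hMl : ∀ i, (M.mulVec (lineForm v k)) i ∈ J := by
    intro i
    have : (M.mulVec (lineForm v k)) i
        = W * lineForm v k i - ∑ j, q i j * lineForm v k j := by
      simp [hM, Matrix.mulVec, dotProduct, sub_mul, Matrix.one_apply, Finset.sum_sub_distrib]
    rw [this]
    exact hqJ i
  have hdet : ∀ i, M.det * lineForm v k i ∈ J := by
    intro i
    have h1 : (M.adjugate.mulVec (M.mulVec (lineForm v k))) i = M.det * lineForm v k i := by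
      rw [Matrix.mulVec_mulVec, Matrix.adjugate_mul, Matrix.smul_mulVec, Matrix.one_mulVec]
      rfl
    rw [← h1]
    change ∑ j, M.adjugate i j * (M.mulVec (lineForm v k)) j ∈ J
    exact Ideal.sum_mem _ fun j _ => Ideal.mul_mem_left _ _ (hMl j)
  refine ⟨M.det, ?_, fun f hf => ?_⟩
  · intro hmem
    have h0 := (Ideal.Quotient.eq_zero_iff_mem).2 hmem
    rw [RingHom.map_det] at h0
    -- The entries `q i j` vanish on the line, so there `M` is scalar and its determinant is a power
    -- of `W`.
    have h1 : (Ideal.Quotient.mk (lineIdeal v)).mapMatrix M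
        = (Ideal.Quotient.mk (lineIdeal v) W) • (1 : Matrix (Fin 4) (Fin 4) _) := by
      ext i j : 1
      have h2 : (Ideal.Quotient.mk (lineIdeal v)) (q i j) = 0 :=
        (Ideal.Quotient.eq_zero_iff_mem).2 (hq i j)
      by_cases hij : i = j
      · subst hij
        simp [hM, h2]
      · simp [hM, h2, hij]
    rw [h1, Matrix.det_smul, Matrix.det_one, mul_one] at h0
    have h3 := eq_zero_of_pow_eq_zero h0
    exact X_pow_notMem hk _ ((Ideal.Quotient.eq_zero_iff_mem).1 h3)
  · have hmem : M.det * f ∈ J := by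
      rw [lineIdeal_eq_span hk] at hf
      induction hf using Submodule.span_induction with
      | mem x hx => obtain ⟨i, rfl⟩ := hx; exact hdet i
      | zero => simp
      | add x y _ _ hx hy => rw [mul_add]; exact J.add_mem hx hy
      | smul a x _ hx =>
        rw [smul_eq_mul, mul_left_comm]
        exact J.mul_mem_left _ hx
    obtain ⟨b, hb, c, hc, hbc⟩ := Submodule.mem_sup.1 hmem
    obtain ⟨r, rfl⟩ := Ideal.mem_span_singleton'.1 hb
    exact ⟨r, by rw [← hbc, add_sub_cancel_left]; exact hc⟩

end IsCurveCone

/-! ### Orders of vanishing; constancy of ratios; limits of chords -/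

lemma aeval_mul_of_isHomogeneous {σ A : Type*} [CommRing A] [Algebra ℂ A]
    {F : MvPolynomial σ ℂ} {d : ℕ} (hF : F.IsHomogeneous d) (c : A) (x : σ → A) :
    aeval (fun i => c * x i) F = c ^ d * aeval x F := by
  classical
  rw [aeval_def, aeval_def, eval₂_eq, eval₂_eq, Finset.mul_sum]
  refine Finset.sum_congr rfl fun s hs => ?_
  have hd : ∑ i ∈ s.support, s i = d := (hF.degree_eq_sum_deg_support hs).symm
  simp only [mul_pow, Finset.prod_mul_distrib, Finset.prod_pow_eq_pow_sum, hd]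
  ring

lemma aeval_sub_mem {σ A : Type*} [CommRing A] [Algebra ℂ A] (J : Ideal A) {x y : σ → A}
    (h : ∀ i, x i - y i ∈ J) (F : MvPolynomial σ ℂ) : aeval x F - aeval y F ∈ J := by
  induction F using MvPolynomial.induction_on with
  | C a => simp
  | add p q hp hq =>
    rw [map_add, map_add, add_sub_add_comm]
    exact J.add_mem hp hq
  | mul_X p i hp =>
    have : aeval x (p * X i) - aeval y (p * X i)
        = (aeval x p - aeval y p) * x i + aeval y p * (x i - y i) := by
      simp only [map_mul, aeval_X]; ring
    rw [this]
    exact J.add_mem (J.mul_mem_right _ hp) (J.mul_mem_left _ (h i))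

lemma eval_aeval {σ ι : Type*} (x : σ → MvPolynomial ι ℂ) (F : MvPolynomial σ ℂ) (v : ι → ℂ) :
    eval v (aeval x F) = eval (fun i => eval v (x i)) F := by
  have : (eval v).comp (aeval x : MvPolynomial σ ℂ →ₐ[ℂ] MvPolynomial ι ℂ).toRingHom
      = eval (fun i => eval v (x i)) := by
    ext i <;> simp
  exact RingHom.congr_fun this F

lemma exists_dotProduct_ne_zero {v t : Fin 4 → ℂ} (h : LinearIndependent ℂ ![v, t]) :
    ∃ u, u ⬝ᵥ v = 0 ∧ u ⬝ᵥ t ≠ 0 := by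
  by_contra! hcon
  have ht : t ∈ stdForm.orthogonal (stdForm.orthogonal (Submodule.span ℂ {v})) := by
    rw [LinearMap.BilinForm.mem_orthogonal_iff]
    intro u hu
    refine hcon u ?_
    rw [LinearMap.BilinForm.mem_orthogonal_iff] at hu
    rw [dotProduct_comm]
    exact hu v (Submodule.mem_span_singleton_self v)
  rw [LinearMap.BilinForm.orthogonal_orthogonal stdForm_nondegenerate stdForm_isRefl,
    Submodule.mem_span_singleton] at ht
  obtain ⟨a, ha⟩ := ht
  exact (LinearIndependent.pair_iff' (h.ne_zero 0)).1 h a ha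

namespace IsCurveCone

variable {I : Ideal (MvPolynomial (Fin 4) ℂ)} {Z : Set (Fin 4 → ℂ)} (hI : IsCurveCone I Z)
include hI

/-- The order of vanishing along the curve at the point `v`, measured by the uniformizer `u`. -/
lemma exists_order {v t u : Fin 4 → ℂ} (hv : v ∈ Z) (ht : t ∈ tang I v)
    (hli : LinearIndependent ℂ ![v, t]) (huv : u ⬝ᵥ v = 0) (hut : u ⬝ᵥ t ≠ 0)
    {f : MvPolynomial (Fin 4) ℂ} (hf : f ∉ I) :
    ∃ (n : ℕ), ∃ s ∉ lineIdeal v, ∃ r ∉ lineIdeal v, s * f - r * lin u ^ n ∈ I := by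
  obtain ⟨s₀, hs₀, huni⟩ := hI.exists_uniformizer hv ht hli huv hut
  have := hI.isPrime
  have hle := hI.le_lineIdeal hv
  set π := Ideal.Quotient.mk I with hπ
  set P := (lineIdeal v).map π with hP
  have hmem : ∀ x, π x ∈ P ↔ x ∈ lineIdeal v := fun x => Ideal.mem_quotient_iff_mem hle
  have hPp : P.IsPrime := by
    refine Ideal.map_isPrime_of_surjective Ideal.Quotient.mk_surjective ?_
    rwa [Ideal.mk_ker]
  set O := Localization.AtPrime P with hO
  set φ := algebraMap (MvPolynomial (Fin 4) ℂ ⧸ I) O with hφ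
  have hinj : Function.Injective φ :=
    IsLocalization.injective O P.primeCompl_le_nonZeroDivisors
  have : IsDomain O := IsLocalization.isDomain_of_le_nonZeroDivisors _
    P.primeCompl_le_nonZeroDivisors
  have : IsNoetherianRing O := IsLocalization.isNoetherianRing P.primeCompl O inferInstance
  have hunit : ∀ x, x ∉ lineIdeal v → IsUnit (φ (π x)) := fun x hx =>
    IsLocalization.map_units O (⟨π x, fun h => hx ((hmem x).1 h)⟩ : P.primeCompl)
  have hU : ¬ IsUnit (φ (π (lin u))) := by
    intro h
    have h1 : π (lin u) ∈ P :=
      (hmem _).2 (mem_lineIdeal_of_isHomogeneous (isHomogeneous_lin u) (by simpa using huv))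
    have h2 := (IsLocalization.AtPrime.isUnit_to_map_iff O P (π (lin u))).1 h
    exact h2 h1
  have hF : φ (π f) ≠ 0 := by
    rw [Ne, map_eq_zero_iff φ hinj, Ideal.Quotient.eq_zero_iff_mem]
    exact hf
  -- In a Noetherian domain a nonzero element is divisible by only finitely many powers of a
  -- nonunit.
  have hfin : FiniteMultiplicity (φ (π (lin u))) (φ (π f)) := FiniteMultiplicity.of_not_isUnit hU hF
  obtain ⟨c, hc, hndvd⟩ := hfin.exists_eq_pow_mul_and_not_dvd
  set m := multiplicity (φ (π (lin u))) (φ (π f))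
  obtain ⟨r', s', hrs⟩ := IsLocalization.exists_mk'_eq P.primeCompl c
  obtain ⟨r, rfl⟩ := Ideal.Quotient.mk_surjective r'
  obtain ⟨s, hs⟩ := Ideal.Quotient.mk_surjective (s' : MvPolynomial (Fin 4) ℂ ⧸ I)
  have hcs : c * φ (π s) = φ (π r) := by
    rw [← hrs, hπ, hs]
    exact IsLocalization.mk'_spec O _ s'
  have hsp : s ∉ lineIdeal v := fun h => s'.2 (by
    rw [← hs]; exact (hmem s).2 h)
  refine ⟨m, s, hsp, r, ?_, ?_⟩
  -- If `r` vanished at the point, the uniformizer would divide it up to a unit, and hence would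
  -- divide the cofactor `c`.
  · intro hr
    obtain ⟨q, hq⟩ := huni r hr
    have h1 : φ (π s₀) * φ (π r) = φ (π q) * φ (π (lin u)) := by
      rw [← map_mul, ← map_mul, ← map_mul, ← map_mul]
      congr 1
      exact Ideal.Quotient.eq.2 hq
    apply hndvd
    have h2 : φ (π (lin u)) ∣ φ (π s₀) * φ (π s) * c := by
      rw [mul_assoc, mul_comm (φ (π s)) c, hcs, h1]
      exact Dvd.intro_left _ rfl
    exact (((hunit _ hs₀).mul (hunit _ hsp)).dvd_mul_left).1 h2
  · rw [← Ideal.Quotient.eq]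
    apply hinj
    change φ (π (s * f)) = φ (π (r * lin u ^ m))
    simp only [map_mul, map_pow]
    rw [hc, ← hcs]
    ring

/-- A quotient of homogeneous polynomials of the same degree whose differential vanishes along an
open part of the curve is constant on the curve. -/
lemma sub_C_mul_mem {P Q E : MvPolynomial (Fin 4) ℂ} {d : ℕ} (hP : P.IsHomogeneous d)
    (hQ : Q.IsHomogeneous d) (hE : E ∉ I)
    (h : ∀ w ∈ Z, w ≠ 0 → eval w E ≠ 0 → ∀ y ∈ tang I w,
      eval w Q * (grad P w ⬝ᵥ y) = eval w P * (grad Q w ⬝ᵥ y))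
    {v : Fin 4 → ℂ} (hv : v ∈ Z) (hv0 : v ≠ 0) (hQv : eval v Q ≠ 0) :
    P - C (eval v P / eval v Q) * Q ∈ I := by
  obtain ⟨τ, hτ, hli⟩ := hI.exists_vectorField hv hv0
  obtain ⟨u, huv, hut⟩ := exists_dotProduct_ne_zero hli
  have := hI.isPrime
  have hle := hI.le_lineIdeal hv
  by_contra hR
  set c : ℂ := eval v P / eval v Q
  set R := P - C c * Q with hRdef
  -- The hypothesis gives this only where `E ≠ 0`; multiply by `E` and use that `I` is prime.
  have hD0 : Q * vder τ P - P * vder τ Q ∈ I := by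
    refine (Ideal.IsPrime.mem_or_mem ‹I.IsPrime› (x := E)
      (hI.mem_of_forall_ne_zero fun w hw hw0 => ?_)).resolve_left hE
    by_cases hEw : eval w E = 0
    · rw [map_mul, hEw, zero_mul]
    · rw [map_mul, map_sub, map_mul, map_mul, eval_vder, eval_vder,
        h w hw hw0 hEw _ (hτ w hw hw0), sub_self, mul_zero]
  have hD : Q * vder τ R - R * vder τ Q ∈ I := by
    have : Q * vder τ R - R * vder τ Q = Q * vder τ P - P * vder τ Q := by
      have h1 : vder τ (C c * Q) = C c * vder τ Q := by
        rw [Derivation.leibniz, derivation_C, smul_zero, add_zero, smul_eq_mul]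
      rw [hRdef, map_sub, h1]
      ring
    rwa [this]
  have hRp : R ∈ lineIdeal v := by
    refine mem_lineIdeal_of_isHomogeneous (hP.sub (hQ.C_mul c)) ?_
    simp [hRdef, c, hQv]
  obtain ⟨n, s, hs, r, hr, hsr⟩ := hI.exists_order hv (hτ v hv hv0) hli huv hut hR
  set U := lin u with hU
  have hUp : U ∈ lineIdeal v :=
    mem_lineIdeal_of_isHomogeneous (isHomogeneous_lin u) (by rw [eval_lin, huv])
  have hUI : U ∉ I := by
    rw [hU, hI.lin_mem_iff]
    rintro rfl
    simp at hut
  have hQp : Q ∉ lineIdeal v := fun h => hQv (eval_of_mem_lineIdeal h)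
  have hDU : vder τ U ∉ lineIdeal v := by
    intro h
    have := eval_of_mem_lineIdeal h
    rw [eval_vder, hU, grad_lin] at this
    exact hut this
  obtain _ | m := n
  · rw [pow_zero, mul_one] at hsr
    refine hr ?_
    have := Ideal.sub_mem _ (Ideal.mul_mem_left _ s hRp) (hle hsr)
    simpa using this
  · have hDs := hI.vder_mem hτ hsr
    -- Differentiate `s R ≡ r U ^ (m + 1)`, then eliminate the derivative of `R` through `hD` and
    -- `R` itself through `hsr`. Every remaining term contains `U ^ m`, and only the one from
    -- differentiating `U ^ (m + 1)` lacks a further `U`.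
    have hkey : U ^ m * (U * (s * r * vder τ Q + Q * r * vder τ s - s * Q * vder τ r)
        - (m + 1 : ℕ) * (s * Q * r * vder τ U)) ∈ I := by
      have e : U ^ m * (U * (s * r * vder τ Q + Q * r * vder τ s - s * Q * vder τ r)
        - (m + 1 : ℕ) * (s * Q * r * vder τ U))
        = s * Q * vder τ (s * R - r * U ^ (m + 1)) - s ^ 2 * (Q * vder τ R - R * vder τ Q)
          - (s * vder τ Q + Q * vder τ s) * (s * R - r * U ^ (m + 1)) := by
        simp only [map_sub, Derivation.leibniz, Derivation.leibniz_pow, smul_eq_mul,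
          nsmul_eq_mul, Nat.add_sub_cancel]
        ring
      rw [e]
      exact I.sub_mem (I.sub_mem (I.mul_mem_left _ hDs) (I.mul_mem_left _ hD))
        (I.mul_mem_left _ hsr)
    have h1 := (Ideal.IsPrime.mem_or_mem ‹I.IsPrime› hkey).resolve_left
      fun h => hUI (Ideal.IsPrime.mem_of_pow_mem ‹I.IsPrime› m h)
    have h2 := Ideal.sub_mem _ (Ideal.mul_mem_right
      (s * r * vder τ Q + Q * r * vder τ s - s * Q * vder τ r) _ hUp) (hle h1)
    rw [sub_sub_cancel] at h2
    have hp := lineIdeal_isPrime v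
    rcases hp.mem_or_mem h2 with h3 | h3
    · have := eval_of_mem_lineIdeal h3
      rw [map_natCast, Nat.cast_eq_zero] at this
      omega
    · exact (hp.mem_or_mem h3).elim (fun h4 => (hp.mem_or_mem h4).elim
        (fun h5 => (hp.mem_or_mem h5).elim hs hQp) hr) hDU

/-- Forms vanishing on all chords through `v` vanish on the tangent line at `v`. -/
lemma eval_minors_tang {F : MvPolynomial (PluckerIndex 3) ℂ} {d : ℕ} (hF : F.IsHomogeneous d)
    {v : Fin 4 → ℂ} (hv : v ∈ Z) (hv0 : v ≠ 0) (h : ∀ y ∈ Z, eval (minors v y) F = 0)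
    {t : Fin 4 → ℂ} (ht : t ∈ tang I v) : eval (minors v t) F = 0 := by
  obtain ⟨τ, hτ, hli⟩ := hI.exists_vectorField hv hv0
  obtain ⟨u, huv, hut⟩ := exists_dotProduct_ne_zero hli
  have hp := hI.isPrime
  have hpv := lineIdeal_isPrime v
  have hle := hI.le_lineIdeal hv
  suffices h0 : eval (minors v (vecEval τ v)) F = 0 by
    rw [← hI.span_pair_eq_tang hv (hτ v hv hv0) hli] at ht
    obtain ⟨c, hc⟩ := exists_minors_eq_smul (a := v) (Submodule.subset_span (by simp)) ht
    rw [hc, eval_smul_of_isHomogeneous hF, h0, mul_zero]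
  obtain ⟨s, hs, huni⟩ := hI.exists_uniformizer hv (hτ v hv hv0) hli huv hut
  set U := lin u with hU
  have hUp : U ∈ lineIdeal v :=
    mem_lineIdeal_of_isHomogeneous (isHomogeneous_lin u) (by rw [eval_lin, huv])
  have hUI : U ∉ I := by
    rw [hU, hI.lin_mem_iff]
    rintro rfl
    simp at hut
  -- The Plücker coordinates of the chord from `v` to a moving point; all vanish when that point
  -- lies on the line through `v`.
  set L : PluckerIndex 3 → MvPolynomial (Fin 4) ℂ :=
    fun p => C (v p.1.1) * X p.1.2 - C (v p.1.2) * X p.1.1 with hL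
  have hLp : ∀ p, L p ∈ lineIdeal v := by
    intro p
    rw [mem_lineIdeal]
    intro c
    simp [hL]
    ring
  choose r hr using fun p => huni (L p) (hLp p)
  have h1 : aeval L F ∈ I := by
    rw [hI.mem_iff]
    intro y hy
    rw [eval_aeval, ← h y hy]
    congr 2
    funext p
    simp [hL, minors]
  -- Divide the chord coordinates by the uniformizer: by homogeneity a factor `U ^ d` comes out, and
  -- it can be cancelled because `I` is prime.
  have h2 : aeval r F ∈ I := by
    have h3 := aeval_sub_mem I (x := fun p => s * L p) (y := fun p => U * r p)
      (fun p => by rw [mul_comm U]; exact hr p) F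
    rw [aeval_mul_of_isHomogeneous hF, aeval_mul_of_isHomogeneous hF] at h3
    have h4 := I.sub_mem (I.mul_mem_left (s ^ d) h1) h3
    rw [sub_sub_cancel] at h4
    exact (hp.mem_or_mem h4).resolve_left fun h => hUI (hp.mem_of_pow_mem d h)
  -- At `v` the quotient of the chord by `U` is, up to scalars, the derivative of the chord, whose
  -- coordinates are the minors of `v` and `vecEval τ v`.
  have h3 : ∀ p, s * vder τ (L p) - vder τ U * r p ∈ lineIdeal v := by
    intro p
    have h4 := hle (hI.vder_mem hτ (hr p))
    have h5 := (lineIdeal v).mul_mem_right (vder τ s) (hLp p)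
    have h6 := (lineIdeal v).mul_mem_right (vder τ (r p)) hUp
    have : s * vder τ (L p) - vder τ U * r p
        = vder τ (s * L p - r p * U) - L p * vder τ s + U * vder τ (r p) := by
      simp only [map_sub, Derivation.leibniz, smul_eq_mul]
      ring
    rw [this]
    exact (lineIdeal v).add_mem ((lineIdeal v).sub_mem h4 h5) h6
  have h4 := aeval_sub_mem (lineIdeal v) h3 F
  rw [aeval_mul_of_isHomogeneous hF, aeval_mul_of_isHomogeneous hF] at h4
  have h5 := (lineIdeal v).add_mem h4 ((lineIdeal v).mul_mem_left (vder τ U ^ d) (hle h2))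
  rw [sub_add_cancel] at h5
  have h6 := (hpv.mem_or_mem h5).resolve_left fun h => hs (hpv.mem_of_pow_mem d h)
  have h7 := eval_of_mem_lineIdeal h6
  rw [eval_aeval] at h7
  rw [← h7]
  congr 2
  funext p
  rw [eval_vder]
  have hg : grad (L p) v = v p.1.1 • Pi.single p.1.2 1 - v p.1.2 • Pi.single p.1.1 1 := by
    ext i
    simp only [grad, hL, map_sub, Derivation.leibniz, derivation_C, pderiv_X,
      Pi.sub_apply, Pi.smul_apply, smul_eq_mul, Pi.single_apply, eq_comm (a := i)]
    split_ifs <;> simp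
  rw [hg]
  simp [minors, sub_dotProduct]

end IsCurveCone

/-! ### Elimination theory -/

section elimination

variable {ι κ : Type*} {m : ℕ} (f : κ → MvPolynomial (Fin m) (MvPolynomial ι ℂ))

/-- The parameter values for which the homogeneous system `f` has a nontrivial solution. -/
def solvable : Set (ι → ℂ) := {y | ∃ x : Fin m → ℂ, x ≠ 0 ∧ ∀ i, eval x (map (eval y) (f i)) = 0}

variable {f}

/-- By the Nullstellensatz a power of each variable lies in the ideal, since the origin is the only
possible common zero. A monomial of degree exceeding the sum of the exponents is divisible by one of
these powers. -/
lemma exists_monomial_mem_span {y : ι → ℂ} (hy : y ∉ solvable f) :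
    ∃ d : ℕ, ∀ s : Fin m →₀ ℕ, s.degree = d →
      monomial s (1 : ℂ) ∈ Ideal.span (Set.range fun i => map (eval y) (f i)) := by
  set J := Ideal.span (Set.range fun i => map (eval y) (f i)) with hJ
  have hX : ∀ j, (X j : MvPolynomial (Fin m) ℂ) ∈ J.radical := by
    intro j
    rw [← vanishingIdeal_zeroLocus_eq_radical (K := ℂ), mem_vanishingIdeal_iff]
    intro x hx
    by_cases hx0 : x = 0
    · simp [hx0]
    · refine absurd ⟨x, hx0, fun i => ?_⟩ hy
      have := hx _ (Ideal.subset_span ⟨i, rfl⟩)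
      simpa using this
  choose N hN using hX
  refine ⟨∑ j, N j + 1, fun s hs => ?_⟩
  obtain ⟨j, hj⟩ : ∃ j, N j < s j := by
    by_contra! hcon
    have : s.degree ≤ ∑ j, N j := by
      rw [Finsupp.degree_eq_sum]
      exact Finset.sum_le_sum fun j _ => hcon j
    omega
  have : monomial s (1 : ℂ) = X j ^ N j * monomial (s - Finsupp.single j (N j)) 1 := by
    have hle : Finsupp.single j (N j) ≤ s := Finsupp.single_le_iff.2 hj.le
    rw [X_pow_eq_monomial, monomial_mul, one_mul, add_tsub_cancel_of_le hle]
  rw [this]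
  exact J.mul_mem_right _ (hN j)

/-- The main theorem of elimination theory. -/
lemma exists_eval_ne_zero_of_notMem_solvable (hf : ∀ i, ∃ d, (f i).IsHomogeneous d)
    {y : ι → ℂ} (hy : y ∉ solvable f) :
    ∃ G : MvPolynomial ι ℂ, eval y G ≠ 0 ∧ ∀ z ∈ solvable f, eval z G = 0 := by
  classical
  obtain ⟨d, hd⟩ := exists_monomial_mem_span hy
  have hfin : {s : Fin m →₀ ℕ | s.degree = d}.Finite :=
    (Finsupp.finite_of_degree_le d).subset fun s hs => le_of_eq hs
  have : Fintype {s : Fin m →₀ ℕ // s.degree = d} := hfin.fintype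
  have hcomb : ∀ s : {s : Fin m →₀ ℕ // s.degree = d},
      ∃ a : κ →₀ MvPolynomial (Fin m) ℂ, a.sum (fun i c => c * map (eval y) (f i))
        = monomial s.1 1 := by
    intro s
    obtain ⟨a, ha⟩ := (Finsupp.mem_ideal_span_range_iff_exists_finsupp).1 (hd s.1 s.2)
    exact ⟨a, ha⟩
  choose a ha using hcomb
  -- The coefficients found at `y` are frozen while the parameters of the system vary. The matrix of
  -- degree `d` coefficients is the identity at `y`.
  set p : {s : Fin m →₀ ℕ // s.degree = d} → MvPolynomial (Fin m) (MvPolynomial ι ℂ) :=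
    fun s => (a s).sum fun i c => map C c * f i with hp
  have hmap : ∀ (z : ι → ℂ) s, map (eval z) (p s)
      = (a s).sum fun i c => c * map (eval z) (f i) := by
    intro z s
    simp only [hp, Finsupp.sum, map_sum, map_mul, map_map]
    refine Finset.sum_congr rfl fun i _ => ?_
    congr 1
    have : (eval z).comp (C : ℂ →+* MvPolynomial ι ℂ) = RingHom.id ℂ := by ext; simp
    rw [this, map_id]
  set M : Matrix {s : Fin m →₀ ℕ // s.degree = d} {s : Fin m →₀ ℕ // s.degree = d}
    (MvPolynomial ι ℂ) := Matrix.of fun s t => coeff t.1 (p s) with hM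
  have hMz : ∀ (z : ι → ℂ), (eval z).mapMatrix M
      = Matrix.of fun s t => coeff t.1 (map (eval z) (p s)) := by
    intro z
    ext s t
    simp [hM, coeff_map]
  refine ⟨M.det, ?_, ?_⟩
  · rw [RingHom.map_det, hMz]
    have : (Matrix.of fun s t => coeff t.1 (map (eval y) (p s)) :
        Matrix {s : Fin m →₀ ℕ // s.degree = d} {s : Fin m →₀ ℕ // s.degree = d} ℂ) = 1 := by
      ext s t
      rw [Matrix.of_apply, hmap, ha, coeff_monomial, Matrix.one_apply]
      simp [Subtype.ext_iff]
    rw [this, Matrix.det_one]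
    exact one_ne_zero
  · rintro z ⟨x, hx0, hx⟩
    rw [RingHom.map_det, hMz, ← Matrix.exists_mulVec_eq_zero_iff]
    -- The degree `d` monomials of a solution form a nonzero kernel vector, so the determinant
    -- vanishes at every solvable parameter.
    refine ⟨fun t => ∏ j, x j ^ t.1 j, ?_, ?_⟩
    · obtain ⟨j, hj⟩ := Function.ne_iff.1 hx0
      intro h
      have := congrFun h ⟨Finsupp.single j d, by simp⟩
      simp only [Pi.zero_apply, Finset.prod_eq_zero_iff] at this
      obtain ⟨i, -, hi⟩ := this
      by_cases hij : i = j
      · subst hij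
        exact hj (eq_zero_of_pow_eq_zero hi)
      · simp [Finsupp.single_eq_of_ne hij] at hi
    · funext s
      have h1 : eval x (homogeneousComponent d (map (eval z) (p s))) = 0 := by
        refine eval_homogeneousComponent_eq_zero (fun c _ => ?_) d
        rw [hmap, Finsupp.sum, map_sum]
        refine Finset.sum_eq_zero fun i _ => ?_
        obtain ⟨e, he⟩ := hf i
        rw [map_mul, eval_smul_of_isHomogeneous (he.map _), hx i, mul_zero, mul_zero]
      rw [Pi.zero_apply, ← h1, eval_eq']
      have hsub : (homogeneousComponent d (map (eval z) (p s))).support ⊆ hfin.toFinset := by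
        intro t ht
        rw [support_homogeneousComponent] at ht
        simpa using (Finset.mem_filter.1 ht).2
      rw [Finset.sum_subset hsub (fun t _ ht => by rw [notMem_support_iff.1 ht, zero_mul])]
      rw [Matrix.mulVec, dotProduct]
      refine Finset.sum_bij (fun t _ => t.1) (by intro t _; simp)
        (by intro t _ t' _ h; exact Subtype.ext h)
        (fun t ht => ⟨⟨t, by simpa using ht⟩, Finset.mem_univ _, rfl⟩) ?_
      intro t _
      rw [coeff_homogeneousComponent, if_pos t.2, Matrix.of_apply]

/-- The main theorem of elimination theory, for systems that are homogeneous in the parameters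
as well. -/
lemma exists_isHomogeneous_of_notMem_solvable (hf : ∀ i, ∃ d, (f i).IsHomogeneous d)
    (hcone : ∀ z ∈ solvable f, ∀ c : ℂ, c ≠ 0 → c • z ∈ solvable f)
    {y : ι → ℂ} (hy : y ∉ solvable f) :
    ∃ G : MvPolynomial ι ℂ, (∃ d, G.IsHomogeneous d) ∧ eval y G ≠ 0 ∧
      ∀ z ∈ solvable f, eval z G = 0 := by
  obtain ⟨G, hGy, hG⟩ := exists_eval_ne_zero_of_notMem_solvable hf hy
  rw [← sum_homogeneousComponent G, map_sum] at hGy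
  obtain ⟨d, -, hd⟩ := Finset.exists_ne_zero_of_sum_ne_zero hGy
  exact ⟨homogeneousComponent d G, ⟨d, homogeneousComponent_isHomogeneous d G⟩, hd, fun z hz =>
    eval_homogeneousComponent_eq_zero (fun c hc => hG _ (hcone z hz c hc)) d⟩

end elimination

/-! ### Noetherian property and dimension of closed sets -/

section

variable {n : ℕ}

lemma coneIdeal_le_coneIdeal_iff {X Y : Set (ProjSpace n)} (hY : IsClosed Y) :
    coneIdeal Y ≤ coneIdeal X ↔ X ⊆ Y := by
  refine ⟨fun h x hx => mem_of_isClosed hY fun f hf => ?_, coneIdeal_anti⟩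
  exact mem_coneIdeal.1 (h (homogeneousVanishing_subset_coneIdeal hf)) _ (rep_mem_cone hx)

lemma coneIdeal_lt_coneIdeal {X Y : Set (ProjSpace n)} (hX : IsClosed X)
    (h : X ⊂ Y) : coneIdeal Y < coneIdeal X :=
  lt_of_le_not_ge (coneIdeal_anti h.1) fun h' => h.2 ((coneIdeal_le_coneIdeal_iff hX).1 h')

/-- Passing to cone ideals strictly reverses inclusions of closed sets, and the polynomial ring is
Noetherian. -/
instance noetherianSpace_projSpace : TopologicalSpace.NoetherianSpace (ProjSpace n) := by
  rw [(TopologicalSpace.noetherianSpace_TFAE (ProjSpace n)).out 0 1 rfl rfl]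
  have hanti : StrictAnti fun Z : TopologicalSpace.Closeds (ProjSpace n) =>
      coneIdeal (Z : Set (ProjSpace n)) := fun Z W h => coneIdeal_lt_coneIdeal Z.isClosed h
  exact hanti.wellFoundedLT

/-- The points of projective space that lie in a linear subspace. -/
def subspaceSet (W : Submodule ℂ (Fin (n + 1) → ℂ)) : Set (ProjSpace n) := {x | x.rep ∈ W}

lemma mk_mem_subspaceSet {W : Submodule ℂ (Fin (n + 1) → ℂ)} {v : Fin (n + 1) → ℂ} (hv : v ≠ 0) :
    Projectivization.mk ℂ v hv ∈ subspaceSet W ↔ v ∈ W := by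
  obtain ⟨a, ha⟩ := Projectivization.exists_smul_eq_mk_rep ℂ v hv
  rw [subspaceSet, Set.mem_ofPred_eq, ← ha]
  exact W.smul_mem_iff_of_isUnit a.isUnit

lemma cone_subspaceSet {W : Submodule ℂ (Fin (n + 1) → ℂ)} (hW : W ≠ ⊥) :
    cone (subspaceSet W) = W := by
  ext v
  by_cases hv : v = 0
  · obtain ⟨w, hw, hw0⟩ := W.ne_bot_iff.1 hW
    have h1 := (mem_cone_iff hw0).2 ((mk_mem_subspaceSet hw0).2 hw)
    have h2 := smul_mem_cone h1 0
    rw [zero_smul] at h2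
    simp [hv, h2]
  · rw [mem_cone_iff hv, mk_mem_subspaceSet hv, SetLike.mem_coe]

lemma isClosed_subspaceSet (W : Submodule ℂ (Fin (n + 1) → ℂ)) : IsClosed (subspaceSet W) := by
  have : subspaceSet W = ⋂ φ ∈ W.dualAnnihilator,
      {x | VanishesAt (lin fun i => φ (Pi.single i 1)) x} := by
    ext x
    have hφ : ∀ φ : Module.Dual ℂ (Fin (n + 1) → ℂ),
        VanishesAt (lin fun i => φ (Pi.single i 1)) x ↔ φ x.rep = 0 := by
      intro φ
      rw [VanishesAt, eval_lin, LinearMap.pi_apply_eq_sum_univ φ x.rep, dotProduct]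
      simp only [smul_eq_mul, mul_comm]
      have : ∀ i : Fin (n + 1),
          (fun j => if i = j then (1 : ℂ) else 0) = Pi.single i (1 : ℂ) := by
        intro i; ext j; simp [Pi.single_apply, eq_comm]
      simp only [this]
    simp only [Set.mem_iInter, Set.mem_ofPred_eq, hφ]
    exact (Subspace.forall_mem_dualAnnihilator_apply_eq_zero_iff W x.rep).symm
  rw [this]
  exact isClosed_biInter fun φ _ => isClosed_setOf_vanishesAt (isHomogeneous_lin _)

instance t1Space_projSpace : T1Space (ProjSpace n) := by
  refine ⟨fun x => ?_⟩
  have : {x} = subspaceSet x.submodule := by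
    ext y
    rw [Set.mem_singleton_iff, subspaceSet, Set.mem_ofPred_eq, Projectivization.submodule_eq,
      Submodule.mem_span_singleton]
    constructor
    · rintro rfl
      exact ⟨1, one_smul _ _⟩
    · rintro ⟨a, ha⟩
      rw [← x.mk_rep, ← y.mk_rep, Projectivization.mk_eq_mk_iff']
      exact ⟨a, ha⟩
  rw [this]
  exact isClosed_subspaceSet _

/-- A product of polynomials vanishes on a linear subspace only if one of them does. -/
lemma forall_mem_eval_eq_zero_or {σ : Type*} (W : Submodule ℂ (σ → ℂ))
    {f g : MvPolynomial σ ℂ} (h : ∀ w ∈ W, eval w f * eval w g = 0) :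
    (∀ w ∈ W, eval w f = 0) ∨ ∀ w ∈ W, eval w g = 0 := by
  by_contra! hcon
  obtain ⟨⟨a, ha, hfa⟩, b, hb, hgb⟩ := hcon
  have key : ∀ (q : MvPolynomial σ ℂ) (c : ℂ),
      (aeval (fun i => Polynomial.C (a i) + Polynomial.C (b i - a i) * Polynomial.X) q).eval c
        = eval (fun i => a i + (b i - a i) * c) q := by
    intro q c
    have : (Polynomial.evalRingHom c).comp (aeval (fun i => Polynomial.C (a i) +
      Polynomial.C (b i - a i) * Polynomial.X) :
        MvPolynomial σ ℂ →ₐ[ℂ] Polynomial ℂ).toRingHom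
        = eval (fun i => a i + (b i - a i) * c) := by
      ext i
      · simp
      · simp
    exact RingHom.congr_fun this q
  -- Restriction to the line that passes through `a` at parameter `0` and `b` at parameter `1`;
  -- polynomials in one variable form a domain.
  set φ : MvPolynomial σ ℂ →ₐ[ℂ] Polynomial ℂ :=
    aeval (fun i => Polynomial.C (a i) + Polynomial.C (b i - a i) * Polynomial.X) with hφ
  have h0 : φ f * φ g = 0 := by
    refine Polynomial.funext fun c => ?_
    rw [Polynomial.eval_mul, key, key, Polynomial.eval_zero]
    refine h _ ?_
    have : (fun i => a i + (b i - a i) * c) = a + c • (b - a) := by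
      ext i; simp [mul_comm]
    rw [this]
    exact W.add_mem ha (W.smul_mem _ (W.sub_mem hb ha))
  rcases mul_eq_zero.1 h0 with h1 | h1
  · apply hfa
    have := key f 0
    rw [h1, Polynomial.eval_zero] at this
    simpa using this.symm
  · apply hgb
    have := key g 1
    rw [h1, Polynomial.eval_zero] at this
    simpa using this.symm

lemma isIrreducible_subspaceSet {W : Submodule ℂ (Fin (n + 1) → ℂ)} (hW : W ≠ ⊥) :
    IsIrreducible (subspaceSet W) := by
  refine isIrreducible_of_coneIdeal ?_ fun f g h => ?_
  · obtain ⟨w, hw, hw0⟩ := W.ne_bot_iff.1 hW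
    exact ⟨_, (mk_mem_subspaceSet hw0).2 hw⟩
  · simp only [mem_coneIdeal, cone_subspaceSet hW, SetLike.mem_coe] at h ⊢
    exact forall_mem_eval_eq_zero_or W fun w hw => by rw [← map_mul]; exact h w hw

lemma isIrreducible_preimage_val {X : Type*} [TopologicalSpace X] {A B : Set X}
    (hA : IsIrreducible A) (h : A ⊆ B) : IsIrreducible (Subtype.val ⁻¹' A : Set B) := by
  refine ⟨?_, ?_⟩
  · obtain ⟨a, ha⟩ := hA.nonempty
    exact ⟨⟨a, h ha⟩, ha⟩
  · rintro _ _ ⟨u, hu, rfl⟩ ⟨v, hv, rfl⟩ ⟨x, hxA, hxu⟩ ⟨y, hyA, hyv⟩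
    obtain ⟨z, hzA, hzu, hzv⟩ := hA.isPreirreducible u v hu hv ⟨x, hxA, hxu⟩ ⟨y, hyA, hyv⟩
    exact ⟨⟨z, h hzA⟩, hzA, hzu, hzv⟩

/-- A strict chain of three irreducible closed sets bounds the dimension from below. -/
lemma two_le_topologicalKrullDim {X : Type*} [TopologicalSpace X] {A B D : Set X}
    (hA : IsIrreducible A) (hB : IsIrreducible B) (hD : IsIrreducible D)
    (hAc : IsClosed A) (hBc : IsClosed B) (hAB : A ⊂ B) (hBD : B ⊂ D) :
    2 ≤ topologicalKrullDim D := by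
  let a : TopologicalSpace.IrreducibleCloseds D :=
    ⟨Subtype.val ⁻¹' A, isIrreducible_preimage_val hA (hAB.1.trans hBD.1),
      hAc.preimage continuous_subtype_val⟩
  let b : TopologicalSpace.IrreducibleCloseds D :=
    ⟨Subtype.val ⁻¹' B, isIrreducible_preimage_val hB hBD.1,
      hBc.preimage continuous_subtype_val⟩
  let d : TopologicalSpace.IrreducibleCloseds D :=
    ⟨Set.univ, by
      have := isIrreducible_preimage_val hD subset_rfl
      rwa [Subtype.coe_preimage_self] at this, isClosed_univ⟩
  have hab : a < b := by
    obtain ⟨x, hxB, hxA⟩ := Set.exists_of_ssubset hAB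
    refine lt_of_le_not_ge (fun y hy => hAB.1 hy) fun hle => hxA ?_
    exact hle (show (⟨x, hBD.1 hxB⟩ : D) ∈ b from hxB)
  have hbd : b < d := by
    obtain ⟨x, hxD, hxB⟩ := Set.exists_of_ssubset hBD
    refine lt_of_le_not_ge (fun y _ => Set.mem_univ y) fun hle => hxB ?_
    exact hle (show (⟨x, hxD⟩ : D) ∈ d from Set.mem_univ _)
  have h2 : ((2 : ℕ) : WithBot ℕ∞) ≤ topologicalKrullDim D := by
    let l₁ : LTSeries (TopologicalSpace.IrreducibleCloseds D) := (RelSeries.singleton _ d).cons b hbd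
    let l₂ : LTSeries (TopologicalSpace.IrreducibleCloseds D) := l₁.cons a hab
    exact Order.le_krullDim_iff.2 ⟨l₂, rfl⟩
  exact_mod_cast h2

/-- Proper closed subsets of an irreducible curve are finite. -/
lemma IsIrreducibleCurve.finite_of_ssubset {C : Set (ProjSpace n)} (hC : IsIrreducibleCurve C)
    {Y : Set (ProjSpace n)} (hY : IsClosed Y) (hYC : Y ⊂ C) : Y.Finite := by
  obtain ⟨T, hT, hTc, hTi, rfl⟩ :=
    TopologicalSpace.NoetherianSpace.exists_finite_set_isClosed_irreducible hY
  refine hT.sUnion fun t ht => ?_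
  obtain ⟨x, hx⟩ := (hTi t ht).nonempty
  by_cases hxt : t = {x}
  · rw [hxt]
    exact Set.finite_singleton x
  · exfalso
    -- A component larger than a point would lie in the middle of a chain of length two ending in
    -- `C`.
    have h1 : ({x} : Set (ProjSpace n)) ⊂ t :=
      lt_of_le_of_ne (Set.singleton_subset_iff.2 hx) (Ne.symm hxt)
    have h2 : t ⊂ C := lt_of_le_of_lt (Set.subset_sUnion_of_mem ht) hYC
    have := two_le_topologicalKrullDim isIrreducible_singleton (hTi t ht) hC.isIrreducible
      isClosed_singleton (hTc t ht) h1 h2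
    rw [hC.dim_eq_one] at this
    exact absurd this (by decide)

/-- The ideal of the origin contributes one more prime on top of a chain of cone ideals. -/
lemma coneIdeal_lt_vanishingIdeal_zero {Y : Set (ProjSpace n)} (hY : Y.Nonempty) :
    coneIdeal Y < vanishingIdeal ℂ {(0 : Fin (n + 1) → ℂ)} := by
  obtain ⟨x, hx⟩ := hY
  refine lt_of_le_not_ge ?_ fun h => ?_
  · intro f hf
    rw [mem_vanishingIdeal_singleton_iff]
    simpa using mem_coneIdeal.1 hf _ (smul_mem_cone (rep_mem_cone hx) 0)
  · refine x.rep_nonzero (funext fun i => ?_)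
    have := mem_coneIdeal.1 (h (show X i ∈ vanishingIdeal ℂ {(0 : Fin (n + 1) → ℂ)} by simp)) _ (rep_mem_cone hx)
    simpa using this

/-- The dimension of a proper closed subset of projective space. -/
lemma topologicalKrullDim_le_of_isClosed {S : Set (ProjSpace 3)} (hS : IsClosed S)
    (hne : S ≠ Set.univ) : topologicalKrullDim S ≤ 2 := by
  have hnonzero : ⊥ < coneIdeal S := by
    rw [bot_lt_iff_ne_bot]
    intro h
    refine hne (Set.univ_subset_iff.1 ((coneIdeal_le_coneIdeal_iff hS).1 ?_))
    rw [h]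
    exact bot_le
  have hle : Order.krullDim (TopologicalSpace.IrreducibleCloseds S)ᵒᵈ ≤ ((2 : ℕ) : WithBot ℕ∞) := by
    refine iSup_le fun l => ?_
    let ι := TopologicalSpace.IrreducibleCloseds.map (Subtype.val : S → ProjSpace 3)
      continuous_subtype_val
    have hι : StrictMono ι :=
      TopologicalSpace.IrreducibleCloseds.map_strictMono_of_isInducing
        Topology.IsInducing.subtypeVal
    have hιS : ∀ z, (ι z : Set (ProjSpace 3)) ⊆ S := by
      intro z
      exact closure_minimal (by rintro _ ⟨y, -, rfl⟩; exact y.2) hS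
    let F : (TopologicalSpace.IrreducibleCloseds S)ᵒᵈ →
        PrimeSpectrum (MvPolynomial (Fin 4) ℂ) :=
      fun z => ⟨coneIdeal (ι (OrderDual.ofDual z) : Set (ProjSpace 3)),
        coneIdeal_isPrime (ι _).isIrreducible⟩
    have hF : StrictMono F := fun z w hzw =>
      coneIdeal_lt_coneIdeal (ι _).isClosed (hι hzw)
    let m : PrimeSpectrum (MvPolynomial (Fin 4) ℂ) :=
      ⟨vanishingIdeal ℂ {(0 : Fin 4 → ℂ)}, inferInstance⟩
    -- A chain in `S` gains the ideal of the origin on top and the zero ideal below. The longer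
    -- chain has length at most four, whence the bound two.
    let l₁ : LTSeries (PrimeSpectrum (MvPolynomial (Fin 4) ℂ)) := (l.map F hF).snoc m (by
      rw [LTSeries.last_map]
      exact coneIdeal_lt_vanishingIdeal_zero (ι _).isIrreducible.nonempty)
    let l₂ : LTSeries (PrimeSpectrum (MvPolynomial (Fin 4) ℂ)) := l₁.cons ⊥ (by
      rw [RelSeries.head_snoc, LTSeries.head_map]
      exact hnonzero.trans_le (coneIdeal_anti (hιS _)))
    have h1 : (l₂.length : WithBot ℕ∞) ≤ Order.krullDim _ := Order.LTSeries.length_le_krullDim l₂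
    have h2 : Order.krullDim (PrimeSpectrum (MvPolynomial (Fin 4) ℂ)) = 4 := by
      have := MvPolynomial.ringKrullDim_of_isNoetherianRing (R := ℂ) (ι := Fin 4)
      rw [ringKrullDim_eq_zero_of_field] at this
      simpa [ringKrullDim] using this
    rw [h2] at h1
    have h3 : l₂.length = l.length + 1 + 1 := by
      simp only [l₂, l₁, RelSeries.cons_length, RelSeries.snoc_length, LTSeries.map_length]
    rw [h3] at h1
    have h4 : l.length + 1 + 1 ≤ 4 := by exact_mod_cast h1
    have h5 : l.length ≤ 2 := by omega
    exact_mod_cast h5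
  rw [Order.krullDim_orderDual] at hle
  exact_mod_cast hle

end

/-! ### Second derivatives and restriction to lines -/

lemma pderiv_pderiv_comm {σ : Type*} (i j : σ) (f : MvPolynomial σ ℂ) :
    pderiv i (pderiv j f) = pderiv j (pderiv i f) := by
  classical
  let D : σ → Derivation ℂ (MvPolynomial σ ℂ) (MvPolynomial σ ℂ) := fun i => pderiv i
  -- A commutator of derivations is a derivation, and this one kills the variables.
  have : ⁅D i, D j⁆ = 0 := by
    refine derivation_ext fun k => ?_
    rw [Derivation.commutator_apply]
    simp only [D, pderiv_X, Pi.single_apply, Derivation.zero_apply]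
    split_ifs <;> simp
  have h := congrArg (fun D => D f) this
  simp only [D, Derivation.commutator_apply, Derivation.zero_apply] at h
  exact sub_eq_zero.1 h

lemma eval_restrictToLine {n : ℕ} (f : MvPolynomial (Fin (n + 1)) ℂ) (x v : Fin (n + 1) → ℂ)
    (c : ℂ) : (restrictToLine f x v).eval c = eval (x + c • v) f := by
  have : ((Polynomial.evalRingHom c).comp
      (aeval (fun i => Polynomial.C (x i) + Polynomial.X * Polynomial.C (v i)) :
        MvPolynomial (Fin (n + 1)) ℂ →ₐ[ℂ] Polynomial ℂ).toRingHom) = eval (x + c • v) := by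
    ext i
    · simp
    · simp; ring
  exact RingHom.congr_fun this f

lemma derivative_restrictToLine {n : ℕ} (f : MvPolynomial (Fin (n + 1)) ℂ)
    (x v : Fin (n + 1) → ℂ) : Polynomial.derivative (restrictToLine f x v)
      = ∑ i, restrictToLine (pderiv i f) x v * Polynomial.C (v i) := by
  classical
  unfold restrictToLine
  induction f using MvPolynomial.induction_on with
  | C a => simp
  | add p q hp hq => simp only [map_add, hp, hq, add_mul, Finset.sum_add_distrib]
  | mul_X p j hp =>
    rw [map_mul, Polynomial.derivative_mul, hp, aeval_X, Finset.sum_mul]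
    have : ∀ i, aeval (fun i => Polynomial.C (x i) + Polynomial.X * Polynomial.C (v i))
        (pderiv i (p * X j)) * Polynomial.C (v i)
        = aeval (fun i => Polynomial.C (x i) + Polynomial.X * Polynomial.C (v i)) (pderiv i p)
          * Polynomial.C (v i) * (Polynomial.C (x j) + Polynomial.X * Polynomial.C (v j))
          + if j = i then aeval (fun i => Polynomial.C (x i) + Polynomial.X * Polynomial.C (v i)) p
            * Polynomial.C (v j) else 0 := by
      intro i
      rw [Derivation.leibniz, pderiv_X]
      by_cases hij : j = i
      · subst hij
        simp; ring
      · simp [hij]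
        ring
    rw [Finset.sum_congr rfl fun i _ => this i, Finset.sum_add_distrib, Finset.sum_ite_eq]
    simp

lemma eval_derivative_restrictToLine {n : ℕ} (f : MvPolynomial (Fin (n + 1)) ℂ)
    (x v : Fin (n + 1) → ℂ) (c : ℂ) :
    (Polynomial.derivative (restrictToLine f x v)).eval c = grad f (x + c • v) ⬝ᵥ v := by
  rw [derivative_restrictToLine, Polynomial.eval_finsetSum]
  simp [eval_restrictToLine, dotProduct, grad]

/-- The differential of a polynomial vanishing on a linear subspace. -/
lemma grad_dotProduct_eq_zero_of_forall_mem {n : ℕ} {F : MvPolynomial (Fin (n + 1)) ℂ}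
    {W : Submodule ℂ (Fin (n + 1) → ℂ)} (hF : ∀ w ∈ W, eval w F = 0)
    {h w : Fin (n + 1) → ℂ} (hh : h ∈ W) (hw : w ∈ W) : grad F h ⬝ᵥ w = 0 := by
  have h0 : restrictToLine F h w = 0 := Polynomial.funext fun c => by
    rw [eval_restrictToLine, hF _ (W.add_mem hh (W.smul_mem c hw)), Polynomial.eval_zero]
  have := eval_derivative_restrictToLine F h w 0
  rw [h0] at this
  simpa using this.symm

/-- The chain rule. -/
lemma grad_aeval {m k : ℕ} (x : Fin m → MvPolynomial (Fin k) ℂ) (F : MvPolynomial (Fin m) ℂ)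
    (v y : Fin k → ℂ) : grad (aeval x F) v ⬝ᵥ y
      = grad F (fun i => eval v (x i)) ⬝ᵥ fun i => grad (x i) v ⬝ᵥ y := by
  classical
  induction F using MvPolynomial.induction_on with
  | C a =>
    rw [algHom_C, algebraMap_eq, grad_C, grad_C, zero_dotProduct, zero_dotProduct]
  | add p q hp hq => rw [map_add, grad_add, grad_add, add_dotProduct, add_dotProduct, hp, hq]
  | mul_X p i hp =>
    have hX : grad (X i : MvPolynomial (Fin m) ℂ) (fun i => eval v (x i)) = Pi.single i 1 := by
      ext j
      simp only [grad, pderiv_X, Pi.single_apply]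
      split_ifs <;> simp_all
    rw [map_mul, grad_mul, grad_mul, add_dotProduct, add_dotProduct, smul_dotProduct,
      smul_dotProduct, smul_dotProduct, smul_dotProduct, hp, aeval_X, eval_aeval, hX,
      single_one_dotProduct, eval_X]

/-- The Hessian of `f` at `v`, applied to `y`. -/
def hess {m : ℕ} (f : MvPolynomial (Fin m) ℂ) (v y : Fin m → ℂ) : Fin m → ℂ :=
  fun i => grad (pderiv i f) v ⬝ᵥ y

lemma hess_dotProduct {m : ℕ} (f : MvPolynomial (Fin m) ℂ) (v y z : Fin m → ℂ) :
    hess f v y ⬝ᵥ z = ∑ i, ∑ j, eval v (pderiv i (pderiv j f)) * y i * z j := by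
  simp only [hess, dotProduct, grad, Finset.sum_mul]
  exact Finset.sum_comm

lemma hess_dotProduct_comm {m : ℕ} (f : MvPolynomial (Fin m) ℂ) (v y z : Fin m → ℂ) :
    hess f v y ⬝ᵥ z = hess f v z ⬝ᵥ y := by
  rw [hess_dotProduct, hess_dotProduct, Finset.sum_comm]
  refine Finset.sum_congr rfl fun i _ => Finset.sum_congr rfl fun j _ => ?_
  rw [pderiv_pderiv_comm]
  ring

lemma hess_add_left {m : ℕ} (f g : MvPolynomial (Fin m) ℂ) (v y : Fin m → ℂ) :
    hess (f + g) v y = hess f v y + hess g v y := by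
  ext i
  simp [hess, grad_add, add_dotProduct]

lemma hess_C_mul {m : ℕ} (c : ℂ) (f : MvPolynomial (Fin m) ℂ) (v y : Fin m → ℂ) :
    hess (C c * f) v y = c • hess f v y := by
  ext i
  simp [hess, grad_mul, grad_C]

lemma grad_C_mul {σ : Type*} (c : ℂ) (f : MvPolynomial σ ℂ) (v : σ → ℂ) :
    grad (C c * f) v = c • grad f v := by
  simp [grad_mul, grad_C]

lemma hess_smul {m : ℕ} (f : MvPolynomial (Fin m) ℂ) (v y : Fin m → ℂ) (c : ℂ) :
    hess f v (c • y) = c • hess f v y := by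
  ext i
  simp [hess]

lemma hess_add {m : ℕ} (f : MvPolynomial (Fin m) ℂ) (v y z : Fin m → ℂ) :
    hess f v (y + z) = hess f v y + hess f v z := by
  ext i
  simp [hess]

/-- The determinant formed by the differentials of `f` and `g` and two constant covectors. -/
def gdet (f g : MvPolynomial (Fin 4) ℂ) (c d : Fin 4 → ℂ) : MvPolynomial (Fin 4) ℂ :=
  det4 (fun i => pderiv i f) (fun i => pderiv i g) (fun i => C (c i)) (fun i => C (d i))

lemma eval_gdet (f g : MvPolynomial (Fin 4) ℂ) (c d v : Fin 4 → ℂ) :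
    eval v (gdet f g c d) = det4 (grad f v) (grad g v) c d := by
  rw [gdet, map_det4]
  congr 1 <;> ext i <;> simp

lemma isHomogeneous_det4 {R : Type*} [CommRing R] {m : ℕ} {a b c d : Fin 4 → MvPolynomial (Fin m) R}
    {e₁ e₂ e₃ e₄ : ℕ}
    (ha : ∀ i, (a i).IsHomogeneous e₁) (hb : ∀ i, (b i).IsHomogeneous e₂)
    (hc : ∀ i, (c i).IsHomogeneous e₃) (hd : ∀ i, (d i).IsHomogeneous e₄) :
    (det4 a b c d).IsHomogeneous ((e₁ + e₂) + (e₃ + e₄)) := by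
  have h1 : ∀ i j, (a i * b j - a j * b i).IsHomogeneous (e₁ + e₂) := fun i j =>
    ((ha i).mul (hb j)).sub ((ha j).mul (hb i))
  have h2 : ∀ i j, (c i * d j - c j * d i).IsHomogeneous (e₃ + e₄) := fun i j =>
    ((hc i).mul (hd j)).sub ((hc j).mul (hd i))
  rw [det4_eq]
  exact (((((h1 _ _).mul (h2 _ _)).sub ((h1 _ _).mul (h2 _ _))).add
    ((h1 _ _).mul (h2 _ _))).add ((h1 _ _).mul (h2 _ _))).sub ((h1 _ _).mul (h2 _ _))
      |>.add ((h1 _ _).mul (h2 _ _))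

lemma exists_isHomogeneous_gdet {f g : MvPolynomial (Fin 4) ℂ} (hf : ∃ d, f.IsHomogeneous d)
    (hg : ∃ d, g.IsHomogeneous d) : ∃ e, ∀ c d, (gdet f g c d).IsHomogeneous e := by
  obtain ⟨m, hm⟩ := hf
  obtain ⟨k, hk⟩ := hg
  exact ⟨_, fun c d => isHomogeneous_det4 (fun i => isHomogeneous_pderiv hm i)
    (fun i => isHomogeneous_pderiv hk i) (fun i => isHomogeneous_C _ _)
    (fun i => isHomogeneous_C _ _)⟩

lemma derivation_det4 {A : Type*} [CommRing A] [Algebra ℂ A] (D : Derivation ℂ A A)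
    (a b c d : Fin 4 → A) : D (det4 a b c d) = det4 (fun i => D (a i)) b c d
      + det4 a (fun i => D (b i)) c d + det4 a b (fun i => D (c i)) d
      + det4 a b c (fun i => D (d i)) := by
  simp only [det4_eq, map_add, map_sub, Derivation.leibniz, smul_eq_mul]
  ring

lemma grad_gdet_dotProduct (f g : MvPolynomial (Fin 4) ℂ) (c d v y : Fin 4 → ℂ) :
    grad (gdet f g c d) v ⬝ᵥ y
      = det4 (hess f v y) (grad g v) c d + det4 (grad f v) (hess g v y) c d := by
  have hy : vecEval (fun i => C (y i)) v = y := by ext i; simp [vecEval]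
  have h1 : grad (gdet f g c d) v ⬝ᵥ y = eval v (vder (fun i => C (y i)) (gdet f g c d)) := by
    rw [eval_vder, hy]
  rw [h1, gdet, derivation_det4]
  simp only [map_add, map_det4, derivation_C]
  have h2 : ∀ q : MvPolynomial (Fin 4) ℂ,
      (eval v ∘ fun i => vder (fun i => C (y i)) (pderiv i q)) = hess q v y := by
    intro q
    ext i
    rw [Function.comp_apply, eval_vder, hy, hess]
  have h3 : ∀ q : MvPolynomial (Fin 4) ℂ, (eval v ∘ fun i => pderiv i q) = grad q v :=
    fun q => rfl
  have h4 : ∀ q : Fin 4 → ℂ, (eval v ∘ fun i => C (q i)) = q := by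
    intro q; ext i; simp
  rw [h2, h2, h3, h3, h4, h4]
  have h5 : (eval v ∘ fun _ : Fin 4 => (0 : MvPolynomial (Fin 4) ℂ)) = 0 := by
    ext i; simp
  rw [h5]
  simp [det4_eq]

lemma det4_comb_left (a b c d : Fin 4 → ℂ) (r s : ℂ) :
    det4 (r • a + s • b) b c d = r * det4 a b c d := by
  simp only [det4_eq, Pi.add_apply, Pi.smul_apply, smul_eq_mul]
  ring

lemma det4_comb_right (a b c d : Fin 4 → ℂ) (r s : ℂ) :
    det4 a (r • a + s • b) c d = s * det4 a b c d := by
  simp only [det4_eq, Pi.add_apply, Pi.smul_apply, smul_eq_mul]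
  ring

lemma det4_eq_zero_of_mem_span {a b c : Fin 4 → ℂ} (h : c ∈ Submodule.span ℂ {a, b})
    (d : Fin 4 → ℂ) : det4 a b c d = 0 := by
  obtain ⟨r, s, rfl⟩ := Submodule.mem_span_pair.1 h
  simp only [det4_eq, Pi.add_apply, Pi.smul_apply, smul_eq_mul]
  ring

lemma linearIndependent_left_of_det4_ne_zero {a b c d : Fin 4 → ℂ} (h : det4 a b c d ≠ 0) :
    LinearIndependent ℂ ![a, b] := by
  by_contra hli
  apply h
  rw [← cof_dotProduct, cof_eq_zero_of_not_linearIndependent hli, zero_dotProduct]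

lemma mem_span_of_forall_det4_eq_zero {a b c : Fin 4 → ℂ} (h : LinearIndependent ℂ ![a, b])
    (hc : ∀ d, det4 a b c d = 0) : c ∈ Submodule.span ℂ {a, b} := by
  by_contra hnot
  obtain ⟨d, hd⟩ := exists_det4_ne_zero (linearIndependent_triple h hnot)
  exact hd (hc d)

lemma exists_det4_ne_zero_of_pair {a b : Fin 4 → ℂ} (h : LinearIndependent ℂ ![a, b]) :
    ∃ c d, det4 a b c d ≠ 0 := by
  obtain ⟨c, hc⟩ := exists_linearIndependent_snoc_of_lt_finrank h (by simp)
  have h2 : ![a, b, c] = Fin.snoc (α := fun _ => Fin 4 → ℂ) ![a, b] c := by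
    funext i
    fin_cases i <;> rfl
  rw [← h2] at hc
  exact ⟨c, exists_det4_ne_zero hc⟩

/-! ### The dual cone: primality, closedness, properness -/

/-- The covectors that vanish on some tangent space of the cone `Z`. -/
def dualCone (I : Ideal (MvPolynomial (Fin 4) ℂ)) (Z : Set (Fin 4 → ℂ)) : Set (Fin 4 → ℂ) :=
  {h | ∃ v ∈ Z, v ≠ 0 ∧ h ∈ nrm I v}

/-- The ideal of the dual cone. -/
def dualIdeal (I : Ideal (MvPolynomial (Fin 4) ℂ)) (Z : Set (Fin 4 → ℂ)) :
    Ideal (MvPolynomial (Fin 4) ℂ) := vanishingIdeal ℂ (dualCone I Z)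

lemma mem_dualIdeal {I : Ideal (MvPolynomial (Fin 4) ℂ)} {Z : Set (Fin 4 → ℂ)}
    {F : MvPolynomial (Fin 4) ℂ} : F ∈ dualIdeal I Z ↔ ∀ h ∈ dualCone I Z, eval h F = 0 := by
  simp [dualIdeal, mem_vanishingIdeal_iff]

lemma smul_mem_dualCone {I : Ideal (MvPolynomial (Fin 4) ℂ)} {Z : Set (Fin 4 → ℂ)}
    {h : Fin 4 → ℂ} (hh : h ∈ dualCone I Z) (c : ℂ) : c • h ∈ dualCone I Z := by
  obtain ⟨v, hv, hv0, hh⟩ := hh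
  exact ⟨v, hv, hv0, (nrm I v).smul_mem c hh⟩

lemma homogeneousComponent_mem_dualIdeal {I : Ideal (MvPolynomial (Fin 4) ℂ)}
    {Z : Set (Fin 4 → ℂ)} {F : MvPolynomial (Fin 4) ℂ} (hF : F ∈ dualIdeal I Z) (d : ℕ) :
    homogeneousComponent d F ∈ dualIdeal I Z := by
  rw [mem_dualIdeal] at hF ⊢
  exact fun h hh =>
    eval_homogeneousComponent_eq_zero (fun c _ => hF _ (smul_mem_dualCone hh c)) d

lemma eval_sum_mul_vder (f : MvPolynomial (Fin 4) ℂ) (τ : Fin 4 → MvPolynomial (Fin 4) ℂ)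
    (v : Fin 4 → ℂ) : eval v (∑ i, τ i * vder τ (pderiv i f))
      = hess f v (vecEval τ v) ⬝ᵥ vecEval τ v := by
  rw [map_sum]
  refine Finset.sum_congr rfl fun i _ => ?_
  rw [map_mul, eval_vder, mul_comm]
  rfl

/-- `F` vanishes on the whole linear space `nrm I v`, so its differential at `h` kills that space,
whose annihilator is the tangent space. -/
lemma grad_dualIdeal_mem_tang {I : Ideal (MvPolynomial (Fin 4) ℂ)}
    {Z : Set (Fin 4 → ℂ)} {F : MvPolynomial (Fin 4) ℂ} (hF : F ∈ dualIdeal I Z)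
    {v h : Fin 4 → ℂ} (hv : v ∈ Z) (hv0 : v ≠ 0) (hh : h ∈ nrm I v) :
    grad F h ∈ tang I v := by
  intro f hf
  rw [dotProduct_comm]
  exact grad_dotProduct_eq_zero_of_forall_mem
    (fun w hw => mem_dualIdeal.1 hF w ⟨v, hv, hv0, hw⟩) hh (grad_mem_nrm hf v)

namespace IsCurveCone

variable {I : Ideal (MvPolynomial (Fin 4) ℂ)} {Z : Set (Fin 4 → ℂ)} (hI : IsCurveCone I Z)
include hI

/-- Transfers equations of the dual cone to the curve by substituting gradients; there they can be
differentiated and tested against the prime ideal `I`. -/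
lemma mem_dualIdeal_iff {F : MvPolynomial (Fin 4) ℂ} :
    F ∈ dualIdeal I Z ↔ ∀ f ∈ I, aeval (fun i => pderiv i f) F ∈ I := by
  rw [mem_dualIdeal]
  constructor
  · intro h f hf
    refine hI.mem_of_forall_ne_zero fun v hv hv0 => ?_
    rw [eval_aeval]
    exact h _ ⟨v, hv, hv0, grad_mem_nrm hf v⟩
  · rintro h _ ⟨v, hv, hv0, f, hf, rfl⟩
    have := hI.eval_eq_zero (h f hf) hv
    rwa [eval_aeval] at this

lemma exists_eval_ne_zero {f : MvPolynomial (Fin 4) ℂ} (hf : f ∉ I) :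
    ∃ v ∈ Z, v ≠ 0 ∧ eval v f ≠ 0 := by
  by_contra! h
  exact hf (hI.mem_of_forall_ne_zero h)

lemma zero_mem_dualCone : (0 : Fin 4 → ℂ) ∈ dualCone I Z := by
  obtain ⟨v, hv, hv0⟩ := hI.exists_mem_ne_zero
  exact ⟨v, hv, hv0, (nrm I v).zero_mem⟩

/-- Two polynomials outside the ideal are both nonzero somewhere on `nrm I v` for one common `v`,
and a linear space is irreducible. -/
lemma dualIdeal_isPrime : (dualIdeal I Z).IsPrime := by
  have hP := hI.isPrime
  refine ⟨fun h => ?_, fun {F G} hFG => ?_⟩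
  · have := mem_dualIdeal.1 ((Ideal.eq_top_iff_one _).1 h) 0 hI.zero_mem_dualCone
    simp at this
  · by_contra! hcon
    obtain ⟨hF, hG⟩ := hcon
    rw [hI.mem_dualIdeal_iff] at hF hG
    push Not at hF hG
    obtain ⟨f, hf, hFf⟩ := hF
    obtain ⟨g, hg, hGg⟩ := hG
    obtain ⟨v, hv, hv0, hne⟩ := hI.exists_eval_ne_zero (hP.mul_notMem hFf hGg)
    rw [map_mul, eval_aeval, eval_aeval] at hne
    have h0 : ∀ w ∈ nrm I v, eval w F * eval w G = 0 := fun w hw => by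
      rw [← map_mul]
      exact mem_dualIdeal.1 hFG w ⟨v, hv, hv0, hw⟩
    rcases forall_mem_eval_eq_zero_or _ h0 with h | h
    · exact left_ne_zero_of_mul hne (h _ (grad_mem_nrm hf v))
    · exact right_ne_zero_of_mul hne (h _ (grad_mem_nrm hg v))

lemma det4_grad_eq_zero {v h : Fin 4 → ℂ} (hv : v ∈ Z) (hv0 : v ≠ 0) (hh : h ∈ nrm I v)
    {f g : MvPolynomial (Fin 4) ℂ} (hf : f ∈ I) (hg : g ∈ I) (w : Fin 4 → ℂ) :
    det4 (grad f v) (grad g v) h w = 0 := by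
  by_contra hne
  have hli := linearIndependent_left_of_det4_ne_zero hne
  rw [← hI.span_grad_eq hv hv0 hf hg hli] at hh
  exact hne (det4_eq_zero_of_mem_span hh w)

/-- The dual cone is cut out by homogeneous polynomials. -/
lemma exists_isHomogeneous_of_notMem_dualCone {h : Fin 4 → ℂ} (hh : h ∉ dualCone I Z) :
    ∃ G ∈ dualIdeal I Z, (∃ d, G.IsHomogeneous d) ∧ eval h G ≠ 0 := by
  let A := {f : MvPolynomial (Fin 4) ℂ // f ∈ I ∧ ∃ d, f.IsHomogeneous d}
  -- The unknown is the point of tangency: the first equations put it on the cone, the determinants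
  -- put the parameter in the span of two gradients at it.
  let s : A ⊕ (A × A × (Fin 4 → ℂ)) → MvPolynomial (Fin 4) (MvPolynomial (Fin 4) ℂ) :=
    Sum.elim (fun f => map C f.1) fun p => det4 (fun i => map C (pderiv i p.1.1))
      (fun i => map C (pderiv i p.2.1.1)) (fun i => C (X i)) (fun i => C (C (p.2.2 i)))
  have hCy : ∀ y : Fin 4 → ℂ, (eval y).comp (C : ℂ →+* MvPolynomial (Fin 4) ℂ) =
      RingHom.id ℂ := by intro y; ext; simp
  have hs : solvable s = dualCone I Z := by
    ext y
    have h1 : ∀ (f : A) x, eval x (map (eval y) (s (Sum.inl f))) = eval x f.1 := by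
      intro f x
      simp [s, map_map, hCy]
    have h2 : ∀ (p : A × A × (Fin 4 → ℂ)) x, eval x (map (eval y) (s (Sum.inr p)))
        = det4 (grad p.1.1 x) (grad p.2.1.1 x) y p.2.2 := by
      intro p x
      simp only [s, Sum.elim_inr, map_det4]
      congr 1 <;> ext i <;> simp [map_map, hCy, grad]
    constructor
    · rintro ⟨x, hx0, hx⟩
      have hxZ : x ∈ Z := by
        refine hI.mem_of_forall x fun f hf => ?_
        rw [← sum_homogeneousComponent f, map_sum]
        refine Finset.sum_eq_zero fun d _ => ?_
        have := hx (Sum.inl ⟨homogeneousComponent d f, hI.homogeneousComponent_mem hf d,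
          d, homogeneousComponent_isHomogeneous d f⟩)
        rwa [h1] at this
      obtain ⟨g₁, hg₁, g₂, hg₂, hh₁, hh₂, hli⟩ := hI.exists_pair hxZ hx0
      refine ⟨x, hxZ, hx0, ?_⟩
      rw [← hI.span_grad_eq hxZ hx0 hg₁ hg₂ hli]
      refine mem_span_of_forall_det4_eq_zero hli fun w => ?_
      have := hx (Sum.inr ⟨⟨g₁, hg₁, hh₁⟩, ⟨g₂, hg₂, hh₂⟩, w⟩)
      rwa [h2] at this
    · rintro ⟨v, hv, hv0, hy⟩
      refine ⟨v, hv0, ?_⟩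
      rintro (f | p)
      · rw [h1]
        exact hI.eval_eq_zero f.2.1 hv
      · rw [h2]
        exact hI.det4_grad_eq_zero hv hv0 hy p.1.2.1 p.2.1.2.1 _
  have hhom : ∀ i, ∃ d, (s i).IsHomogeneous d := by
    rintro (f | p)
    · obtain ⟨d, hd⟩ := f.2.2
      exact ⟨d, hd.map _⟩
    · obtain ⟨d, hd⟩ := p.1.2.2
      obtain ⟨e, he⟩ := p.2.1.2.2
      exact ⟨_, isHomogeneous_det4 (fun i => (isHomogeneous_pderiv hd i).map _)
        (fun i => (isHomogeneous_pderiv he i).map _) (fun i => isHomogeneous_C _ _)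
        (fun i => isHomogeneous_C _ _)⟩
  obtain ⟨G, hG, hGh, hG0⟩ := exists_isHomogeneous_of_notMem_solvable hhom
    (fun z hz c _ => by rw [hs] at hz ⊢; exact smul_mem_dualCone hz c) (by rwa [hs])
  rw [hs] at hG0
  exact ⟨G, mem_dualIdeal.2 hG0, hG, hGh⟩

/-- The ramification locus of the projection from a line is a proper subset. -/
lemma gdet_notMem {g₁ g₂ : MvPolynomial (Fin 4) ℂ} {a b c d : Fin 4 → ℂ} (h₁ : g₁ ∈ I)
    (h₂ : g₂ ∈ I) (h : gdet g₁ g₂ c d ∉ I) (hab : LinearIndependent ℂ ![a, b]) :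
    gdet g₁ g₂ a b ∉ I := by
  intro hmem
  obtain ⟨v, hv, hbv⟩ := hI.nondegenerate b (hab.ne_zero 1)
  have hv0 : v ≠ 0 := by rintro rfl; simp at hbv
  -- Vanishing of the determinant along the curve means that the ratio of `lin a` and `lin b` has
  -- zero differential. It would then be constant, and `C` would lie in a plane of the pencil.
  have key := hI.sub_C_mul_mem (P := lin a) (Q := lin b) (isHomogeneous_lin a)
    (isHomogeneous_lin b) h (by
      intro w hw _ hE y hy
      rw [eval_gdet] at hE
      have hli := linearIndependent_left_of_det4_ne_zero hE
      rw [grad_lin, grad_lin, eval_lin, eval_lin]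
      by_contra hne
      have h0 : det4 (grad g₁ w) (grad g₂ w) a b = 0 := by
        rw [← eval_gdet]
        exact hI.eval_eq_zero hmem hw
      refine det4_ne_zero_of_linearIndependent ?_ h0
      rw [Fintype.linearIndependent_iff]
      intro r hr
      simp only [Fin.sum_univ_four, Matrix.cons_val] at hr
      have hw1 := congrArg (· ⬝ᵥ w) hr
      have hy1 := congrArg (· ⬝ᵥ y) hr
      have hwt := hI.self_mem_tang hw
      simp only [add_dotProduct, smul_dotProduct, hwt g₁ h₁, hwt g₂ h₂, hy g₁ h₁, hy g₂ h₂,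
        smul_eq_mul, mul_zero, zero_add, zero_dotProduct] at hw1 hy1
      have hne' : b ⬝ᵥ w * a ⬝ᵥ y - a ⬝ᵥ w * b ⬝ᵥ y ≠ 0 := sub_ne_zero.2 hne
      have hr2 : r 2 = 0 := by
        refine (mul_eq_zero.1 (?_ : r 2 * (b ⬝ᵥ w * a ⬝ᵥ y - a ⬝ᵥ w * b ⬝ᵥ y) = 0)).resolve_right
          hne'
        linear_combination (b ⬝ᵥ w) * hy1 - (b ⬝ᵥ y) * hw1
      have hr3 : r 3 = 0 := by
        refine (mul_eq_zero.1 (?_ : r 3 * (b ⬝ᵥ w * a ⬝ᵥ y - a ⬝ᵥ w * b ⬝ᵥ y) = 0)).resolve_right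
          hne'
        linear_combination (a ⬝ᵥ y) * hw1 - (a ⬝ᵥ w) * hy1
      rw [hr2, hr3, zero_smul, zero_smul, add_zero, add_zero] at hr
      obtain ⟨hr0, hr1⟩ := LinearIndependent.pair_iff.1 hli _ _ hr
      intro i
      fin_cases i <;> assumption) hv hv0 (by simpa using hbv)
  have hlin : lin a - C (eval v (lin a) / eval v (lin b)) * lin b
      = lin (a + (-(eval v (lin a) / eval v (lin b))) • b) := by
    rw [lin_add, lin_smul, map_neg]
    ring
  rw [hlin, hI.lin_mem_iff] at key
  have := LinearIndependent.pair_iff.1 hab 1 _ (by rw [one_smul]; exact key)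
  exact one_ne_zero this.1

/-- The dual cone is a proper subset. -/
lemma exists_notMem_dualCone : ∃ h, h ∉ dualCone I Z := by
  obtain ⟨v, hv, hv0⟩ := hI.exists_mem_ne_zero
  obtain ⟨g₁, h₁, g₂, h₂, hh₁, hh₂, hli⟩ := hI.exists_pair hv hv0
  obtain ⟨c, d, hcd⟩ := exists_det4_ne_zero_of_pair hli
  have hE : gdet g₁ g₂ c d ∉ I := fun h => hcd (by rw [← eval_gdet]; exact hI.eval_eq_zero h hv)
  set b : Fin 4 → ℂ := Pi.single 0 1 with hb
  set e : Fin 4 → ℂ := Pi.single 1 1 with he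
  have hb0 : b ≠ 0 := fun h => by simpa [hb] using congrFun h 0
  have he0 : e ≠ 0 := fun h => by simpa [he] using congrFun h 1
  have hbe : b ⬝ᵥ e = 0 := by simp [hb, he]
  obtain ⟨T₁, hT₁, hz₁⟩ := hI.finite_zeros (lin b) ⟨1, isHomogeneous_lin b⟩
    (fun h => hb0 (hI.lin_mem_iff.1 h))
  -- The condition at `e` makes `a` independent of `b`; the conditions on `T₁` keep the axis of the
  -- pencil spanned by `a` and `b` away from the curve.
  obtain ⟨a, ha⟩ : ∃ a : Fin 4 → ℂ, ∀ t ∈ insert e T₁, t ≠ 0 → a ⬝ᵥ t ≠ 0 := by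
    classical
    set T := (hT₁.insert e).toFinset with hT
    have hprod : ∏ t ∈ T.filter (· ≠ 0), lin t ≠ (0 : MvPolynomial (Fin 4) ℂ) := by
      rw [Finset.prod_ne_zero_iff]
      intro t ht h0
      have ht0 := (Finset.mem_filter.1 ht).2
      apply ht0
      ext i
      have := congrArg (eval (Pi.single i 1)) h0
      simpa using this
    obtain ⟨a, ha⟩ : ∃ a, eval a (∏ t ∈ T.filter (· ≠ 0), lin t) ≠ 0 := by
      by_contra! hcon
      exact hprod (MvPolynomial.funext fun x => by rw [hcon, map_zero])
    refine ⟨a, fun t ht ht0 => ?_⟩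
    rw [map_prod, Finset.prod_ne_zero_iff] at ha
    have := ha t (Finset.mem_filter.2 ⟨by simpa [hT] using ht, ht0⟩)
    rwa [eval_lin, dotProduct_comm] at this
  have hab : LinearIndependent ℂ ![a, b] := by
    rw [LinearIndependent.pair_iff]
    intro r s hrs
    have h1 := congrArg (· ⬝ᵥ e) hrs
    simp only [add_dotProduct, smul_dotProduct, hbe, mul_zero, add_zero, zero_dotProduct,
      smul_eq_mul] at h1
    have hr : r = 0 := (mul_eq_zero.1 h1).resolve_right (ha e (Set.mem_insert _ _) he0)
    rw [hr, zero_smul, zero_add] at hrs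
    exact ⟨hr, (smul_eq_zero.1 hrs).resolve_right hb0⟩
  have hK := hI.gdet_notMem h₁ h₂ hE hab
  obtain ⟨m, hm⟩ := exists_isHomogeneous_gdet hh₁ hh₂
  obtain ⟨T₂, hT₂, hz₂⟩ := hI.finite_zeros _ ⟨m, hm a b⟩ hK
  by_contra! hcon
  -- A tangent plane of the pencil touches at a ramification point of the projection from the axis.
  -- There are finitely many of these, and each lies on only one plane `a + c • b`.
  refine Set.infinite_univ (α := ℂ)
    ((hT₂.image fun t => -(a ⬝ᵥ t) / (b ⬝ᵥ t)).subset fun c _ => ?_)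
  obtain ⟨w, hw, hw0, hcw⟩ := hcon (a + c • b)
  have hKw : eval w (gdet g₁ g₂ a b) = 0 := by
    rw [eval_gdet]
    have h0 := hI.det4_grad_eq_zero hw hw0 hcw h₁ h₂ b
    rw [← h0]
    simp only [det4_eq, Pi.add_apply, Pi.smul_apply, smul_eq_mul]
    ring
  obtain ⟨t, ht, k, hk, rfl⟩ := hz₂ w hw hw0 hKw
  have h1 : a ⬝ᵥ t + c * (b ⬝ᵥ t) = 0 := by
    have := hI.dotProduct_self_of_mem_nrm hw hcw
    rw [dotProduct_smul, add_dotProduct, smul_dotProduct] at this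
    exact (smul_eq_zero.1 this).resolve_left hk
  have hbt : b ⬝ᵥ t ≠ 0 := by
    intro hbt
    have hat : a ⬝ᵥ t = 0 := by simpa [hbt] using h1
    obtain ⟨s, hs, k', hk', hks⟩ := hz₁ _ hw hw0 (by rw [eval_lin, dotProduct_smul, hbt, smul_zero])
    have hs0 : s ≠ 0 := by
      rintro rfl
      exact hw0 (by rw [hks, smul_zero])
    apply ha s (Set.mem_insert_of_mem _ hs) hs0
    have : a ⬝ᵥ (k • t) = 0 := by rw [dotProduct_smul, hat, smul_zero]
    rw [hks, dotProduct_smul] at this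
    exact (smul_eq_zero.1 this).resolve_left hk'
  refine ⟨t, ht, ?_⟩
  show -(a ⬝ᵥ t) / (b ⬝ᵥ t) = c
  rw [div_eq_iff hbt]
  linear_combination -h1

/-- Take a nonzero form of least degree in the ideal. If its partial derivatives were all in the
ideal they would be zero, contrary to Euler's formula. -/
lemma exists_pderiv_notMem_dualIdeal : ∃ F ∈ dualIdeal I Z, (∃ d, F.IsHomogeneous d) ∧
    ∃ i, pderiv i F ∉ dualIdeal I Z := by
  classical
  have hex : ∃ d, ∃ F ∈ dualIdeal I Z, F ≠ 0 ∧ F.IsHomogeneous d := by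
    obtain ⟨h, hh⟩ := hI.exists_notMem_dualCone
    obtain ⟨G, hG, ⟨d, hd⟩, hGh⟩ := hI.exists_isHomogeneous_of_notMem_dualCone hh
    exact ⟨d, G, hG, by rintro rfl; simp at hGh, hd⟩
  obtain ⟨F, hF, hF0, hd⟩ := Nat.find_spec hex
  set d := Nat.find hex with hd'
  refine ⟨F, hF, ⟨d, hd⟩, ?_⟩
  by_contra! hcon
  rcases Nat.eq_zero_or_pos d with h0 | hpos
  · rw [h0] at hd
    have hC : F = C (coeff 0 F) := totalDegree_eq_zero_iff_eq_C.1 (by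
      rw [hd.totalDegree hF0])
    have := mem_dualIdeal.1 hF 0 hI.zero_mem_dualCone
    rw [hC, eval_C] at this
    exact hF0 (by rw [hC, this, C_0])
  · have hz : ∀ i, pderiv i F = 0 := by
      intro i
      by_contra hne
      exact Nat.find_min hex (m := d - 1) (by omega)
        ⟨_, hcon i, hne, isHomogeneous_pderiv hd i⟩
    have := hd.sum_X_mul_pderiv
    simp only [hz, mul_zero, Finset.sum_const_zero] at this
    rw [eq_comm, smul_eq_zero] at this
    rcases this with h | h
    · omega
    · exact hF0 h

/-! ### The second fundamental form and biduality -/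

/-- The derivative along `y` of the Euler expression `∑ i, X i * pderiv i f`, which belongs to `I`.
-/
lemma hess_dotProduct_self {f : MvPolynomial (Fin 4) ℂ} (hf : f ∈ I) {v y : Fin 4 → ℂ}
    (hy : y ∈ tang I v) : hess f v y ⬝ᵥ v = 0 := by
  have hp : ∑ i, X i * pderiv i f ∈ I := by
    rw [hI.mem_iff]
    intro w hw
    have := hI.self_mem_tang hw f hf
    simpa [dotProduct, grad, mul_comm] using this
  have h1 := hy _ hp
  have h2 := hy _ hf
  rw [grad_sum, sum_dotProduct] at h1
  have h3 : ∀ i, grad (X i * pderiv i f) v ⬝ᵥ y = hess f v y i * v i + grad f v i * y i := by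
    intro i
    have hX : grad (X i : MvPolynomial (Fin 4) ℂ) v = Pi.single i 1 := by
      ext j
      simp only [grad, pderiv_X, Pi.single_apply]
      split_ifs <;> simp_all
    rw [grad_mul, add_dotProduct, smul_dotProduct, smul_dotProduct, hX, single_one_dotProduct,
      eval_X, smul_eq_mul, smul_eq_mul, mul_comm]
    rfl
  rw [Finset.sum_congr rfl fun i _ => h3 i, Finset.sum_add_distrib] at h1
  have h4 : hess f v y ⬝ᵥ v + grad f v ⬝ᵥ y = 0 := h1
  rwa [h2, add_zero] at h4

/-- The general point of a nondegenerate curve is not an inflection point. -/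
lemma exists_hess_ne_zero : ∃ f ∈ I, ∃ v ∈ Z, v ≠ 0 ∧ ∃ y ∈ tang I v, ∃ z ∈ tang I v,
    hess f v y ⬝ᵥ z ≠ 0 := by
  by_contra! hcon
  obtain ⟨v, hv, hv0⟩ := hI.exists_mem_ne_zero
  obtain ⟨g₁, h₁, g₂, h₂, hh₁, hh₂, hli⟩ := hI.exists_pair hv hv0
  obtain ⟨c₀, d₀, hcd⟩ := exists_det4_ne_zero_of_pair hli
  rw [← eval_gdet] at hcd
  have hE : gdet g₁ g₂ c₀ d₀ ∉ I := fun h => hcd (hI.eval_eq_zero h hv)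
  obtain ⟨m, hm⟩ := exists_isHomogeneous_gdet hh₁ hh₂
  -- If all second fundamental forms vanish, the gradients move within their own span, so ratios of
  -- Plücker coordinates of the normal plane have zero differential.
  have hprop : ∀ c d, ∀ w ∈ Z, w ≠ 0 → eval w (gdet g₁ g₂ c₀ d₀) ≠ 0 → ∀ y ∈ tang I w,
      eval w (gdet g₁ g₂ c₀ d₀) * (grad (gdet g₁ g₂ c d) w ⬝ᵥ y)
        = eval w (gdet g₁ g₂ c d) * (grad (gdet g₁ g₂ c₀ d₀) w ⬝ᵥ y) := by
    intro c d w hw hw0 hEw y hy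
    rw [eval_gdet] at hEw
    have hliw := linearIndependent_left_of_det4_ne_zero hEw
    have hspan := hI.span_grad_eq hw hw0 h₁ h₂ hliw
    have hmem : ∀ g ∈ I, hess g w y ∈ Submodule.span ℂ {grad g₁ w, grad g₂ w} := by
      intro g hg
      rw [hspan, mem_nrm_iff]
      exact fun z hz => hcon g hg w hw hw0 y hy z hz
    obtain ⟨r₁, s₁, hr₁⟩ := Submodule.mem_span_pair.1 (hmem g₁ h₁)
    obtain ⟨r₂, s₂, hr₂⟩ := Submodule.mem_span_pair.1 (hmem g₂ h₂)
    simp only [grad_gdet_dotProduct, ← hr₁, ← hr₂, det4_comb_left, det4_comb_right, eval_gdet]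
    ring
  -- Coordinates taken against `grad g₁ v` vanish at `v`, and constant ratios make them vanish
  -- everywhere. So this covector lies in every general normal plane, and the curve in the plane it
  -- defines.
  have hmem : ∀ d, gdet g₁ g₂ (grad g₁ v) d ∈ I := by
    intro d
    have := hI.sub_C_mul_mem (hm (grad g₁ v) d) (hm c₀ d₀) hE (hprop _ _) hv hv0 hcd
    have h0 : eval v (gdet g₁ g₂ (grad g₁ v) d) = 0 := by
      rw [eval_gdet, det4_eq]
      ring
    simpa [h0] using this
  have hc0 : grad g₁ v ≠ 0 := hli.ne_zero 0
  refine (hI.isPrime.mul_notMem hE fun h => hc0 (hI.lin_mem_iff.1 h)) ?_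
  refine hI.mem_of_forall_ne_zero fun w hw hw0 => ?_
  rw [map_mul, eval_lin]
  by_cases hEw : eval w (gdet g₁ g₂ c₀ d₀) = 0
  · rw [hEw, zero_mul]
  · rw [eval_gdet] at hEw
    have hliw := linearIndependent_left_of_det4_ne_zero hEw
    have : grad g₁ v ∈ nrm I w := by
      rw [← hI.span_grad_eq hw hw0 h₁ h₂ hliw]
      refine mem_span_of_forall_det4_eq_zero hliw fun d => ?_
      rw [← eval_gdet]
      exact hI.eval_eq_zero (hmem d) hw
    rw [hI.dotProduct_self_of_mem_nrm hw this, mul_zero]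

/-- The chain rule for `F` composed with the gradient of `f`, which is an element of `I`. -/
lemma grad_dualIdeal_dotProduct_hess {F f : MvPolynomial (Fin 4) ℂ} (hF : F ∈ dualIdeal I Z)
    (hf : f ∈ I) {v y : Fin 4 → ℂ} (hy : y ∈ tang I v) :
    grad F (grad f v) ⬝ᵥ hess f v y = 0 := by
  have := hy _ (hI.mem_dualIdeal_iff.1 hF f hf)
  rwa [grad_aeval] at this

/-- A polynomial vector field together with an element of the ideal, with nonzero second
fundamental form. -/
lemma exists_hess_vectorField : ∃ f ∈ I, ∃ τ : Fin 4 → MvPolynomial (Fin 4) ℂ,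
    (∀ w ∈ Z, w ≠ 0 → vecEval τ w ∈ tang I w) ∧ ∑ i, τ i * vder τ (pderiv i f) ∉ I := by
  obtain ⟨f, hf, v, hv, hv0, y, hy, z, hz, hne⟩ := hI.exists_hess_ne_zero
  obtain ⟨τ, hτ, hli⟩ := hI.exists_vectorField hv hv0
  refine ⟨f, hf, τ, hτ, fun hmem => ?_⟩
  have h0 := hI.eval_eq_zero hmem hv
  have h1 : hess f v (vecEval τ v) ⬝ᵥ vecEval τ v = 0 := by
    rw [← h0, map_sum]
    refine Finset.sum_congr rfl fun i _ => ?_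
    rw [map_mul, eval_vder, mul_comm]
    rfl
  have hτv := hτ v hv hv0
  have hspan := hI.span_pair_eq_tang hv hτv hli
  rw [← hspan] at hy hz
  obtain ⟨r, s, rfl⟩ := Submodule.mem_span_pair.1 hy
  obtain ⟨r', s', rfl⟩ := Submodule.mem_span_pair.1 hz
  have hvv := hI.hess_dotProduct_self hf (hI.self_mem_tang hv)
  have hτv' := hI.hess_dotProduct_self hf hτv
  have hvτ := hess_dotProduct_comm f v v (vecEval τ v)
  rw [hτv'] at hvτ
  apply hne
  simp only [hess_add, hess_smul, add_dotProduct, smul_dotProduct, dotProduct_add, dotProduct_smul,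
    hvv, hτv', hvτ, h1, smul_zero, add_zero]

/-- The Gauss map of the dual surface recovers the point of the curve. -/
lemma grad_dualIdeal_mul {F f : MvPolynomial (Fin 4) ℂ} (hF : F ∈ dualIdeal I Z) (hf : f ∈ I)
    {v : Fin 4 → ℂ} (hv : v ∈ Z) (i j : Fin 4) :
    grad F (grad f v) i * v j = grad F (grad f v) j * v i := by
  obtain ⟨f₀, hf₀, τ, hτ, hκ⟩ := hI.exists_hess_vectorField
  -- The gradient of `F` lies in the span of `w` and the tangent vector and is killed by the Hessian
  -- covector, which kills `w` but not the tangent vector.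
  have hspecial : ∀ g ∈ I, ∀ w ∈ Z, w ≠ 0 → hess g w (vecEval τ w) ⬝ᵥ vecEval τ w ≠ 0 →
      grad F (grad g w) i * w j = grad F (grad g w) j * w i := by
    intro g hg w hw hw0 hne
    have hτw := hτ w hw hw0
    have hww := hI.hess_dotProduct_self hg hτw
    have hli : LinearIndependent ℂ ![w, vecEval τ w] := by
      rw [LinearIndependent.pair_iff]
      intro r s hrs
      have h1 := congrArg (hess g w (vecEval τ w) ⬝ᵥ ·) hrs
      simp only [dotProduct_add, dotProduct_smul, hww, smul_zero, zero_add, dotProduct_zero] at h1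
      have hs := (smul_eq_zero.1 h1).resolve_right hne
      rw [hs, zero_smul, add_zero] at hrs
      exact ⟨(smul_eq_zero.1 hrs).resolve_right hw0, hs⟩
    have hq := grad_dualIdeal_mem_tang hF hw hw0 (grad_mem_nrm hg w)
    have hq' := hI.grad_dualIdeal_dotProduct_hess hF hg hτw
    rw [← hI.span_pair_eq_tang hw hτw hli] at hq
    obtain ⟨r, s, hrs⟩ := Submodule.mem_span_pair.1 hq
    rw [← hrs, dotProduct_comm, dotProduct_add, dotProduct_smul, dotProduct_smul, hww, smul_zero,
      zero_add] at hq'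
    have hs := (smul_eq_zero.1 hq').resolve_right hne
    rw [← hrs, hs, zero_smul, add_zero]
    simp only [Pi.smul_apply, smul_eq_mul]
    ring
  -- Perturb `f` to `f + c f₀`: all but one value of `c` fall under the special case, and the claim
  -- is polynomial in `c`, so it holds at `c = 0`.
  have hgen : ∀ w ∈ Z, w ≠ 0 → eval w (∑ i, τ i * vder τ (pderiv i f₀)) ≠ 0 →
      grad F (grad f w) i * w j = grad F (grad f w) j * w i := by
    intro w hw hw0 hne
    rw [eval_sum_mul_vder] at hne
    set A := hess f w (vecEval τ w) ⬝ᵥ vecEval τ w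
    set B := hess f₀ w (vecEval τ w) ⬝ᵥ vecEval τ w
    set p := restrictToLine (C (w j) * pderiv i F - C (w i) * pderiv j F) (grad f w) (grad f₀ w)
    have hp : p * (Polynomial.C A + Polynomial.C B * Polynomial.X) = 0 := by
      refine Polynomial.funext fun c => ?_
      rw [Polynomial.eval_mul, Polynomial.eval_zero, eval_restrictToLine]
      by_cases h0 : A + B * c = 0
      · simp [h0]
      · have hmem : f + C c * f₀ ∈ I := I.add_mem hf (I.mul_mem_left _ hf₀)
        have := hspecial (f + C c * f₀) hmem w hw hw0 (by
          rw [hess_add_left, hess_C_mul, add_dotProduct, smul_dotProduct, smul_eq_mul]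
          rwa [mul_comm])
        rw [grad_add, grad_C_mul] at this
        simp only [grad] at this
        simp only [map_sub, map_mul, eval_C]
        rw [mul_comm (w j), mul_comm (w i), sub_eq_zero.2 this, zero_mul]
    have hp0 : p = 0 := by
      refine (mul_eq_zero.1 hp).resolve_right fun h => hne ?_
      have := congrArg (Polynomial.coeff · 1) h
      simpa using this
    have := eval_restrictToLine (C (w j) * pderiv i F - C (w i) * pderiv j F) (grad f w)
      (grad f₀ w) 0
    change Polynomial.eval 0 p = _ at this
    rw [hp0] at this
    simp only [Polynomial.eval_zero, zero_smul, add_zero, map_sub, map_mul, eval_C] at this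
    simp only [grad] at this ⊢
    linear_combination -this
  have hmem : (∑ i, τ i * vder τ (pderiv i f₀)) *
      (aeval (fun k => pderiv k f) (pderiv i F) * X j
        - aeval (fun k => pderiv k f) (pderiv j F) * X i) ∈ I := by
    refine hI.mem_of_forall_ne_zero fun w hw hw0 => ?_
    rw [map_mul]
    by_cases h : eval w (∑ i, τ i * vder τ (pderiv i f₀)) = 0
    · rw [h, zero_mul]
    · have := hgen w hw hw0 h
      simp only [map_sub, map_mul, eval_aeval, eval_X]
      exact mul_eq_zero_of_right _ (sub_eq_zero.2 this)
  have := hI.eval_eq_zero ((hI.isPrime.mem_or_mem hmem).resolve_left hκ) hv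
  simp only [map_sub, map_mul, eval_aeval, eval_X] at this
  exact sub_eq_zero.1 this

lemma exists_grad_dualIdeal_eq_smul {F : MvPolynomial (Fin 4) ℂ} (hF : F ∈ dualIdeal I Z)
    {v h : Fin 4 → ℂ} (hv : v ∈ Z) (hv0 : v ≠ 0) (hh : h ∈ nrm I v) :
    ∃ c : ℂ, grad F h = c • v := by
  obtain ⟨f, hf, rfl⟩ := hh
  obtain ⟨j, hj⟩ := Function.ne_iff.1 hv0
  refine ⟨grad F (grad f v) j / v j, funext fun i => ?_⟩
  have := hI.grad_dualIdeal_mul hF hf hv i j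
  rw [Pi.smul_apply, smul_eq_mul, div_mul_eq_mul_div, eq_div_iff hj, this]

/-- The tangent space of the dual cone at a smooth point. -/
lemma mem_tang_dualIdeal_iff {F : MvPolynomial (Fin 4) ℂ} (hF : F ∈ dualIdeal I Z)
    {v h y : Fin 4 → ℂ} (hv : v ∈ Z) (hv0 : v ≠ 0) (hh : h ∈ nrm I v) (hFh : grad F h ≠ 0) :
    y ∈ tang (dualIdeal I Z) h ↔ v ⬝ᵥ y = 0 := by
  constructor
  · intro hy
    obtain ⟨c, hc⟩ := hI.exists_grad_dualIdeal_eq_smul hF hv hv0 hh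
    have h1 := hy F hF
    rw [hc, smul_dotProduct] at h1
    refine (smul_eq_zero.1 h1).resolve_left ?_
    rintro rfl
    exact hFh (by rw [hc, zero_smul])
  · intro hy G hG
    obtain ⟨c, hc⟩ := hI.exists_grad_dualIdeal_eq_smul hG hv hv0 hh
    rw [hc, smul_dotProduct, hy, smul_zero]

end IsCurveCone

/-! ### Duality of lines in Plücker coordinates -/

/-- The linear form in the Plücker coordinates of the line through `u` and `w` whose value is
`det4 u w c d`. -/
def dualForm (c d : Fin 4 → ℂ) : MvPolynomial (PluckerIndex 3) ℂ :=
  C (c 2 * d 3 - c 3 * d 2) * X ⟨(0, 1), by decide⟩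
    - C (c 1 * d 3 - c 3 * d 1) * X ⟨(0, 2), by decide⟩
    + C (c 1 * d 2 - c 2 * d 1) * X ⟨(0, 3), by decide⟩
    + C (c 0 * d 3 - c 3 * d 0) * X ⟨(1, 2), by decide⟩
    - C (c 0 * d 2 - c 2 * d 0) * X ⟨(1, 3), by decide⟩
    + C (c 0 * d 1 - c 1 * d 0) * X ⟨(2, 3), by decide⟩

lemma eval_dualForm (u w c d : Fin 4 → ℂ) : eval (minors u w) (dualForm c d) = det4 u w c d := by
  simp only [dualForm, map_add, map_sub, map_mul, eval_C, eval_X, minors, det4_eq]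
  ring

lemma isHomogeneous_dualForm (c d : Fin 4 → ℂ) : (dualForm c d).IsHomogeneous 1 := by
  have h : ∀ (r : ℂ) (p : PluckerIndex 3), (C r * X p : MvPolynomial _ ℂ).IsHomogeneous 1 :=
    fun r p => isHomogeneous_C_mul_X r p
  exact (((((h _ _).sub (h _ _)).add (h _ _)).add (h _ _)).sub (h _ _)).add (h _ _)

/-- The Plücker coordinates of the dual line. -/
lemma exists_minors_dualLine {L : LineGr 3} {u w a b : Fin 4 → ℂ}
    (huw : Submodule.span ℂ {u, w} = L.1) (hab : Submodule.span ℂ {a, b} = (perp L).1) :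
    ∃ k : ℂ, k ≠ 0 ∧ minors a b
      = k • fun p => eval (minors u w) (dualForm (Pi.single p.1.1 1) (Pi.single p.1.2 1)) := by
  have hli := linearIndependent_of_finrank_span_pair (huw ▸ L.2)
  have hliab := linearIndependent_of_finrank_span_pair (hab ▸ (perp L).2)
  have hperp : ∀ z ∈ (perp L).1, z ⬝ᵥ u = 0 ∧ z ⬝ᵥ w = 0 := by
    intro z hz
    have := (mem_dualLine L z).1 hz
    exact ⟨this u (huw ▸ Submodule.subset_span (by simp)),
      this w (huw ▸ Submodule.subset_span (by simp))⟩
  obtain ⟨hau, haw⟩ := hperp a (hab ▸ Submodule.subset_span (by simp))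
  obtain ⟨hbu, hbw⟩ := hperp b (hab ▸ Submodule.subset_span (by simp))
  obtain ⟨c, d, hcd⟩ := exists_det4_ne_zero_of_pair hli
  have hbasis := linearIndependent_of_det4_ne_zero hcd
  have hspan : ∀ z, ∃ r s t q : ℂ, z = r • u + s • w + t • c + q • d := by
    intro z
    have h1 := hbasis.span_eq_top_of_card_eq_finrank (by simp)
    have h2 : z ∈ Submodule.span ℂ (Set.range ![u, w, c, d]) := by rw [h1]; trivial
    obtain ⟨r, hr⟩ := (Submodule.mem_span_range_iff_exists_fun ℂ).1 h2
    refine ⟨r 0, r 1, r 2, r 3, ?_⟩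
    rw [← hr]
    simp [Fin.sum_univ_four]
  set r := (a ⬝ᵥ c) * (b ⬝ᵥ d) - (a ⬝ᵥ d) * (b ⬝ᵥ c) with hr
  -- Both sides are alternating forms in `x` and `y` on the two-dimensional quotient by the line,
  -- hence proportional; `r` fixes the factor on `c` and `d`.
  have hprop : ∀ x y, det4 u w c d * ((a ⬝ᵥ x) * (b ⬝ᵥ y) - (a ⬝ᵥ y) * (b ⬝ᵥ x))
      = r * det4 u w x y := by
    intro x y
    obtain ⟨x₁, x₂, x₃, x₄, rfl⟩ := hspan x
    obtain ⟨y₁, y₂, y₃, y₄, rfl⟩ := hspan y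
    have h2 : det4 u w (x₁ • u + x₂ • w + x₃ • c + x₄ • d) (y₁ • u + y₂ • w + y₃ • c + y₄ • d)
        = (x₃ * y₄ - x₄ * y₃) * det4 u w c d := by
      simp only [det4_eq, Pi.add_apply, Pi.smul_apply, smul_eq_mul]
      ring
    rw [h2]
    simp only [dotProduct_add, dotProduct_smul, hau, haw, hbu, hbw, zero_add, hr,
      smul_eq_mul, mul_zero]
    ring
  have hmin : minors a b = (r / det4 u w c d) •
      fun p => eval (minors u w) (dualForm (Pi.single p.1.1 1) (Pi.single p.1.2 1)) := by
    funext p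
    have := hprop (Pi.single p.1.1 1) (Pi.single p.1.2 1)
    simp only [dotProduct_single, mul_one] at this
    rw [Pi.smul_apply, eval_dualForm, smul_eq_mul, div_mul_eq_mul_div, eq_div_iff hcd, ← this]
    simp only [minors]
    ring
  refine ⟨_, ?_, hmin⟩
  intro h0
  rw [h0, zero_smul] at hmin
  exact minors_ne_zero hliab hmin

lemma perp_perp (L : LineGr 3) : perp (perp L) = L := perp.left_inv L

/-- Duality is linear in Plücker coordinates up to a nonzero factor, so forms pull back to forms of
the same degree. -/
lemma continuous_perp : Continuous perp := by
  refine continuous_generateFrom_iff.2 ?_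
  rintro _ ⟨d, F, hF, rfl⟩
  refine (isTopologicalBasis_line 3).isOpen ⟨d, aeval (fun p : PluckerIndex 3 =>
    dualForm (Pi.single p.1.1 1) (Pi.single p.1.2 1)) F, ?_, ?_⟩
  · have := hF.aeval (fun p : PluckerIndex 3 =>
      dualForm (Pi.single p.1.1 1) (Pi.single p.1.2 1)) (fun p => isHomogeneous_dualForm _ _)
    rwa [one_mul] at this
  · ext L
    obtain ⟨u, w, -, -, -, huw⟩ := exists_basis_pair L.2
    obtain ⟨a, b, -, -, -, hab⟩ := exists_basis_pair (perp L).2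
    have hG : (aeval (fun p : PluckerIndex 3 =>
      dualForm (Pi.single p.1.1 1) (Pi.single p.1.2 1)) F).IsHomogeneous d := by
      have := hF.aeval (fun p : PluckerIndex 3 =>
        dualForm (Pi.single p.1.1 1) (Pi.single p.1.2 1)) (fun p => isHomogeneous_dualForm _ _)
      rwa [one_mul] at this
    obtain ⟨k, hk, hkm⟩ := exists_minors_dualLine huw hab
    simp only [Set.mem_preimage, Set.mem_ofPred_eq]
    rw [vanishesAtLine_iff hF hab, vanishesAtLine_iff hG huw, eval_aeval, hkm,
      eval_smul_of_isHomogeneous hF, mul_eq_zero]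
    simp [hk]

/-- Duality of lines as a homeomorphism. -/
def perpHomeomorph : LineGr 3 ≃ₜ LineGr 3 where
  toEquiv := perp
  continuous_toFun := continuous_perp
  continuous_invFun := continuous_perp

lemma perp_image_closure (X : Set (LineGr 3)) : perp '' closure X = closure (perp '' X) :=
  perpHomeomorph.image_closure X

lemma mem_perp_image {X : Set (LineGr 3)} {L : LineGr 3} : L ∈ perp '' X ↔ perp L ∈ X :=
  ⟨by rintro ⟨M, hM, rfl⟩; rwa [perp_perp], fun h => ⟨_, h, perp_perp L⟩⟩

/-! ### The curve, its tangent lines and its dual surface -/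

section curve

variable {C : Set (ProjSpace 3)}

lemma isCurveCone (hC : IsIrreducibleCurve C) (hsmooth : ∀ x ∈ C, IsSmoothPoint C x)
    (hnd : IsNondegenerate C) : IsCurveCone (coneIdeal C) (cone C) where
  mem_iff f := mem_coneIdeal
  smul_mem v hv c := smul_mem_cone hv c
  isPrime := coneIdeal_isPrime hC.isIrreducible
  mem_of_forall v hv := by
    by_cases hv0 : v = 0
    · obtain ⟨x, hx⟩ := hC.isIrreducible.nonempty
      exact ⟨x, hx, 0, by simp [hv0]⟩
    · rw [mem_cone_iff hv0]
      refine mem_of_isClosed hC.isClosed fun f hf => ?_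
      obtain ⟨d, hd⟩ := hf.1
      exact (vanishesAt_mk hd hv0).2 (hv f (homogeneousVanishing_subset_coneIdeal hf))
  finrank_tang v hv hv0 := by
    have h := (hsmooth _ ((mem_cone_iff hv0).1 hv)).2
    rw [embeddedTangent_eq_tang, hC.dim_eq_one] at h
    have h2 : ((Module.finrank ℂ (tang (coneIdeal C) v) : ℕ) : WithBot ℕ∞) = ((2 : ℕ) : _) := by
      rw [h]; rfl
    exact_mod_cast h2
  nondegenerate a ha := by
    obtain ⟨x, hx, h⟩ := hnd a ha
    exact ⟨x.rep, rep_mem_cone hx, h⟩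
  finite_zeros f := by
    rintro ⟨d, hd⟩ hf
    have hY : (C ∩ {x | VanishesAt f x}).Finite := by
      refine hC.finite_of_ssubset (hC.isClosed.inter (isClosed_setOf_vanishesAt hd))
        ⟨Set.inter_subset_left, fun h => hf ?_⟩
      refine homogeneousVanishing_subset_coneIdeal ⟨⟨d, hd⟩, fun x hx => (h hx).2⟩
    refine ⟨_, hY.image Projectivization.rep, fun v hv hv0 h0 => ?_⟩
    refine ⟨_, ⟨Projectivization.mk ℂ v hv0, ⟨(mem_cone_iff hv0).1 hv,
      (vanishesAt_mk hd hv0).2 h0⟩, rfl⟩, ?_⟩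
    obtain ⟨a, ha⟩ := Projectivization.exists_smul_eq_mk_rep ℂ v hv0
    refine ⟨(a⁻¹ : ℂˣ), Units.ne_zero _, ?_⟩
    rw [← ha]
    change v = a⁻¹ • a • v
    rw [inv_smul_smul]

lemma mem_tangentLines_iff {L : LineGr 3} :
    L ∈ tangentLines C ↔ ∃ v ∈ cone C, v ≠ 0 ∧ L.1 = tang (coneIdeal C) v := by
  constructor
  · rintro ⟨x, hx, h⟩
    refine ⟨x.rep, rep_mem_cone hx, x.rep_nonzero, ?_⟩
    rw [h, ← embeddedTangent_eq_tang x.rep_nonzero, Projectivization.mk_rep]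
  · rintro ⟨v, hv, hv0, h⟩
    exact ⟨_, (mem_cone_iff hv0).1 hv, by rw [h, embeddedTangent_eq_tang]⟩

lemma mem_perp_tangentLines_iff {L : LineGr 3} :
    L ∈ perp '' tangentLines C ↔ ∃ v ∈ cone C, v ≠ 0 ∧ L.1 = nrm (coneIdeal C) v := by
  rw [mem_perp_image, mem_tangentLines_iff]
  refine exists_congr fun v => and_congr_right fun _ => and_congr_right fun _ => ?_
  constructor
  · intro h
    rw [← perp_perp L, ← orthogonal_tang, ← h]
    rfl
  · intro h
    rw [← orthogonal_nrm, ← h]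
    rfl

/-- The antisymmetric matrix with given entries above the diagonal. -/
def skew {A : Type*} [Ring A] (p : PluckerIndex 3 → A) (i j : Fin 4) : A :=
  if h : i < j then p ⟨(i, j), h⟩ else if h : j < i then -p ⟨(j, i), h⟩ else 0

lemma skew_minors (u w : Fin 4 → ℂ) (i j : Fin 4) :
    skew (minors u w) i j = u i * w j - u j * w i := by
  unfold skew
  split_ifs with h1 h2
  · rfl
  · simp [minors]
  · have : i = j := le_antisymm (not_lt.1 h2) (not_lt.1 h1)
    subst this
    ring

lemma map_skew {A B : Type*} [Ring A] [Ring B] (φ : A →+* B) (p : PluckerIndex 3 → A)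
    (i j : Fin 4) : φ (skew p i j) = skew (fun q => φ (p q)) i j := by
  unfold skew
  split_ifs <;> simp

lemma skew_smul (c : ℂ) (p : PluckerIndex 3 → ℂ) (i j : Fin 4) :
    skew (c • p) i j = c * skew p i j := by
  unfold skew
  split_ifs <;> simp

/-- Elimination of the point of tangency. The skew matrix of a line applied to a gradient vanishes
exactly when the gradient kills the line, so tangency is linear in the Plücker coordinates. -/
lemma isClosed_tangentLines (hC : IsCurveCone (coneIdeal C) (cone C)) :
    IsClosed (tangentLines C) := by
  let A := {f : MvPolynomial (Fin 4) ℂ // f ∈ coneIdeal C ∧ ∃ d, f.IsHomogeneous d}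
  let s : A ⊕ (A × Fin 4) → MvPolynomial (Fin 4) (MvPolynomial (PluckerIndex 3) ℂ) :=
    Sum.elim (fun f => map MvPolynomial.C f.1) fun p =>
      ∑ j, MvPolynomial.C (skew X p.2 j) * map MvPolynomial.C (pderiv j p.1.1)
  have hCy : ∀ y : PluckerIndex 3 → ℂ,
      (eval y).comp (MvPolynomial.C : ℂ →+* MvPolynomial (PluckerIndex 3) ℂ) = RingHom.id ℂ := by
    intro y; ext; simp
  have h1 : ∀ y (f : A) x, eval x (map (eval y) (s (Sum.inl f))) = eval x f.1 := by
    intro y f x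
    simp [s, map_map, hCy]
  have h2 : ∀ y (p : A × Fin 4) x, eval x (map (eval y) (s (Sum.inr p)))
      = ∑ j, skew y p.2 j * grad p.1.1 x j := by
    intro y p x
    simp [s, map_map, hCy, grad, map_skew]
  have hhom : ∀ i, ∃ d, (s i).IsHomogeneous d := by
    rintro (f | p)
    · obtain ⟨d, hd⟩ := f.2.2
      exact ⟨d, hd.map _⟩
    · obtain ⟨d, hd⟩ := p.1.2.2
      refine ⟨0 + (d - 1), IsHomogeneous.sum _ _ _ fun j _ =>
        (isHomogeneous_C _ _).mul ((isHomogeneous_pderiv hd j).map _)⟩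
  have hcone : ∀ z ∈ solvable s, ∀ c : ℂ, c ≠ 0 → c • z ∈ solvable s := by
    rintro z ⟨x, hx0, hx⟩ c -
    refine ⟨x, hx0, ?_⟩
    rintro (f | p)
    · have := hx (Sum.inl f)
      rw [h1] at this ⊢
      exact this
    · have := hx (Sum.inr p)
      rw [h2] at this ⊢
      simp only [skew_smul, mul_assoc, ← Finset.mul_sum, this, mul_zero]
  have hrow : ∀ (u w q : Fin 4 → ℂ) (i : Fin 4), ∑ j, skew (minors u w) i j * q j
      = u i * (q ⬝ᵥ w) - w i * (q ⬝ᵥ u) := by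
    intro u w q i
    simp only [skew_minors, dotProduct, Finset.mul_sum, ← Finset.sum_sub_distrib]
    exact Finset.sum_congr rfl fun j _ => by ring
  have hsolv : ∀ (L : LineGr 3) (u w : Fin 4 → ℂ), Submodule.span ℂ {u, w} = L.1 →
      (minors u w ∈ solvable s ↔ L ∈ tangentLines C) := by
    intro L u w huw
    have hli := linearIndependent_of_finrank_span_pair (huw ▸ L.2)
    rw [mem_tangentLines_iff]
    constructor
    · rintro ⟨x, hx0, hx⟩
      have hxZ : x ∈ cone C := by
        refine hC.mem_of_forall x fun f hf => ?_
        rw [← sum_homogeneousComponent f, map_sum]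
        refine Finset.sum_eq_zero fun d _ => ?_
        have := hx (Sum.inl ⟨homogeneousComponent d f, hC.homogeneousComponent_mem hf d,
          d, homogeneousComponent_isHomogeneous d f⟩)
        rwa [h1] at this
      have horth : ∀ f : A, grad f.1 x ⬝ᵥ w = 0 ∧ grad f.1 x ⬝ᵥ u = 0 := by
        intro f
        have h3 : (grad f.1 x ⬝ᵥ w) • u + (-(grad f.1 x ⬝ᵥ u)) • w = 0 := by
          ext i
          have := hx (Sum.inr ⟨f, i⟩)
          rw [h2, hrow] at this
          simp only [Pi.add_apply, Pi.smul_apply, smul_eq_mul, Pi.zero_apply]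
          linear_combination this
        obtain ⟨h4, h5⟩ := LinearIndependent.pair_iff.1 hli _ _ h3
        exact ⟨h4, neg_eq_zero.1 h5⟩
      obtain ⟨g₁, hg₁, g₂, hg₂, hh₁, hh₂, hlig⟩ := hC.exists_pair hxZ hx0
      obtain ⟨hw₁, hu₁⟩ := horth ⟨g₁, hg₁, hh₁⟩
      obtain ⟨hw₂, hu₂⟩ := horth ⟨g₂, hg₂, hh₂⟩
      refine ⟨x, hxZ, hx0, ?_⟩
      rw [← huw]
      exact span_pair_eq_of_mem hli (hC.finrank_tang x hxZ hx0)
        (hC.mem_tang_of_pair hxZ hx0 hg₁ hg₂ hlig hu₁ hu₂)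
        (hC.mem_tang_of_pair hxZ hx0 hg₁ hg₂ hlig hw₁ hw₂)
    · rintro ⟨x, hxZ, hx0, hL⟩
      rw [← huw] at hL
      have hu : u ∈ tang (coneIdeal C) x := hL ▸ Submodule.subset_span (by simp)
      have hw : w ∈ tang (coneIdeal C) x := hL ▸ Submodule.subset_span (by simp)
      refine ⟨x, hx0, ?_⟩
      rintro (f | p)
      · rw [h1]
        exact hC.eval_eq_zero f.2.1 hxZ
      · rw [h2, hrow, hu _ p.1.2.1, hw _ p.1.2.1]
        ring
  rw [← closure_subset_iff_isClosed]
  intro L hL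
  by_contra hnot
  obtain ⟨u, w, -, -, -, huw⟩ := exists_basis_pair L.2
  obtain ⟨G, ⟨d, hd⟩, hG, hG0⟩ := exists_isHomogeneous_of_notMem_solvable hhom hcone
    (mt (hsolv L u w huw).1 hnot)
  refine hG ((vanishesAtLine_iff hd huw).1 (mem_closure_iff_vanishesAtLine.1 hL G d hd
    fun M hM u' w' h' => hG0 _ ((hsolv M u' w' h').2 hM)))

lemma isClosed_perp_tangentLines (hC : IsCurveCone (coneIdeal C) (cone C)) :
    IsClosed (perp '' tangentLines C) := by
  rw [← closure_eq_iff_isClosed, ← perp_image_closure, (isClosed_tangentLines hC).closure_eq]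

lemma rep_mem_dualCone_iff {h : Fin 4 → ℂ} (hh : h ≠ 0)
    {I : Ideal (MvPolynomial (Fin 4) ℂ)} {Z : Set (Fin 4 → ℂ)} :
    (Projectivization.mk ℂ h hh).rep ∈ dualCone I Z ↔ h ∈ dualCone I Z := by
  obtain ⟨a, ha⟩ := Projectivization.exists_smul_eq_mk_rep ℂ h hh
  rw [← ha]
  change (a : ℂ) • h ∈ _ ↔ _
  refine ⟨fun h1 => ?_, fun h1 => smul_mem_dualCone h1 _⟩
  have := smul_mem_dualCone h1 (a : ℂ)⁻¹
  rwa [smul_smul, inv_mul_cancel₀ a.ne_zero, one_smul] at this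

/-- The closure adds nothing, because the dual cone is cut out by forms. -/
lemma dualVariety_eq (hC : IsCurveCone (coneIdeal C) (cone C))
    (hsmooth : ∀ x ∈ C, IsSmoothPoint C x) :
    dualVariety C = {h | h.rep ∈ dualCone (coneIdeal C) (cone C)} := by
  have hset : {h : ProjSpace 3 | ∃ x, IsSmoothPoint C x ∧ ∀ y ∈ embeddedTangent C x,
      h.rep ⬝ᵥ y = 0} = {h | h.rep ∈ dualCone (coneIdeal C) (cone C)} := by
    ext h
    constructor
    · rintro ⟨x, hx, hy⟩
      refine ⟨x.rep, rep_mem_cone hx.1, x.rep_nonzero, mem_nrm_iff.2 ?_⟩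
      rwa [← embeddedTangent_eq_tang x.rep_nonzero, Projectivization.mk_rep]
    · rintro ⟨v, hv, hv0, hh⟩
      refine ⟨_, hsmooth _ ((mem_cone_iff hv0).1 hv), ?_⟩
      rw [embeddedTangent_eq_tang]
      exact mem_nrm_iff.1 hh
  rw [dualVariety]
  change closure {h : ProjSpace 3 | ∃ x, IsSmoothPoint C x ∧ ∀ y ∈ embeddedTangent C x,
      h.rep ⬝ᵥ y = 0} = _
  rw [hset]
  refine Set.Subset.antisymm (fun h hh => ?_) subset_closure
  by_contra hnot
  obtain ⟨G, hG, hd, hGh⟩ := hC.exists_isHomogeneous_of_notMem_dualCone hnot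
  exact hGh (mem_closure_iff_vanishesAt.1 hh G ⟨hd, fun x hx => mem_dualIdeal.1 hG _ hx⟩)

lemma mk_mem_dualVariety (hC : IsCurveCone (coneIdeal C) (cone C))
    (hsmooth : ∀ x ∈ C, IsSmoothPoint C x) {h : Fin 4 → ℂ} (hh : h ≠ 0) :
    Projectivization.mk ℂ h hh ∈ dualVariety C ↔ h ∈ dualCone (coneIdeal C) (cone C) := by
  rw [dualVariety_eq hC hsmooth]
  exact rep_mem_dualCone_iff hh

lemma isClosed_dualVariety : IsClosed (dualVariety C) := isClosed_closure

lemma IsCurveCone.exists_mem_nrm_ne_zero {I : Ideal (MvPolynomial (Fin 4) ℂ)}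
    {Z : Set (Fin 4 → ℂ)} (hI : IsCurveCone I Z) {v : Fin 4 → ℂ} (hv : v ∈ Z) (hv0 : v ≠ 0) :
    ∃ h ∈ nrm I v, h ≠ 0 := by
  refine (Submodule.ne_bot_iff _).1 fun h => ?_
  have := hI.finrank_nrm hv hv0
  rw [h, finrank_bot] at this
  omega

lemma nonempty_dualVariety (hC : IsCurveCone (coneIdeal C) (cone C))
    (hsmooth : ∀ x ∈ C, IsSmoothPoint C x) : (dualVariety C).Nonempty := by
  obtain ⟨v, hv, hv0⟩ := hC.exists_mem_ne_zero
  obtain ⟨h, hh, hh0⟩ := hC.exists_mem_nrm_ne_zero hv hv0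
  exact ⟨_, (mk_mem_dualVariety hC hsmooth hh0).2 ⟨v, hv, hv0, hh⟩⟩

lemma cone_dualVariety (hC : IsCurveCone (coneIdeal C) (cone C))
    (hsmooth : ∀ x ∈ C, IsSmoothPoint C x) :
    cone (dualVariety C) = dualCone (coneIdeal C) (cone C) := by
  ext h
  by_cases hh : h = 0
  · obtain ⟨x, hx⟩ := nonempty_dualVariety hC hsmooth
    subst hh
    exact ⟨fun _ => hC.zero_mem_dualCone, fun _ => ⟨x, hx, 0, by simp⟩⟩
  · rw [mem_cone_iff hh, mk_mem_dualVariety hC hsmooth hh]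

lemma coneIdeal_dualVariety (hC : IsCurveCone (coneIdeal C) (cone C))
    (hsmooth : ∀ x ∈ C, IsSmoothPoint C x) :
    coneIdeal (dualVariety C) = dualIdeal (coneIdeal C) (cone C) := by
  rw [coneIdeal, cone_dualVariety hC hsmooth, dualIdeal]

lemma isIrreducible_dualVariety (hC : IsCurveCone (coneIdeal C) (cone C))
    (hsmooth : ∀ x ∈ C, IsSmoothPoint C x) : IsIrreducible (dualVariety C) := by
  refine isIrreducible_of_coneIdeal (nonempty_dualVariety hC hsmooth) fun f g h => ?_
  rw [coneIdeal_dualVariety hC hsmooth] at h ⊢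
  exact hC.dualIdeal_isPrime.mem_or_mem h

/-- The upper bound is that of a proper closed set. For the lower one, take a point on a ruling; the
ruling is not the whole surface, since otherwise all normal planes would agree and `C` would be
degenerate. -/
lemma topologicalKrullDim_dualVariety (hC : IsCurveCone (coneIdeal C) (cone C))
    (hsmooth : ∀ x ∈ C, IsSmoothPoint C x) : topologicalKrullDim (dualVariety C) = 2 := by
  apply le_antisymm
  · refine topologicalKrullDim_le_of_isClosed isClosed_dualVariety fun h => ?_
    obtain ⟨a, ha⟩ := hC.exists_notMem_dualCone
    have ha0 : a ≠ 0 := fun h0 => ha (h0 ▸ hC.zero_mem_dualCone)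
    exact ha ((mk_mem_dualVariety hC hsmooth ha0).1 (h ▸ Set.mem_univ _))
  · obtain ⟨v, hv, hv0⟩ := hC.exists_mem_ne_zero
    obtain ⟨a, b, hab, ha, hb, -⟩ := exists_basis_pair (hC.finrank_nrm hv hv0)
    have ha0 : a ≠ 0 := hab.ne_zero 0
    have hb0 : b ≠ 0 := hab.ne_zero 1
    have hne : nrm (coneIdeal C) v ≠ ⊥ := (Submodule.ne_bot_iff _).2 ⟨a, ha, ha0⟩
    refine two_le_topologicalKrullDim (A := {Projectivization.mk ℂ a ha0})
      (B := subspaceSet (nrm (coneIdeal C) v)) isIrreducible_singleton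
      (isIrreducible_subspaceSet hne) (isIrreducible_dualVariety hC hsmooth) isClosed_singleton
      (isClosed_subspaceSet _) ⟨?_, fun h => ?_⟩ ⟨?_, fun h => ?_⟩
    · rw [Set.singleton_subset_iff]
      exact (mk_mem_subspaceSet ha0).2 ha
    · have := h ((mk_mem_subspaceSet hb0).2 hb)
      rw [Set.mem_singleton_iff, Projectivization.mk_eq_mk_iff'] at this
      obtain ⟨c, hc⟩ := this
      have := LinearIndependent.pair_iff.1 hab c (-1) (by rw [hc]; simp)
      simp at this
    · intro x hx
      rw [dualVariety_eq hC hsmooth]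
      exact ⟨v, hv, hv0, hx⟩
    · obtain ⟨w, hw, haw⟩ := hC.nondegenerate a ha0
      have hw0 : w ≠ 0 := by rintro rfl; simp at haw
      have hle : nrm (coneIdeal C) w ≤ nrm (coneIdeal C) v := by
        intro z hz
        by_cases hz0 : z = 0
        · rw [hz0]; exact Submodule.zero_mem _
        · exact (mk_mem_subspaceSet hz0).1
            (h ((mk_mem_dualVariety hC hsmooth hz0).2 ⟨w, hw, hw0, hz⟩))
      have heq := Submodule.eq_of_le_of_finrank_eq hle
        (by rw [hC.finrank_nrm hw hw0, hC.finrank_nrm hv hv0])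
      exact haw (hC.dotProduct_self_of_mem_nrm hw (heq ▸ ha))

lemma mem_embeddedTangent_dualVariety (hC : IsCurveCone (coneIdeal C) (cone C))
    (hsmooth : ∀ x ∈ C, IsSmoothPoint C x) {F : MvPolynomial (Fin 4) ℂ}
    (hF : F ∈ dualIdeal (coneIdeal C) (cone C)) {v h : Fin 4 → ℂ} (hv : v ∈ cone C)
    (hv0 : v ≠ 0) (hh : h ∈ nrm (coneIdeal C) v) (hFh : grad F h ≠ 0) (hh0 : h ≠ 0)
    {y : Fin 4 → ℂ} : y ∈ embeddedTangent (dualVariety C) (Projectivization.mk ℂ h hh0) ↔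
      v ⬝ᵥ y = 0 := by
  rw [embeddedTangent_eq_tang, coneIdeal_dualVariety hC hsmooth,
    hC.mem_tang_dualIdeal_iff hF hv hv0 hh hFh]

/-- By biduality all differentials at `h` are multiples of one `v`: the tangent space is the
hyperplane dual to `v` if some differential is nonzero, and all of `ℂ⁴` otherwise. -/
lemma isSmoothPoint_dualVariety_iff (hC : IsCurveCone (coneIdeal C) (cone C))
    (hsmooth : ∀ x ∈ C, IsSmoothPoint C x) {h : Fin 4 → ℂ} (hh : h ≠ 0) :
    IsSmoothPoint (dualVariety C) (Projectivization.mk ℂ h hh) ↔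
      h ∈ dualCone (coneIdeal C) (cone C) ∧
        ∃ F ∈ dualIdeal (coneIdeal C) (cone C), grad F h ≠ 0 := by
  rw [IsSmoothPoint, mk_mem_dualVariety hC hsmooth hh, topologicalKrullDim_dualVariety hC hsmooth,
    embeddedTangent_eq_tang, coneIdeal_dualVariety hC hsmooth]
  refine and_congr_right fun hmem => ?_
  constructor
  · intro h3
    by_contra! hcon
    have htop : tang (dualIdeal (coneIdeal C) (cone C)) h = ⊤ := by
      rw [Submodule.eq_top_iff']
      intro y F hF
      rw [hcon F hF, zero_dotProduct]
    rw [htop, finrank_top] at h3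
    have h4 : ((Module.finrank ℂ (Fin 4 → ℂ) : ℕ) : WithBot ℕ∞) = ((3 : ℕ) : _) := by
      rw [h3]; rfl
    have : Module.finrank ℂ (Fin 4 → ℂ) = 3 := by exact_mod_cast h4
    simp at this
  · rintro ⟨F, hF, hFh⟩
    obtain ⟨v, hv, hv0, hhv⟩ := hmem
    have heq : tang (dualIdeal (coneIdeal C) (cone C)) h
        = stdForm.orthogonal (Submodule.span ℂ {v}) := by
      ext y
      rw [hC.mem_tang_dualIdeal_iff hF hv hv0 hhv hFh, LinearMap.BilinForm.mem_orthogonal_iff]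
      constructor
      · intro hy z hz
        obtain ⟨c, rfl⟩ := Submodule.mem_span_singleton.1 hz
        change (c • v) ⬝ᵥ y = 0
        rw [smul_dotProduct, hy, smul_zero]
      · intro hy
        exact hy v (Submodule.mem_span_singleton_self v)
    rw [heq, LinearMap.BilinForm.finrank_orthogonal stdForm_nondegenerate,
      finrank_span_singleton hv0]
    simp
    norm_num

end curve

/-! ### Asymptotic directions and inflectional lines -/

lemma grad_lin_mul {m : ℕ} (u : Fin m → ℂ) (k : MvPolynomial (Fin m) ℂ) {v : Fin m → ℂ}
    (huv : u ⬝ᵥ v = 0) (hk : eval v k = 0) : grad (lin u * k) v = 0 := by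
  rw [grad_mul, eval_lin, huv, hk, zero_smul, zero_smul, add_zero]

/-- With `grad_lin_mul`, this lets the Hessian of an element of `I` be shifted by any normal
covector without changing its gradient at `v`. -/
lemma hess_lin_mul {m : ℕ} (u : Fin m → ℂ) (k : MvPolynomial (Fin m) ℂ) {v y : Fin m → ℂ}
    (huv : u ⬝ᵥ v = 0) (hk : grad k v ⬝ᵥ y = 0) :
    hess (lin u * k) v y = (u ⬝ᵥ y) • grad k v := by
  ext i
  have h1 : pderiv i (lin u * k) = lin u * pderiv i k + k * C (u i) := by
    rw [Derivation.leibniz, pderiv_lin, smul_eq_mul, smul_eq_mul]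
  rw [hess, h1, grad_add, grad_mul, grad_mul, grad_lin, grad_C, eval_lin, huv, eval_C]
  simp only [zero_smul, zero_add, smul_zero, add_dotProduct, smul_dotProduct, hk, add_zero,
    smul_eq_mul, mul_zero, Pi.smul_apply]
  rw [mul_comm]
  rfl

lemma eval_derivative_derivative_restrictToLine {n : ℕ} (f : MvPolynomial (Fin (n + 1)) ℂ)
    (x v : Fin (n + 1) → ℂ) : (Polynomial.derivative (Polynomial.derivative
      (restrictToLine f x v))).eval 0 = hess f x v ⬝ᵥ v := by
  rw [derivative_restrictToLine, Polynomial.derivative_sum, Polynomial.eval_finsetSum]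
  refine Finset.sum_congr rfl fun i _ => ?_
  rw [Polynomial.derivative_mul, Polynomial.derivative_C, mul_zero, add_zero, Polynomial.eval_mul,
    eval_derivative_restrictToLine, Polynomial.eval_C, zero_smul, add_zero]
  rfl

namespace IsCurveCone

variable {I : Ideal (MvPolynomial (Fin 4) ℂ)} {Z : Set (Fin 4 → ℂ)} (hI : IsCurveCone I Z)
include hI

/-- The differential of the Gauss map of the dual surface. -/
lemma exists_hess_dualIdeal_eq {F g : MvPolynomial (Fin 4) ℂ} (hF : F ∈ dualIdeal I Z)
    (hg : g ∈ I) {v t : Fin 4 → ℂ} (hv0 : v ≠ 0) (ht : t ∈ tang I v) {c : ℂ}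
    (hc : grad F (grad g v) = c • v) :
    ∃ r : ℂ, hess F (grad g v) (hess g v t) = c • t + r • v := by
  set H := hess F (grad g v) (hess g v t) with hH
  have hX : ∀ i, grad (X i : MvPolynomial (Fin 4) ℂ) v = Pi.single i 1 := by
    intro i
    ext j
    simp only [grad, pderiv_X, Pi.single_apply]
    split_ifs <;> simp_all
  -- Biduality holds along the whole curve, so it may be differentiated in the direction `t`.
  have hij : ∀ i j, (H i - c * t i) * v j = (H j - c * t j) * v i := by
    intro i j
    have hmem : aeval (fun k => pderiv k g) (pderiv i F) * X j
        + C (-1) * (aeval (fun k => pderiv k g) (pderiv j F) * X i) ∈ I := by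
      rw [hI.mem_iff]
      intro w hw
      have := hI.grad_dualIdeal_mul hF hg hw i j
      simp only [map_add, map_mul, eval_aeval, eval_X, eval_C]
      have hFi : ∀ i, grad F (grad g w) i = eval (fun k => eval w (pderiv k g)) (pderiv i F) :=
        fun _ => rfl
      rw [hFi, hFi] at this
      linear_combination this
    have h1 := ht _ hmem
    have hgi : ∀ i, eval (fun k => eval v (pderiv k g)) (pderiv i F) = c * v i :=
      fun i => congrFun hc i
    have hHi : ∀ i, grad (pderiv i F) (fun k => eval v (pderiv k g)) ⬝ᵥ
        (fun k => grad (pderiv k g) v ⬝ᵥ t) = H i := fun i => rfl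
    simp only [grad_add, grad_C, grad_mul, zero_dotProduct, eval_C, smul_zero, add_dotProduct, smul_dotProduct, grad_aeval,
      eval_aeval, hX, hgi, hHi, single_one_dotProduct, eval_X, smul_eq_mul] at h1
    linear_combination h1
  obtain ⟨j, hj⟩ := Function.ne_iff.1 hv0
  refine ⟨(H j - c * t j) / v j, funext fun i => ?_⟩
  have := hij i j
  rw [Pi.add_apply, Pi.smul_apply, Pi.smul_apply, smul_eq_mul, smul_eq_mul, div_mul_eq_mul_div,
    ← this, mul_div_assoc, div_self hj]
  ring

/-- The asymptotic directions of the dual surface at a smooth point are those of its ruling. -/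
lemma mem_nrm_of_hess_eq_zero {F : MvPolynomial (Fin 4) ℂ} (hF : F ∈ dualIdeal I Z)
    {v h w : Fin 4 → ℂ} (hv : v ∈ Z) (hv0 : v ≠ 0) (hh : h ∈ nrm I v) (hFh : grad F h ≠ 0)
    (h₁ : grad F h ⬝ᵥ w = 0) (h₂ : hess F h w ⬝ᵥ w = 0) : w ∈ nrm I v := by
  obtain ⟨c, hc⟩ := hI.exists_grad_dualIdeal_eq_smul hF hv hv0 hh
  obtain ⟨f, hf, rfl⟩ := hh
  have hc0 : c ≠ 0 := by
    rintro rfl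
    exact hFh (by rw [hc, zero_smul])
  obtain ⟨τ, hτ, hli⟩ := hI.exists_vectorField hv hv0
  have ht := hτ v hv hv0
  set t := vecEval τ v
  obtain ⟨u, huv, hut⟩ := exists_dotProduct_ne_zero hli
  have hvw : v ⬝ᵥ w = 0 := by
    rw [hc, smul_dotProduct] at h₁
    exact (smul_eq_zero.1 h₁).resolve_left hc0
  set a := hess f v t with ha
  have hav : a ⬝ᵥ v = 0 := hI.hess_dotProduct_self hf ht
  -- Replacing `f` by `f` plus a suitable multiple of `lin u` keeps the point `grad f v` and turns
  -- the velocity `a` into `a + n`.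
  have key : ∀ n ∈ nrm I v, ∃ r : ℂ, hess F (grad f v) (a + n) = c • t + r • v := by
    rintro _ ⟨k, hk, rfl⟩
    have hk' : C ((u ⬝ᵥ t)⁻¹) * k ∈ I := I.mul_mem_left _ hk
    have hg : f + lin u * (C ((u ⬝ᵥ t)⁻¹) * k) ∈ I := I.add_mem hf (I.mul_mem_left _ hk')
    have hgv : grad (f + lin u * (C ((u ⬝ᵥ t)⁻¹) * k)) v = grad f v := by
      rw [grad_add, grad_lin_mul u _ huv (hI.eval_eq_zero hk' hv), add_zero]
    have hgt : hess (f + lin u * (C ((u ⬝ᵥ t)⁻¹) * k)) v t = a + grad k v := by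
      rw [hess_add_left, hess_lin_mul u _ huv (ht _ hk'), grad_C_mul, smul_smul,
        mul_inv_cancel₀ hut, one_smul]
    have := hI.exists_hess_dualIdeal_eq hF hg hv0 ht (c := c) (by rw [hgv, hc])
    rwa [hgv, hgt] at this
  -- Otherwise `a` is itself normal, the velocity can be shifted to zero, and `c • t + r • v` would
  -- vanish with `c ≠ 0`.
  have hat : a ⬝ᵥ t ≠ 0 := by
    intro hat
    obtain ⟨r, hr⟩ := key (-a) (Submodule.neg_mem _ (hI.mem_nrm_of_dotProduct hv ht hli hav hat))
    rw [add_neg_cancel] at hr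
    have h0 : hess F (grad f v) 0 = 0 := by
      ext i
      simp [hess]
    rw [h0, add_comm] at hr
    exact hc0 (LinearIndependent.pair_iff.1 hli _ _ hr.symm).2
  by_contra hw
  have hwt : w ⬝ᵥ t ≠ 0 := fun h0 =>
    hw (hI.mem_nrm_of_dotProduct hv ht hli (by rw [dotProduct_comm, hvw]) h0)
  have hs : (w ⬝ᵥ t) / (a ⬝ᵥ t) ≠ 0 := div_ne_zero hwt hat
  set s := (w ⬝ᵥ t) / (a ⬝ᵥ t) with hs'
  -- A tangent direction `w` outside the ruling is a multiple of some `a + n`, so its second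
  -- differential is a nonzero multiple of `c * (w ⬝ᵥ t)`.
  have hn : s⁻¹ • w - a ∈ nrm I v := by
    refine hI.mem_nrm_of_dotProduct hv ht hli ?_ ?_
    · rw [sub_dotProduct, smul_dotProduct, hav, dotProduct_comm, hvw, smul_zero, sub_zero]
    · rw [sub_dotProduct, smul_dotProduct, hs', inv_div, smul_eq_mul, div_mul_cancel₀ _ hwt,
        sub_self]
  obtain ⟨r, hr⟩ := key _ hn
  rw [add_sub_cancel, hess_smul] at hr
  have h3 : s⁻¹ * (hess F (grad f v) w ⬝ᵥ w) = c * (w ⬝ᵥ t) := by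
    have := congrArg (· ⬝ᵥ w) hr
    simp only [smul_dotProduct, add_dotProduct, hvw, smul_eq_mul, mul_zero, add_zero] at this
    rw [this, dotProduct_comm t]
  rw [h₂, mul_zero] at h3
  exact mul_ne_zero hc0 hwt h3.symm

/-- A nonempty open set of smooth points of the dual surface. -/
lemma exists_smooth_open : ∃ F ∈ dualIdeal I Z, ∃ Φ ∉ dualIdeal I Z, (∃ d, Φ.IsHomogeneous d) ∧
    ∀ h, eval h Φ ≠ 0 → h ≠ 0 ∧ grad F h ≠ 0 := by
  obtain ⟨F, hF, ⟨d, hd⟩, i, hi⟩ := hI.exists_pderiv_notMem_dualIdeal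
  obtain ⟨v, hv, hv0⟩ := hI.exists_mem_ne_zero
  obtain ⟨h, hh, hh0⟩ := hI.exists_mem_nrm_ne_zero hv hv0
  obtain ⟨j, hj⟩ := Function.ne_iff.1 hh0
  have hX : (X j : MvPolynomial (Fin 4) ℂ) ∉ dualIdeal I Z := fun hmem =>
    hj (by simpa using mem_dualIdeal.1 hmem h ⟨v, hv, hv0, hh⟩)
  -- The factor `X j` excludes the zero vector even when the derivative is constant.
  refine ⟨F, hF, X j * pderiv i F, hI.dualIdeal_isPrime.mul_notMem hX hi,
    ⟨_, (isHomogeneous_X ℂ j).mul (isHomogeneous_pderiv hd i)⟩, fun h hne => ?_⟩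
  rw [map_mul, eval_X] at hne
  constructor
  · rintro rfl
    exact hne (by simp)
  · intro h0
    exact right_ne_zero_of_mul hne (congrFun h0 i)

end IsCurveCone

section curve

variable {C : Set (ProjSpace 3)}

lemma exists_isHomogeneous_grad_ne_zero {I : Ideal (MvPolynomial (Fin 4) ℂ)}
    {Z : Set (Fin 4 → ℂ)} {F : MvPolynomial (Fin 4) ℂ} (hF : F ∈ dualIdeal I Z) {h : Fin 4 → ℂ}
    (hFh : grad F h ≠ 0) : ∃ G ∈ dualIdeal I Z, (∃ d, G.IsHomogeneous d) ∧ grad G h ≠ 0 := by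
  rw [← sum_homogeneousComponent F, grad_sum] at hFh
  obtain ⟨d, -, hd⟩ := Finset.exists_ne_zero_of_sum_ne_zero hFh
  exact ⟨_, homogeneousComponent_mem_dualIdeal hF d,
    ⟨d, homogeneousComponent_isHomogeneous d F⟩, hd⟩

/-- Contact of order three kills the first and second derivatives of an equation along the line, so
every direction of the line is asymptotic and lies in the ruling. -/
lemma mem_nrm_of_multiplicity (hC : IsCurveCone (coneIdeal C) (cone C))
    (hsmooth : ∀ x ∈ C, IsSmoothPoint C x) {L : LineGr 3} {x : ProjSpace 3}
    (hx : IsSmoothPoint (dualVariety C) x) (hL : 3 ≤ lineMultiplicity L (dualVariety C) x) :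
    ∃ v ∈ cone C, v ≠ 0 ∧ L.1 = nrm (coneIdeal C) v := by
  rw [← x.mk_rep, isSmoothPoint_dualVariety_iff hC hsmooth] at hx
  obtain ⟨⟨v, hv, hv0, hh⟩, F', hF', hFh'⟩ := hx
  obtain ⟨F, hF, ⟨d, hd⟩, hFh⟩ := exists_isHomogeneous_grad_ne_zero hF' hFh'
  refine ⟨v, hv, hv0, Submodule.eq_of_le_of_finrank_eq (fun w hw => ?_)
    (by rw [L.2, hC.finrank_nrm hv hv0])⟩
  have hFS : F ∈ homogeneousVanishing (dualVariety C) :=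
    mem_homogeneousVanishing_of_coneIdeal (by rwa [coneIdeal_dualVariety hC hsmooth]) hd
  have h3 : (3 : ℕ∞) ≤ emultiplicity (Polynomial.X : Polynomial ℂ) (restrictToLine F x.rep w) :=
    hL.trans ((iInf₂_le F hFS).trans (iInf₂_le w hw))
  obtain ⟨q, hq⟩ : (Polynomial.X : Polynomial ℂ) ^ 3 ∣ restrictToLine F x.rep w :=
    pow_dvd_of_le_emultiplicity (by exact_mod_cast h3)
  refine hC.mem_nrm_of_hess_eq_zero hF hv hv0 hh hFh ?_ ?_
  · have := eval_derivative_restrictToLine F x.rep w 0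
    rw [zero_smul, add_zero] at this
    rw [← this, hq]
    simp [Polynomial.derivative_mul]
  · rw [← eval_derivative_derivative_restrictToLine, hq]
    simp [Polynomial.derivative_mul]

lemma lineMultiplicity_eq_top {S : Set (ProjSpace 3)} {L : LineGr 3}
    (hL : ∀ w ∈ L.1, w ∈ cone S) {x : ProjSpace 3} (hx : OnLine x L) :
    lineMultiplicity L S x = ⊤ := by
  have hxL : x.rep ∈ L.1 := by
    rw [← onLine_mk x.rep_nonzero, Projectivization.mk_rep]
    exact hx
  simp only [lineMultiplicity, iInf_eq_top]
  intro f hf w hw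
  have h0 : restrictToLine f x.rep w = 0 := Polynomial.funext fun c => by
    rw [eval_restrictToLine, Polynomial.eval_zero]
    exact mem_coneIdeal.1 (homogeneousVanishing_subset_coneIdeal hf) _
      (hL _ (L.1.add_mem hxL (L.1.smul_mem c hw)))
  rw [h0, emultiplicity_zero]

/-- The minors formed by the differentials of two polynomials. -/
def gradMinors (f g : MvPolynomial (Fin 4) ℂ) (p : PluckerIndex 3) : MvPolynomial (Fin 4) ℂ :=
  pderiv p.1.1 f * pderiv p.1.2 g - pderiv p.1.2 f * pderiv p.1.1 g

lemma eval_gradMinors (f g : MvPolynomial (Fin 4) ℂ) (v : Fin 4 → ℂ) :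
    (fun p => eval v (gradMinors f g p)) = minors (grad f v) (grad g v) := by
  ext p
  simp [gradMinors, minors, grad]

/-- A ruling lies in the surface, so its multiplicity is infinite. Only general rulings are shown to
contain a smooth point; the others are reached as limits, since their Plücker coordinates are
polynomial near the given point. -/
lemma perp_tangentLines_subset_Infl (hC : IsCurveCone (coneIdeal C) (cone C))
    (hsmooth : ∀ x ∈ C, IsSmoothPoint C x) :
    perp '' tangentLines C ⊆ Infl (dualVariety C) := by
  intro L hL
  obtain ⟨v, hv, hv0, hLv⟩ := mem_perp_tangentLines_iff.1 hL
  rw [Infl, mem_closure_iff_vanishesAtLine]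
  intro F d hd hF
  obtain ⟨g₁, h₁, g₂, h₂, -, -, hli⟩ := hC.exists_pair hv hv0
  obtain ⟨G, hG, Φ, hΦ, -, hsm⟩ := hC.exists_smooth_open
  rw [hC.mem_dualIdeal_iff] at hΦ
  push Not at hΦ
  obtain ⟨k, hk, hΦk⟩ := hΦ
  obtain ⟨p, hp⟩ := Function.ne_iff.1 (minors_ne_zero hli)
  rw [vanishesAtLine_iff hd (u := grad g₁ v) (v := grad g₂ v)
    (by rw [hC.span_grad_eq hv hv0 h₁ h₂ hli, hLv]), ← eval_gradMinors, ← eval_aeval]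
  refine hC.eval_eq_zero ?_ hv
  have hpI : gradMinors g₁ g₂ p ∉ coneIdeal C := by
    intro hmem
    apply hp
    rw [← eval_gradMinors]
    exact hC.eval_eq_zero hmem hv
  -- The first factor restricts attention to points where the two gradients are independent, the
  -- second to points where the gradient of `k` is smooth on the dual surface.
  refine (hC.isPrime.mem_or_mem ?_).resolve_left (hC.isPrime.mul_notMem hpI hΦk)
  refine hC.mem_of_forall_ne_zero fun w hw hw0 => ?_
  rw [map_mul, map_mul]
  by_cases hz : eval w (gradMinors g₁ g₂ p) = 0
  · rw [hz, zero_mul, zero_mul]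
  by_cases hz' : eval w (aeval (fun i => pderiv i k) Φ) = 0
  · rw [hz', mul_zero, zero_mul]
  refine mul_eq_zero_of_right _ ?_
  rw [eval_aeval] at hz' ⊢
  obtain ⟨hk0, hGk⟩ := hsm _ hz'
  have hliw : LinearIndependent ℂ ![grad g₁ w, grad g₂ w] := by
    refine linearIndependent_of_minors_ne_zero fun h0 => hz ?_
    have := congrFun (eval_gradMinors g₁ g₂ w) p
    rw [h0] at this
    exact this
  rw [eval_gradMinors]
  let M : LineGr 3 := ⟨nrm (coneIdeal C) w, hC.finrank_nrm hw hw0⟩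
  have hMS : ∀ z ∈ M.1, z ∈ cone (dualVariety C) := fun z hz => by
    rw [cone_dualVariety hC hsmooth]
    exact ⟨w, hw, hw0, hz⟩
  have hon : OnLine (Projectivization.mk ℂ _ hk0) M := (onLine_mk hk0).2 (grad_mem_nrm hk w)
  refine (vanishesAtLine_iff hd (L := M) (hC.span_grad_eq hw hw0 h₁ h₂ hliw)).1 (hF M ?_)
  refine ⟨Projectivization.mk ℂ _ hk0, ?_, hon, ?_⟩
  · exact (isSmoothPoint_dualVariety_iff hC hsmooth hk0).2
      ⟨⟨w, hw, hw0, grad_mem_nrm hk w⟩, G, hG, hGk⟩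
  · rw [lineMultiplicity_eq_top hMS hon]
    exact le_top

lemma Infl_dualVariety (hC : IsCurveCone (coneIdeal C) (cone C))
    (hsmooth : ∀ x ∈ C, IsSmoothPoint C x) :
    perp '' tangentLines C = Infl (dualVariety C) := by
  refine (perp_tangentLines_subset_Infl hC hsmooth).antisymm
    (closure_minimal ?_ (isClosed_perp_tangentLines hC))
  rintro L ⟨x, hx, -, hL⟩
  exact mem_perp_tangentLines_iff.2 (mem_nrm_of_multiplicity hC hsmooth hx hL)

end curve

/-! ### Secants and bitangents -/

/-- A covector in the normal space at `x` which also annihilates `y`. -/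
def secNormal (f k : MvPolynomial (Fin 4) ℂ) (x y : Fin 4 → ℂ) : Fin 4 → ℂ :=
  (grad k x ⬝ᵥ y) • grad f x - (grad f x ⬝ᵥ y) • grad k x

/-- The polynomial whose values are those of `secNormal`. -/
def secNormalPoly (f k : MvPolynomial (Fin 4) ℂ) (i : Fin 4) :
    MvPolynomial (Fin 4 ⊕ Fin 4) ℂ :=
  (∑ j, rename Sum.inl (pderiv j k) * X (Sum.inr j)) * rename Sum.inl (pderiv i f)
    - (∑ j, rename Sum.inl (pderiv j f) * X (Sum.inr j)) * rename Sum.inl (pderiv i k)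

lemma eval_secNormalPoly (f k : MvPolynomial (Fin 4) ℂ) (x y : Fin 4 → ℂ) :
    (fun i => eval (Sum.elim x y) (secNormalPoly f k i)) = secNormal f k x y := by
  ext i
  simp [secNormalPoly, secNormal, eval_rename, dotProduct, grad]

lemma secNormal_mem_nrm {I : Ideal (MvPolynomial (Fin 4) ℂ)} {f k : MvPolynomial (Fin 4) ℂ} (hf : f ∈ I) (hk : k ∈ I)
    (x y : Fin 4 → ℂ) : secNormal f k x y ∈ nrm I x :=
  (nrm I x).sub_mem ((nrm I x).smul_mem _ (grad_mem_nrm hf x))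
    ((nrm I x).smul_mem _ (grad_mem_nrm hk x))

namespace IsCurveCone

variable {I : Ideal (MvPolynomial (Fin 4) ℂ)} {Z : Set (Fin 4 → ℂ)} (hI : IsCurveCone I Z)
include hI

/-- The product of the cone with itself is irreducible. -/
lemma exists_eval_elim_ne_zero {A B : MvPolynomial (Fin 4 ⊕ Fin 4) ℂ}
    (hA : ∃ x ∈ Z, ∃ y ∈ Z, eval (Sum.elim x y) A ≠ 0)
    (hB : ∃ x ∈ Z, ∃ y ∈ Z, eval (Sum.elim x y) B ≠ 0) :
    ∃ x ∈ Z, ∃ y ∈ Z, eval (Sum.elim x y) (A * B) ≠ 0 := by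
  obtain ⟨x₁, hx₁, y₁, hy₁, hA⟩ := hA
  obtain ⟨x₂, hx₂, y₂, hy₂, hB⟩ := hB
  have hl : ∀ (P : MvPolynomial (Fin 4 ⊕ Fin 4) ℂ) (x y : Fin 4 → ℂ),
      eval x (aeval (Sum.elim X fun i => C (y i)) P) = eval (Sum.elim x y) P := by
    intro P x y
    rw [eval_aeval]
    congr 2
    ext (i | i) <;> simp
  have hr : ∀ (P : MvPolynomial (Fin 4 ⊕ Fin 4) ℂ) (x y : Fin 4 → ℂ),
      eval y (aeval (Sum.elim (fun i => C (x i)) X) P) = eval (Sum.elim x y) P := by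
    intro P x y
    rw [eval_aeval]
    congr 2
    ext (i | i) <;> simp
  -- With the second points fixed, primality gives a common first point; with that one fixed, it
  -- gives a common second point.
  obtain ⟨x, hx, -, hx'⟩ := hI.exists_eval_ne_zero (hI.isPrime.mul_notMem
    (x := aeval (Sum.elim X fun i => C (y₁ i)) A) (y := aeval (Sum.elim X fun i => C (y₂ i)) B)
    (fun h => hA (by rw [← hl]; exact hI.eval_eq_zero h hx₁))
    (fun h => hB (by rw [← hl]; exact hI.eval_eq_zero h hx₂)))
  rw [map_mul, hl, hl] at hx'
  obtain ⟨y, hy, -, hy'⟩ := hI.exists_eval_ne_zero (hI.isPrime.mul_notMem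
    (x := aeval (Sum.elim (fun i => C (x i)) X) A) (y := aeval (Sum.elim (fun i => C (x i)) X) B)
    (fun h => left_ne_zero_of_mul hx' (by rw [← hr]; exact hI.eval_eq_zero h hy₁))
    (fun h => right_ne_zero_of_mul hx' (by rw [← hr]; exact hI.eval_eq_zero h hy₂)))
  rw [map_mul, hr, hr] at hy'
  exact ⟨x, hx, y, hy, by rwa [map_mul]⟩

/-- The plane through a general secant line that is tangent at one of its points is a general
point of the dual surface. -/
lemma exists_secNormal_eval_ne_zero {Φ : MvPolynomial (Fin 4) ℂ} (hΦ : Φ ∉ dualIdeal I Z)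
    (hd : ∃ d, Φ.IsHomogeneous d) : ∃ f ∈ I, ∃ k ∈ I, ∃ x ∈ Z, ∃ y ∈ Z,
      eval (secNormal f k x y) Φ ≠ 0 := by
  classical
  obtain ⟨d, hd⟩ := hd
  rw [mem_dualIdeal] at hΦ
  push Not at hΦ
  obtain ⟨b', ⟨x, hx, hx0, k, hk, hkb⟩, hb'⟩ := hΦ
  by_cases hb0 : b' = 0
  · have hconst : ∀ z, eval z Φ ≠ 0 := by
      intro z hz
      have := eval_smul_of_isHomogeneous hd 0 z
      rw [zero_smul, hz, mul_zero, ← hb0] at this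
      exact hb' this
    exact ⟨k, hk, k, hk, x, hx, x, hx, hconst _⟩
  obtain ⟨f, hf, hab⟩ : ∃ f ∈ I, LinearIndependent ℂ ![grad f x, grad k x] := by
    by_contra! hcon
    have hle : nrm I x ≤ Submodule.span ℂ {b'} := by
      rintro _ ⟨f, hf, rfl⟩
      have := hcon f hf
      rw [LinearIndependent.pair_symm_iff, hkb, LinearIndependent.pair_iff' hb0] at this
      push Not at this
      obtain ⟨c, hc⟩ := this
      exact Submodule.mem_span_singleton.2 ⟨c, hc⟩
    have := Submodule.finrank_mono hle
    rw [hI.finrank_nrm hx hx0, finrank_span_singleton hb0] at this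
    omega
  refine ⟨f, hf, k, hk, x, hx, ?_⟩
  by_contra! hcon
  set a := grad f x with ha
  set b := grad k x with hb
  set p := restrictToLine Φ (-b) a with hp
  have hp0 : p ≠ 0 := by
    intro h0
    have := eval_restrictToLine Φ (-b) a 0
    rw [← hp, h0, Polynomial.eval_zero, zero_smul, add_zero, ← neg_one_smul ℂ,
      eval_smul_of_isHomogeneous hd, hkb] at this
    exact mul_ne_zero (pow_ne_zero _ (by norm_num)) hb' this.symm
  -- If `Φ` vanished on all these covectors, the ratio of `b ⬝ᵥ y` to `a ⬝ᵥ y` would always be a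
  -- root of `p`. Finitely many planes would cover the curve, and one of them would contain it.
  have hmem : lin a * ∏ r ∈ p.roots.toFinset, lin (b + (-r) • a) ∈ I := by
    rw [hI.mem_iff]
    intro y hy
    rw [map_mul, eval_lin]
    by_cases hay : a ⬝ᵥ y = 0
    · rw [hay, zero_mul]
    refine mul_eq_zero_of_right _ ?_
    rw [map_prod]
    refine Finset.prod_eq_zero (i := (b ⬝ᵥ y) / (a ⬝ᵥ y)) ?_ ?_
    · rw [Multiset.mem_toFinset, Polynomial.mem_roots hp0, Polynomial.IsRoot.def,
        eval_restrictToLine]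
      have h1 : secNormal f k x y = (a ⬝ᵥ y) • (-b + ((b ⬝ᵥ y) / (a ⬝ᵥ y)) • a) := by
        rw [smul_add, smul_smul, mul_div_cancel₀ _ hay, secNormal, smul_neg]
        abel
      have h2 := hcon y hy
      rw [h1, eval_smul_of_isHomogeneous hd] at h2
      exact (mul_eq_zero.1 h2).resolve_left (pow_ne_zero _ hay)
    · rw [eval_lin, add_dotProduct, smul_dotProduct, smul_eq_mul, neg_mul,
        div_mul_cancel₀ _ hay, add_neg_cancel]
  rcases hI.isPrime.mem_or_mem hmem with h | h
  · exact hab.ne_zero 0 (hI.lin_mem_iff.1 h)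
  · have := hI.isPrime
    obtain ⟨r, -, hr⟩ := (Ideal.IsPrime.prod_mem_iff).1 h
    have := LinearIndependent.pair_iff.1 hab (-r) 1
      (by rw [one_smul, add_comm]; exact hI.lin_mem_iff.1 hr)
    exact one_ne_zero this.2

/-- General tangent lines of the curve do not meet. -/
lemma exists_det4_grad_ne_zero : ∃ f ∈ I, ∃ g ∈ I, ∃ x ∈ Z, ∃ y ∈ Z,
    det4 (grad f x) (grad g x) (grad f y) (grad g y) ≠ 0 := by
  obtain ⟨y, hy, hy0⟩ := hI.exists_mem_ne_zero
  obtain ⟨g₁, h₁, g₂, h₂, -, -, hli⟩ := hI.exists_pair hy hy0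
  obtain ⟨c, d, hcd⟩ := exists_det4_ne_zero_of_pair hli
  have hE : gdet g₁ g₂ c d ∉ I := fun h => hcd (by rw [← eval_gdet]; exact hI.eval_eq_zero h hy)
  -- Project from the tangent line at `y`: its ramification is proper, and any unramified `x` has a
  -- tangent line disjoint from that axis.
  obtain ⟨x, hx, -, hne⟩ := hI.exists_eval_ne_zero (hI.gdet_notMem h₁ h₂ hE hli)
  rw [eval_gdet] at hne
  exact ⟨g₁, h₁, g₂, h₂, x, hx, y, hy, hne⟩

lemma disjoint_nrm {f g : MvPolynomial (Fin 4) ℂ} (hf : f ∈ I) (hg : g ∈ I) {x y : Fin 4 → ℂ}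
    (hx : x ∈ Z) (hx0 : x ≠ 0) (hy : y ∈ Z) (hy0 : y ≠ 0)
    (h : det4 (grad f x) (grad g x) (grad f y) (grad g y) ≠ 0) {z : Fin 4 → ℂ}
    (hzx : z ∈ nrm I x) (hzy : z ∈ nrm I y) : z = 0 := by
  have hli := linearIndependent_of_det4_ne_zero h
  have hlix := linearIndependent_left_of_det4_ne_zero h
  have hliy : LinearIndependent ℂ ![grad f y, grad g y] := by
    refine linearIndependent_left_of_det4_ne_zero (c := grad f x) (d := grad g x) ?_
    convert h using 1
    simp only [det4_eq]
    ring
  rw [← hI.span_grad_eq hx hx0 hf hg hlix] at hzx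
  rw [← hI.span_grad_eq hy hy0 hf hg hliy] at hzy
  obtain ⟨r, s, hrs⟩ := Submodule.mem_span_pair.1 hzx
  obtain ⟨t, q, htq⟩ := Submodule.mem_span_pair.1 hzy
  rw [Fintype.linearIndependent_iff] at hli
  have := hli ![r, s, -t, -q] (by
    simp only [Fin.sum_univ_four, Matrix.cons_val, neg_smul]
    rw [hrs, add_assoc, ← neg_add, htq, add_neg_cancel])
  have h0 : r = 0 := this 0
  have h1 : s = 0 := this 1
  rw [← hrs, h0, h1, zero_smul, zero_smul, add_zero]

end IsCurveCone

lemma mk_eq_mk_of_not_linearIndependent {n : ℕ} {x y : Fin (n + 1) → ℂ} (hx : x ≠ 0) (hy : y ≠ 0)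
    (h : ¬ LinearIndependent ℂ ![x, y]) :
    Projectivization.mk ℂ x hx = Projectivization.mk ℂ y hy := by
  rw [LinearIndependent.pair_iff' hx] at h
  push Not at h
  obtain ⟨c, hc⟩ := h
  exact ((Projectivization.mk_eq_mk_iff' ℂ _ _ _ _).2 ⟨c, hc⟩).symm

lemma not_linearIndependent_of_mk_eq_mk {n : ℕ} {x y : Fin (n + 1) → ℂ} (hx : x ≠ 0) (hy : y ≠ 0)
    (h : Projectivization.mk ℂ x hx = Projectivization.mk ℂ y hy) :
    ¬ LinearIndependent ℂ ![x, y] := by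
  rw [LinearIndependent.pair_iff' hx]
  push Not
  obtain ⟨c, hc⟩ := (Projectivization.mk_eq_mk_iff' ℂ _ _ _ _).1 h.symm
  exact ⟨c, hc⟩

section curve

variable {C : Set (ProjSpace 3)}

lemma mem_secant_iff (hsmooth : ∀ x ∈ C, IsSmoothPoint C x) {L : LineGr 3} :
    (∃ x y, x ≠ y ∧ IsSmoothPoint C x ∧ IsSmoothPoint C y ∧ OnLine x L ∧ OnLine y L) ↔
      ∃ x ∈ cone C, ∃ y ∈ cone C, LinearIndependent ℂ ![x, y] ∧ x ∈ L.1 ∧ y ∈ L.1 := by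
  constructor
  · rintro ⟨x, y, hxy, hx, hy, hxL, hyL⟩
    refine ⟨x.rep, rep_mem_cone hx.1, y.rep, rep_mem_cone hy.1, ?_, ?_, ?_⟩
    · by_contra h
      have := mk_eq_mk_of_not_linearIndependent x.rep_nonzero y.rep_nonzero h
      rw [x.mk_rep, y.mk_rep] at this
      exact hxy this
    · rwa [← onLine_mk x.rep_nonzero, x.mk_rep]
    · rwa [← onLine_mk y.rep_nonzero, y.mk_rep]
  · rintro ⟨x, hx, y, hy, hli, hxL, hyL⟩
    have hx0 : x ≠ 0 := hli.ne_zero 0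
    have hy0 : y ≠ 0 := hli.ne_zero 1
    exact ⟨Projectivization.mk ℂ x hx0, Projectivization.mk ℂ y hy0,
      fun h => not_linearIndependent_of_mk_eq_mk hx0 hy0 h hli,
      hsmooth _ ((mem_cone_iff hx0).1 hx), hsmooth _ ((mem_cone_iff hy0).1 hy),
      (onLine_mk hx0).2 hxL, (onLine_mk hy0).2 hyL⟩

lemma IsCurveCone.exists_mem_linearIndependent {I : Ideal (MvPolynomial (Fin 4) ℂ)}
    {Z : Set (Fin 4 → ℂ)} (hI : IsCurveCone I Z) {v : Fin 4 → ℂ} (hv : v ∈ Z) (hv0 : v ≠ 0) :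
    ∃ y ∈ Z, LinearIndependent ℂ ![v, y] := by
  obtain ⟨a, ha, ha0⟩ := hI.exists_mem_nrm_ne_zero hv hv0
  obtain ⟨y, hy, hay⟩ := hI.nondegenerate a ha0
  refine ⟨y, hy, ?_⟩
  rw [LinearIndependent.pair_iff' hv0]
  rintro c rfl
  rw [dotProduct_smul, hI.dotProduct_self_of_mem_nrm hv ha, smul_zero] at hay
  exact hay rfl

lemma nrm_eq_nrm_of_not_linearIndependent {v w : Fin 4 → ℂ} (hv0 : v ≠ 0) (hw0 : w ≠ 0)
    (h : ¬ LinearIndependent ℂ ![v, w]) : nrm (coneIdeal C) v = nrm (coneIdeal C) w := by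
  rw [← orthogonal_tang, ← orthogonal_tang, ← embeddedTangent_eq_tang hv0,
    ← embeddedTangent_eq_tang hw0, mk_eq_mk_of_not_linearIndependent hv0 hw0 h]

/-- A form that vanishes on all secants vanishes on the chords through `v`, hence on their limit. -/
lemma tangentLines_subset_Sec (hC : IsCurveCone (coneIdeal C) (cone C))
    (hsmooth : ∀ x ∈ C, IsSmoothPoint C x) : tangentLines C ⊆ Sec C := by
  intro L hL
  obtain ⟨v, hv, hv0, hLv⟩ := mem_tangentLines_iff.1 hL
  rw [Sec, mem_closure_iff_vanishesAtLine]
  intro F d hd hF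
  obtain ⟨τ, hτ, hli⟩ := hC.exists_vectorField hv hv0
  have ht := hτ v hv hv0
  rw [vanishesAtLine_iff hd (by rw [hC.span_pair_eq_tang hv ht hli, hLv])]
  have hsec : ∀ y ∈ cone C, LinearIndependent ℂ ![v, y] → eval (minors v y) F = 0 := by
    intro y hy hvy
    let M : LineGr 3 := ⟨Submodule.span ℂ {v, y}, finrank_span_pair hvy⟩
    refine (vanishesAtLine_iff hd (L := M) rfl).1 (hF M ((mem_secant_iff hsmooth).2
      ⟨v, hv, y, hy, hvy, Submodule.subset_span (by simp), Submodule.subset_span (by simp)⟩))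
  refine hC.eval_minors_tang hd hv hv0 (fun y hy => ?_) ht
  by_cases hvy : LinearIndependent ℂ ![v, y]
  · exact hsec y hy hvy
  · obtain ⟨z, hz, hvz⟩ := hC.exists_mem_linearIndependent hv hv0
    -- A form of degree zero need not vanish at the origin, so the zero minors are written as a
    -- multiple of those of a genuine chord.
    have h0 : minors v y = (0 : ℂ) • minors v z := by
      rw [zero_smul]
      by_contra hne
      exact hvy (linearIndependent_of_minors_ne_zero hne)
    rw [h0, eval_smul_of_isHomogeneous hd, hsec z hz hvz, mul_zero]

/-- The tangent planes at the two smooth points are dual to `v` and `w`. If these are different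
points of `C`, the dual of `L` is their secant; if not, `L` joins two points of one ruling and its
dual is a tangent line. -/
lemma Bit_subset_perp_Sec (hC : IsCurveCone (coneIdeal C) (cone C))
    (hsmooth : ∀ x ∈ C, IsSmoothPoint C x) : Bit (dualVariety C) ⊆ perp '' Sec C := by
  refine closure_minimal ?_ (by rw [Sec, perp_image_closure]; exact isClosed_closure)
  rintro L ⟨x, y, hxy, hx, hy, hxL, hyL, hLx, hLy⟩
  rw [← x.mk_rep, isSmoothPoint_dualVariety_iff hC hsmooth] at hx
  rw [← y.mk_rep, isSmoothPoint_dualVariety_iff hC hsmooth] at hy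
  obtain ⟨⟨v, hv, hv0, hxv⟩, F, hF, hFx⟩ := hx
  obtain ⟨⟨w, hw, hw0, hyw⟩, G, hG, hGy⟩ := hy
  rw [← x.mk_rep, onLine_mk] at hxL
  rw [← y.mk_rep, onLine_mk] at hyL
  rw [mem_perp_image]
  by_cases hvw : LinearIndependent ℂ ![v, w]
  · refine subset_closure ((mem_secant_iff hsmooth).2 ⟨v, hv, w, hw, hvw, ?_, ?_⟩)
    · refine (mem_dualLine L v).2 fun z hz => ?_
      have := hLx hz
      rwa [← x.mk_rep, mem_embeddedTangent_dualVariety hC hsmooth hF hv hv0 hxv hFx] at this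
    · refine (mem_dualLine L w).2 fun z hz => ?_
      have := hLy hz
      rwa [← y.mk_rep, mem_embeddedTangent_dualVariety hC hsmooth hG hw hw0 hyw hGy] at this
  · refine tangentLines_subset_Sec hC hsmooth ?_
    rw [← mem_perp_image, mem_perp_tangentLines_iff]
    refine ⟨v, hv, hv0, ?_⟩
    rw [← nrm_eq_nrm_of_not_linearIndependent hv0 hw0 hvw] at hyw
    have hli : LinearIndependent ℂ ![x.rep, y.rep] := by
      by_contra h
      have := mk_eq_mk_of_not_linearIndependent x.rep_nonzero y.rep_nonzero h
      rw [x.mk_rep, y.mk_rep] at this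
      exact hxy this
    rw [← span_pair_eq_of_mem hli L.2 hxL hyL,
      span_pair_eq_of_mem hli (hC.finrank_nrm hv hv0) hxv hyw]

lemma secNormal_dotProduct (f k : MvPolynomial (Fin 4) ℂ) (x y : Fin 4 → ℂ) :
    secNormal f k x y ⬝ᵥ y = 0 := by
  rw [secNormal, sub_dotProduct, smul_dotProduct, smul_dotProduct, smul_eq_mul, smul_eq_mul]
  ring

/-- The minors of two vectors of indeterminates. -/
def genericMinors (p : PluckerIndex 3) : MvPolynomial (Fin 4 ⊕ Fin 4) ℂ :=
  X (Sum.inl p.1.1) * X (Sum.inr p.1.2) - X (Sum.inl p.1.2) * X (Sum.inr p.1.1)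

lemma eval_genericMinors (x y : Fin 4 → ℂ) :
    (fun p => eval (Sum.elim x y) (genericMinors p)) = minors x y := by
  ext p
  simp [genericMinors, minors]

/-- The determinant of the differentials of two polynomials at two points. -/
def tangentDet (f g : MvPolynomial (Fin 4) ℂ) : MvPolynomial (Fin 4 ⊕ Fin 4) ℂ :=
  det4 (fun i => rename Sum.inl (pderiv i f)) (fun i => rename Sum.inl (pderiv i g))
    (fun i => rename Sum.inr (pderiv i f)) (fun i => rename Sum.inr (pderiv i g))

lemma eval_tangentDet (f g : MvPolynomial (Fin 4) ℂ) (x y : Fin 4 → ℂ) :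
    eval (Sum.elim x y) (tangentDet f g)
      = det4 (grad f x) (grad g x) (grad f y) (grad g y) := by
  rw [tangentDet, map_det4]
  congr 1 <;> ext i <;> simp [eval_rename, grad]

lemma perp_Sec_subset_Bit (hC : IsCurveCone (coneIdeal C) (cone C))
    (hsmooth : ∀ x ∈ C, IsSmoothPoint C x) : perp '' Sec C ⊆ Bit (dualVariety C) := by
  have hsub : Sec C ⊆ perp '' Bit (dualVariety C) := by
    rw [Bit, perp_image_closure]
    refine closure_minimal ?_ isClosed_closure
    intro L hL
    obtain ⟨x₀, hx₀, y₀, hy₀, hli₀, hxL, hyL⟩ := (mem_secant_iff hsmooth).1 hL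
    rw [mem_closure_iff_vanishesAtLine]
    intro F d hd hF
    rw [vanishesAtLine_iff hd (span_pair_eq_of_mem hli₀ L.2 hxL hyL)]
    obtain ⟨G, hG, Φ, hΦ, hΦh, hsm⟩ := hC.exists_smooth_open
    obtain ⟨f, hf, k, hk, x₁, hx₁, y₁, hy₁, hne₁⟩ := hC.exists_secNormal_eval_ne_zero hΦ hΦh
    obtain ⟨g₁, h₁, g₂, h₂, x₂, hx₂, y₂, hy₂, hne₂⟩ := hC.exists_det4_grad_ne_zero
    by_contra hne₀
    set A := aeval (secNormalPoly f k) Φ with hA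
    have hAe : ∀ x y, eval (Sum.elim x y) A = eval (secNormal f k x y) Φ := by
      intro x y
      rw [hA, eval_aeval, eval_secNormalPoly]
    have hswap : ∀ x y, eval (Sum.elim x y) (rename Sum.swap A)
        = eval (secNormal f k y x) Φ := by
      intro x y
      rw [eval_rename, ← hAe]
      congr 2
      ext (i | i) <;> rfl
    have hQ : ∀ x y, eval (Sum.elim x y) (aeval genericMinors F) = eval (minors x y) F := by
      intro x y
      rw [eval_aeval, eval_genericMinors]
    -- If `F` were nonzero on the given secant, irreducibility of the product would give a secant on
    -- which `F` is nonzero, whose end points have disjoint tangent lines and for which both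
    -- covectors `a` and `b` are smooth points of the dual surface. Its dual is then bitangent.
    obtain ⟨x, hx, y, hy, hne⟩ := hC.exists_eval_elim_ne_zero
      (hC.exists_eval_elim_ne_zero (A := aeval genericMinors F) (B := tangentDet g₁ g₂)
        ⟨x₀, hx₀, y₀, hy₀, by rwa [hQ]⟩ ⟨x₂, hx₂, y₂, hy₂, by rwa [eval_tangentDet]⟩)
      (hC.exists_eval_elim_ne_zero (A := A) (B := rename Sum.swap A)
        ⟨x₁, hx₁, y₁, hy₁, by rwa [hAe]⟩ ⟨y₁, hy₁, x₁, hx₁, by rwa [hswap]⟩)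
    rw [map_mul, map_mul, map_mul, hQ, eval_tangentDet, hAe, hswap] at hne
    have hFxy := left_ne_zero_of_mul (left_ne_zero_of_mul hne)
    have hdet := right_ne_zero_of_mul (left_ne_zero_of_mul hne)
    obtain ⟨ha0, haG⟩ := hsm _ (left_ne_zero_of_mul (right_ne_zero_of_mul hne))
    obtain ⟨hb0, hbG⟩ := hsm _ (right_ne_zero_of_mul (right_ne_zero_of_mul hne))
    set a := secNormal f k x y with ha
    set b := secNormal f k y x with hb
    have hx0 : x ≠ 0 := fun h0 => hb0 (by
      rw [hb, h0, secNormal, dotProduct_zero, dotProduct_zero, zero_smul, zero_smul, sub_zero])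
    have hy0 : y ≠ 0 := fun h0 => ha0 (by
      rw [ha, h0, secNormal, dotProduct_zero, dotProduct_zero, zero_smul, zero_smul, sub_zero])
    have hax : a ∈ nrm (coneIdeal C) x := secNormal_mem_nrm hf hk x y
    have hby : b ∈ nrm (coneIdeal C) y := secNormal_mem_nrm hf hk y x
    have hax0 := hC.dotProduct_self_of_mem_nrm hx hax
    have hby0 := hC.dotProduct_self_of_mem_nrm hy hby
    have hay0 : a ⬝ᵥ y = 0 := secNormal_dotProduct f k x y
    have hbx0 : b ⬝ᵥ x = 0 := secNormal_dotProduct f k y x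
    have hab : LinearIndependent ℂ ![a, b] := by
      rw [LinearIndependent.pair_iff' ha0]
      rintro c hc
      exact hb0 (hC.disjoint_nrm h₁ h₂ hx hx0 hy hy0 hdet
        (hc ▸ (nrm (coneIdeal C) x).smul_mem c hax) hby)
    have hxy : LinearIndependent ℂ ![x, y] := by
      by_contra hxy
      refine ha0 (hC.disjoint_nrm h₁ h₂ hx hx0 hy hy0 hdet hax ?_)
      rwa [nrm_eq_nrm_of_not_linearIndependent hx0 hy0 hxy] at hax
    let M : LineGr 3 := ⟨Submodule.span ℂ {x, y}, finrank_span_pair hxy⟩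
    have hperpM : ∀ z, z ∈ (perp M).1 → x ⬝ᵥ z = 0 ∧ y ⬝ᵥ z = 0 := by
      intro z hz
      have := (mem_dualLine M z).1 hz
      exact ⟨by rw [dotProduct_comm]; exact this x (Submodule.subset_span (by simp)),
        by rw [dotProduct_comm]; exact this y (Submodule.subset_span (by simp))⟩
    have hmemM : ∀ z, z ⬝ᵥ x = 0 → z ⬝ᵥ y = 0 → z ∈ (perp M).1 := by
      intro z hzx hzy
      refine (mem_dualLine M z).2 fun u hu => ?_
      obtain ⟨r, s, rfl⟩ := Submodule.mem_span_pair.1 hu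
      rw [dotProduct_add, dotProduct_smul, dotProduct_smul, hzx, hzy, smul_zero, smul_zero,
        add_zero]
    refine hFxy ((vanishesAtLine_iff hd (L := M) rfl).1 (hF M (mem_perp_image.2 ?_)))
    refine ⟨Projectivization.mk ℂ a ha0, Projectivization.mk ℂ b hb0,
      fun h => not_linearIndependent_of_mk_eq_mk ha0 hb0 h hab,
      (isSmoothPoint_dualVariety_iff hC hsmooth ha0).2 ⟨⟨x, hx, hx0, hax⟩, G, hG, haG⟩,
      (isSmoothPoint_dualVariety_iff hC hsmooth hb0).2 ⟨⟨y, hy, hy0, hby⟩, G, hG, hbG⟩,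
      (onLine_mk ha0).2 (hmemM a hax0 hay0), (onLine_mk hb0).2 (hmemM b hbx0 hby0),
      fun z hz => ?_, fun z hz => ?_⟩
    · rw [mem_embeddedTangent_dualVariety hC hsmooth hG hx hx0 hax haG]
      exact (hperpM z hz).1
    · rw [mem_embeddedTangent_dualVariety hC hsmooth hG hy hy0 hby hbG]
      exact (hperpM z hz).2
  rintro _ ⟨L, hL, rfl⟩
  exact mem_perp_image.1 (hsub hL)

end curve

end SpaceCurve

end

theorem mainTheorem8 (C : Set (SpaceCurve.ProjSpace 3))
    (hC : SpaceCurve.IsIrreducibleCurve C)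
    (hsmooth : ∀ x ∈ C, SpaceCurve.IsSmoothPoint C x)
    (hnd : SpaceCurve.IsNondegenerate C) :
    SpaceCurve.perp '' SpaceCurve.Sec C = SpaceCurve.Bit (SpaceCurve.dualVariety C) ∧
    SpaceCurve.perp '' SpaceCurve.tangentLines C = SpaceCurve.Infl (SpaceCurve.dualVariety C) ∧
    SpaceCurve.Infl (SpaceCurve.dualVariety C) ⊆ SpaceCurve.Bit (SpaceCurve.dualVariety C) := by
  have hI := SpaceCurve.isCurveCone hC hsmooth hnd
  have hBit := (SpaceCurve.perp_Sec_subset_Bit hI hsmooth).antisymm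
    (SpaceCurve.Bit_subset_perp_Sec hI hsmooth)
  have hInfl := SpaceCurve.Infl_dualVariety hI hsmooth
  refine ⟨hBit, hInfl, ?_⟩
  rw [← hBit, ← hInfl]
  exact Set.image_mono (SpaceCurve.tangentLines_subset_Sec hI hsmooth)
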